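/- Conventions. For a Lie group $G$ with Lie algebra $\mathfrak g=T_1G$ equipped with an $\mathrm{Ad}$-invariant positive definite inner product $(\cdot\,|\,\cdot)$, let $\theta^L_g(\xi)=g^{-1}.\xi$ and $\theta^R_g(\xi)=\xi.g^{-1}$ be the Maurer–Cartan $1$-forms, and let $\chi$ be the left-invariant $3$-form on $G$ with $\chi_1(X,Y,Z)=\frac12(X\,|\,[Y,Z])$. If $G$ acts smoothly on a manifold $M$, put $X^{\#}_x=\frac{d}{dt}\big|_{t=0}\exp(tX).x$ for $X\in\mathfrak g$. A quasi-Hamiltonian $G$-space is a triple $(M,\omega,\mu:M\to G)$ consisting of a manifold $M$ with a smooth $G$-action, a $G$-invariant smooth $2$-form $\omega$, and a smooth map $\mu$ that is equivariant for the conjugacy action of $G$ on itself, such that (i) $d\omega=-\mu^*\chi$; (ii) for all $x\in M$, $\ker\omega_x=\{X^{\#}_x : X\in\mathfrak g,\ (\mathrm{Ad}\,\mu(x)+\mathrm{Id})X=0\}$; (iii) for all $X\in\mathfrak g$, $\iota_{X^{\#}}\omega=\frac12\mu^*(\theta^L+\theta^R\,|\,X)$. Theorem. Let $U$ be a compact connected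 Lie group whose Lie algebra is equipped with an $\mathrm{Ad}$-invariant positive definite inner product, and let $(M,\omega,\mu:M\to U)$ be a quasi-Hamiltonian $U$-space. Let $K\subset U$ be a closed subgroup, let $\mathcal N(K)$ be its normalizer in $U$ (with its structure of embedded Lie subgroup), and let $p_K:\mathcal N(K)\to L_K:=\mathcal N(K)/K$ be the projection onto the quotient Lie group. Equip $\mathrm{Lie}(L_K)=\mathrm{Lie}(\mathcal N(K))/\mathrm{Lie}(K)$ with the inner product obtained by identifying it with the orthogonal complement of $\mathrm{Lie}(K)$ in $\mathrm{Lie}(\mathcal N(K))$; this inner product is $\mathrm{Ad}$-invariant. Let $M_K=\{x\in M : U_x=K\}$, where $U_x$ is the stabilizer of $x$. Then: 1. $L_K$ is a compact Lie group, and the action of $\mathcal N(K)$ on $M_K$ induces a free action of $L_K$ on $M_K$. 2. $\mu(M_K)\subset\mathcal N(K)$. 3. $M_K$ is an embedded submanifold of $M$ (whose connected components may have different dimensions: it is the disjoint union of open $L_K$-stable subsets $M_K^{(d)}$, $d\in\mathbb N$, each an embedded submanifold of $M$ of dimension $d$), and $(M_K,\ \omega|_{M_K},\ p_K\circ\mu|_{M_K})$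 is a quasi-Hamiltonian $L_K$-space, that is, each $M_K^{(d)}$ with the restrictions of these data is one. -/

import Mathlib

open scoped Manifold ContDiff

noncomputable section

namespace QHam

section LieGroups

variable {F : Type*} [NormedAddCommGroup F] [NormedSpace ℝ F]
  {G : Type*} [TopologicalSpace G] [ChartedSpace F G] [Group G]

/-- The adjoint action `Ad g` on the Lie algebra `T₁ G`: the differential at `1` of
`h ↦ g h g⁻¹` (a map from `T₁ G` to `T_{g 1 g⁻¹} G = T₁ G`). -/
def Ad (g : G) : GroupLieAlgebra 𝓘(ℝ, F) G →L[ℝ] GroupLieAlgebra 𝓘(ℝ, F) G :=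
  mfderiv 𝓘(ℝ, F) 𝓘(ℝ, F) (fun h : G => g * h * g⁻¹) 1

/-- The left-invariant Maurer-Cartan form: `θᴸ_u(ξ) = u⁻¹.ξ`, an element of
`T_{u⁻¹ u} G = T₁ G`. -/
def thetaL (u : G) : TangentSpace 𝓘(ℝ, F) u →L[ℝ] GroupLieAlgebra 𝓘(ℝ, F) G :=
  mfderiv 𝓘(ℝ, F) 𝓘(ℝ, F) (fun h : G => u⁻¹ * h) u

/-- The right-invariant Maurer-Cartan form: `θᴿ_u(ξ) = ξ.u⁻¹`, an element of
`T_{u u⁻¹} G = T₁ G`. -/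
def thetaR (u : G) : TangentSpace 𝓘(ℝ, F) u →L[ℝ] GroupLieAlgebra 𝓘(ℝ, F) G :=
  mfderiv 𝓘(ℝ, F) 𝓘(ℝ, F) (fun h : G => h * u⁻¹) u

/-- `B` is an `Ad`-invariant positive definite inner product on the Lie algebra of `G`. -/
structure IsAdInvariantInner (B : LinearMap.BilinForm ℝ (GroupLieAlgebra 𝓘(ℝ, F) G)) :
    Prop where
  symm : ∀ X Y, B X Y = B Y X
  pos : ∀ X, X ≠ 0 → 0 < B X X
  ad_invariant : ∀ (g : G) X Y, B (Ad g X) (Ad g Y) = B X Y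

/-- Half the Cartan `3`-form of `(G, B)`: the left-invariant `3`-form with
`χ₁(X, Y, Z) = (X | [Y, Z]) / 2`. -/
def cartan (B : LinearMap.BilinForm ℝ (GroupLieAlgebra 𝓘(ℝ, F) G)) (u : G)
    (ξ η ζ : TangentSpace 𝓘(ℝ, F) u) : ℝ :=
  (1 / 2 : ℝ) * B (thetaL u ξ) ⁅thetaL u η, thetaL u ζ⁆

/-- The linear map between Lie algebras induced by a (smooth) homomorphism of Lie groups: its
differential at `1`. -/
def lieMap {F' : Type*} [NormedAddCommGroup F'] [NormedSpace ℝ F']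
    {G' : Type*} [TopologicalSpace G'] [ChartedSpace F' G'] [Group G'] (f : G →* G') :
    GroupLieAlgebra 𝓘(ℝ, F) G →L[ℝ] GroupLieAlgebra 𝓘(ℝ, F') G' :=
  mfderiv 𝓘(ℝ, F) 𝓘(ℝ, F') f 1

/-- Let `i : H → G` be the inclusion of a Lie subgroup, `p : H → Q` a quotient map of Lie groups
and `B` an inner product on `Lie(G)`. Then `Lie(Q) = Lie(H) / ker(dp)`, where `ker(dp)` is the Lie
algebra of the kernel of `p`. The form `B'` on `Lie(Q)` is the quotient inner product: it
corresponds to the restriction of `B` under the identification of `Lie(Q)` with the orthogonal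
complement of `ker(dp)` in `Lie(H)`. -/
def IsQuotientInner (B : LinearMap.BilinForm ℝ (GroupLieAlgebra 𝓘(ℝ, F) G))
    {F₁ : Type*} [NormedAddCommGroup F₁] [NormedSpace ℝ F₁]
    {H : Type*} [TopologicalSpace H] [ChartedSpace F₁ H] [Group H]
    {F₂ : Type*} [NormedAddCommGroup F₂] [NormedSpace ℝ F₂]
    {Q : Type*} [TopologicalSpace Q] [ChartedSpace F₂ Q] [Group Q]
    (i : H →* G) (p : H →* Q) (B' : LinearMap.BilinForm ℝ (GroupLieAlgebra 𝓘(ℝ, F₂) Q)) :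
    Prop :=
  ∀ X Y : GroupLieAlgebra 𝓘(ℝ, F₁) H,
    (∀ Z : GroupLieAlgebra 𝓘(ℝ, F₁) H,
      (lieMap p Z : GroupLieAlgebra 𝓘(ℝ, F₂) Q) = 0 →
        B (lieMap i X) (lieMap i Z) = 0 ∧ B (lieMap i Y) (lieMap i Z) = 0) →
    B' (lieMap p X) (lieMap p Y) = B (lieMap i X) (lieMap i Y)

end LieGroups

section Forms

variable {E : Type*} [NormedAddCommGroup E] [NormedSpace ℝ E]
  {M : Type*} [TopologicalSpace M] [ChartedSpace E M] {k : ℕ}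

variable (E M k) in
/-- A (not necessarily continuous) field of alternating `k`-forms on the tangent spaces. -/
abbrev FormField : Type _ := ∀ x : M, TangentSpace 𝓘(ℝ, E) x [⋀^Fin k]→L[ℝ] ℝ

/-- The expression of a `k`-form in the preferred chart around `x₀`: its pull-back under the
inverse of the chart. It is meaningful on the (open) target of the chart. -/
def FormField.inChart (σ : FormField E M k) (x₀ : M) : E → E [⋀^Fin k]→L[ℝ] ℝ := fun y =>
  (σ ((extChartAt 𝓘(ℝ, E) x₀).symm y)).compContinuousLinearMap
    (mfderiv 𝓘(ℝ, E) 𝓘(ℝ, E) (extChartAt 𝓘(ℝ, E) x₀).symm y)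

/-- A smooth differential form: all its expressions in charts are smooth. -/
def FormField.IsSmooth (σ : FormField E M k) : Prop :=
  ∀ x₀ : M, ContDiffOn ℝ ∞ (σ.inChart x₀) (extChartAt 𝓘(ℝ, E) x₀).target

/-- The exterior derivative of a differential form, computed at `x` in the chart at `x`. -/
def FormField.d (σ : FormField E M k) : FormField E M (k + 1) := fun x =>
  (extDeriv (σ.inChart x) (extChartAt 𝓘(ℝ, E) x x)).compContinuousLinearMap
    (mfderiv 𝓘(ℝ, E) 𝓘(ℝ, E) (extChartAt 𝓘(ℝ, E) x) x)

/-- The pull-back of a differential form under a (smooth) map. -/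
def FormField.pullback {E' : Type*} [NormedAddCommGroup E'] [NormedSpace ℝ E']
    {S : Type*} [TopologicalSpace S] [ChartedSpace E' S] (σ : FormField E M k) (f : S → M) :
    FormField E' S k := fun s =>
  (σ (f s)).compContinuousLinearMap (mfderiv 𝓘(ℝ, E') 𝓘(ℝ, E) f s)

end Forms

section QuasiHamiltonian

variable {F : Type*} [NormedAddCommGroup F] [NormedSpace ℝ F]
  {G : Type*} [TopologicalSpace G] [ChartedSpace F G] [Group G]
  {E : Type*} [NormedAddCommGroup E] [NormedSpace ℝ E]
  {M : Type*} [TopologicalSpace M] [ChartedSpace E M] [MulAction G M]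

/-- The value at `x` of the fundamental vector field of `X`: the derivative of
`t ↦ exp(tX).x` at `0`, that is, the differential of `g ↦ g.x` at `1` applied to `X`. -/
def fundamental (X : GroupLieAlgebra 𝓘(ℝ, F) G) (x : M) : TangentSpace 𝓘(ℝ, E) x :=
  (mfderiv 𝓘(ℝ, F) 𝓘(ℝ, E) (fun g : G => g • x) 1 X : TangentSpace 𝓘(ℝ, E) ((1 : G) • x))

/-- `(M, σ, μ : M → G)` is a quasi-Hamiltonian space for the given action of the Lie group `G`
whose Lie algebra carries the inner product `B`. -/
structure IsQuasiHamiltonian (B : LinearMap.BilinForm ℝ (GroupLieAlgebra 𝓘(ℝ, F) G))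
    (σ : FormField E M 2) (μ : M → G) : Prop where
  smooth_action : ContMDiffSMul 𝓘(ℝ, F) 𝓘(ℝ, E) ∞ G M
  smooth_form : σ.IsSmooth
  smooth_momentum : ContMDiff 𝓘(ℝ, E) 𝓘(ℝ, F) ∞ μ
  /-- the `2`-form is invariant -/
  invariant : ∀ g : G, σ.pullback (fun x : M => g • x) = σ
  /-- `μ` is equivariant for the conjugacy action of `G` on itself -/
  equivariant : ∀ (g : G) (x : M), μ (g • x) = g * μ x * g⁻¹
  /-- `dσ = - μ^* χ` -/
  d_form : ∀ (x : M) (v : Fin 3 → TangentSpace 𝓘(ℝ, E) x),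
    σ.d x v = - cartan B (μ x) (mfderiv 𝓘(ℝ, E) 𝓘(ℝ, F) μ x (v 0))
      (mfderiv 𝓘(ℝ, E) 𝓘(ℝ, F) μ x (v 1)) (mfderiv 𝓘(ℝ, E) 𝓘(ℝ, F) μ x (v 2))
  /-- `ker σ_x = {X^#_x : (Ad μ(x) + Id).X = 0}` -/
  ker_form : ∀ (x : M) (v : TangentSpace 𝓘(ℝ, E) x),
    (∀ w : TangentSpace 𝓘(ℝ, E) x, σ x ![v, w] = 0) ↔
      ∃ X : GroupLieAlgebra 𝓘(ℝ, F) G, Ad (μ x) X + X = 0 ∧ fundamental X x = v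
  /-- `ι_{X^#} σ = μ^* (θᴸ + θᴿ | X) / 2` -/
  momentum : ∀ (X : GroupLieAlgebra 𝓘(ℝ, F) G) (x : M) (v : TangentSpace 𝓘(ℝ, E) x),
    σ x ![fundamental X x, v] =
      (1 / 2 : ℝ) * B (thetaL (μ x) (mfderiv 𝓘(ℝ, E) 𝓘(ℝ, F) μ x v) +
        thetaR (μ x) (mfderiv 𝓘(ℝ, E) 𝓘(ℝ, F) μ x v)) X

end QuasiHamiltonian

section Isotropy

variable {G : Type*} [Group G]

/-- The normalizer `N(K)`. -/
abbrev Nor (K : Subgroup G) : Subgroup G := Subgroup.normalizer (K : Set G)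

/-- The quotient group `L_K = N(K)/K`. -/
abbrev LK (K : Subgroup G) : Type _ := Nor K ⧸ K.subgroupOf (Nor K)

/-- The projection `p_K : N(K) → L_K`. -/
abbrev pK (K : Subgroup G) : Nor K →* LK K := QuotientGroup.mk' (K.subgroupOf (Nor K))

/-- The set `M_K` of points with stabilizer exactly `K`. -/
def Isotropy (M : Type*) [MulAction G M] (K : Subgroup G) : Set M :=
  {x | MulAction.stabilizer G x = K}

variable {M : Type*} [MulAction G M] {K : Subgroup G}

theorem smul_mem_isotropy (n : Nor K) {x : M} (hx : x ∈ Isotropy M K) :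
    (n : G) • x ∈ Isotropy M K := by
  have hx' : MulAction.stabilizer G x = K := hx
  ext g
  have h1 : (g * (n : G)) • x = (n : G) • x ↔ ((n : G)⁻¹ * g * (n : G)) • x = x := by
    rw [mul_assoc, mul_smul (n : G)⁻¹, inv_smul_eq_iff]
  have h2 := Subgroup.mem_normalizer_iff.1 n.2 ((n : G)⁻¹ * g * (n : G))
  rw [MulAction.mem_stabilizer_iff, ← mul_smul, h1, ← MulAction.mem_stabilizer_iff, hx']
  simpa [mul_assoc] using h2

/-- `N(K)` acts on `M_K` by restriction of the action of `G` on `M`. -/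
instance instNorAction : MulAction (Nor K) (Isotropy M K) where
  smul n x := ⟨(n : G) • (x : M), smul_mem_isotropy n x.2⟩
  one_smul x := Subtype.ext (one_smul G (x : M))
  mul_smul a b x := Subtype.ext (mul_smul (a : G) (b : G) (x : M))

theorem subgroupOf_le_ker :
    K.subgroupOf (Nor K) ≤ (MulAction.toPermHom (Nor K) (Isotropy M K)).ker := by
  intro k hk
  rw [MonoidHom.mem_ker]
  ext x
  have hx : MulAction.stabilizer G (x : M) = K := x.2
  have hk' : (k : G) ∈ MulAction.stabilizer G (x : M) := by
    rw [hx]; exact Subgroup.mem_subgroupOf.1 hk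
  exact hk'

/-- The induced action of `L_K = N(K)/K` on `M_K`. -/
instance instLKAction : MulAction (LK K) (Isotropy M K) :=
  MulAction.compHom (Isotropy M K)
    (QuotientGroup.lift (K.subgroupOf (Nor K)) (MulAction.toPermHom (Nor K) (Isotropy M K))
      subgroupOf_le_ker)

theorem pK_smul (n : Nor K) (x : Isotropy M K) : ((pK K n • x : Isotropy M K) : M) = (n : G) • (x : M) :=
  rfl

end Isotropy

end QHam

end

/-! Equivariance settles the second assertion: for `x` in `M_K` and `k` in `K`, `k μ(x) k⁻¹ = μ(k x)
= μ(x)`, so `μ(x)` centralizes `K`. Freeness of the `L_K`-action only says that stabilizers of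
points of `M_K` equal `K`.

Smooth structure of `M_K`. Averaging a chart over `K` makes the `K`-action linear near `x`
(`exists_linearization`), and near `x` a point fixed by `K` has no stabilizer larger than `K`
(`eventually_stabilizer`). Hence `M_K` is, near `x`, the preimage of the linear subspace `(T_x
M)^K`. The dimension of this space is locally constant on `M_K` and cuts it into strata
(`isotropy_local_structure`), whose tangent spaces are the fixed spaces (`range_mD_stratum`).

Lie structures on `N(K)` and `L_K`. These come without the exponential map. For `H` closed, average
over `H` a nonnegative smooth function with zero set `H`. The left translates of the average form a
left-invariant family, which therefore has constant rank; finitely many of them give a submersion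
whose fibres are locally the cosets of `H` (`exists_coset_submersion`). This one submersion makes
`H` a submanifold and the coset space a quotient manifold. Throughout, `Lie(K)` appears as the
kernel of the differential of `p_K`.

Form and momentum map. For `v` tangent to `M_K` let `ξ = θᴸ(dμ(v))`, an element of `Lie(N(K))`. If
`Z` is in `Lie(K)`, then `Z^#` vanishes at `x` and `Ad μ(x)` fixes `Z`, so the momentum identity
reads `0 = (ξ + Ad μ(x) ξ | Z)/2 = (ξ | Z)` (`norForm_logMom_eq_zero`). This orthogonality allows
the quotient inner product in the formula for `dω`. In the momentum identity it is instead the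
generator, lifted orthogonally to `Lie(K)`, that allows it.

Kernel. An invariant form pairs a `K`-fixed vector with `w` only through the average of `w`, so the
kernel of the restricted form consists of the fixed vectors in the kernel of `ω`
(`ev_eq_zero_of_fixed`). A generator of such a vector can be averaged under `Ad K`; it still solves
`(Ad μ(x) + Id) X = 0` and has become tangent to `N(K)` (`exists_fixed_generator`,
`fixedVectors_conj_le`). Conversely, if `X` in `Lie(L_K)` solves the equation for `p_K(μ(x))` and
`Y` is its orthogonal lift, then `Ad μ(x) Y + Y` lies in `Lie(K)` and is orthogonal to it, hence
vanishes (`ker_form_pullback`). -/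

noncomputable section

namespace QHam
open Set Filter Topology Function IsManifold

/-! ### Differentials as linear maps between the fixed model spaces. -/

section Derivative

variable {E : Type*} [NormedAddCommGroup E] [NormedSpace ℝ E]
  {M : Type*} [TopologicalSpace M] [ChartedSpace E M]
  {E' : Type*} [NormedAddCommGroup E'] [NormedSpace ℝ E']
  {M' : Type*} [TopologicalSpace M'] [ChartedSpace E' M']
  {E'' : Type*} [NormedAddCommGroup E''] [NormedSpace ℝ E'']
  {M'' : Type*} [TopologicalSpace M''] [ChartedSpace E'' M'']

variable (E E') in
/-- The differential of a map of manifolds, as a linear map between the model spaces. -/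
def mD (f : M → M') (x : M) : E →L[ℝ] E' := mfderiv 𝓘(ℝ, E) 𝓘(ℝ, E') f x

theorem mD_comp {g : M' → M''} {f : M → M'} (x : M)
    (hg : MDifferentiableAt 𝓘(ℝ, E') 𝓘(ℝ, E'') g (f x))
    (hf : MDifferentiableAt 𝓘(ℝ, E) 𝓘(ℝ, E') f x) :
    mD E E'' (fun y => g (f y)) x = (mD E' E'' g (f x)).comp (mD E E' f x) :=
  mfderiv_comp x hg hf

theorem mD_comp_apply {g : M' → M''} {f : M → M'} (x : M)
    (hg : MDifferentiableAt 𝓘(ℝ, E') 𝓘(ℝ, E'') g (f x))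
    (hf : MDifferentiableAt 𝓘(ℝ, E) 𝓘(ℝ, E') f x) (v : E) :
    mD E E'' (fun y => g (f y)) x v = mD E' E'' g (f x) (mD E E' f x v) := by
  rw [mD_comp x hg hf]; rfl

theorem mD_congr {f g : M → M'} {x : M} (h : f =ᶠ[𝓝 x] g) : mD E E' f x = mD E E' g x :=
  h.mfderiv_eq

theorem mD_id (x : M) : mD E E (fun y : M => y) x = ContinuousLinearMap.id ℝ E :=
  mfderiv_id

theorem mD_const (c : M') (x : M) : mD E E' (fun _ : M => c) x = 0 :=
  mfderiv_const

theorem mD_eq_fderiv (f : E → E') (x : E) : mD E E' f x = fderiv ℝ f x :=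
  mfderiv_eq_fderiv

/-- The tangent space at `x` is the model space by way of the preferred chart at `x`, so this chart
reads as the identity there. Later computations drop chart differentials at base points for this
reason. -/
theorem mD_extChartAt_self [IsManifold 𝓘(ℝ, E) ∞ M] (x : M) :
    mD E E (extChartAt 𝓘(ℝ, E) x) x = ContinuousLinearMap.id ℝ E := by
  have h : MDifferentiableAt 𝓘(ℝ, E) 𝓘(ℝ, E) (extChartAt 𝓘(ℝ, E) x) x :=
    (contMDiffAt_extChartAt (n := ∞) (x := x)).mdifferentiableAt (by simp)
  have : HasFDerivAt (writtenInExtChartAt 𝓘(ℝ, E) 𝓘(ℝ, E) x (extChartAt 𝓘(ℝ, E) x))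
      (ContinuousLinearMap.id ℝ E) (extChartAt 𝓘(ℝ, E) x x) := by
    refine (hasFDerivAt_id _).congr_of_eventuallyEq ?_
    filter_upwards [extChartAt_target_mem_nhds (I := 𝓘(ℝ, E)) x] with y hy
    simp only [writtenInExtChartAt, extChartAt_model_space_eq_id, comp_apply, PartialEquiv.refl_coe,
      id]
    exact (extChartAt 𝓘(ℝ, E) x).right_inv hy
  exact HasMFDerivAt.mfderiv ⟨h.continuousAt, this.hasFDerivWithinAt⟩

end Derivative

/-! ### The inverse function theorem and the normal form of submersions. -/

section Straightening

variable {E : Type*} [NormedAddCommGroup E] [NormedSpace ℝ E] [FiniteDimensional ℝ E]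
  {M : Type*} [TopologicalSpace M] [ChartedSpace E M] [IsManifold 𝓘(ℝ, E) ∞ M]

/-- The inverse function theorem: a smooth map whose differential at `x` is bijective is a
chart around `x`. -/
theorem exists_chart_of_bijective {f : M → E} {s : Set M} (hs : IsOpen s) {x : M} (hx : x ∈ s)
    (hf : ContMDiffOn 𝓘(ℝ, E) 𝓘(ℝ, E) ∞ f s) (hb : Bijective (mD E E f x)) :
    ∃ e ∈ maximalAtlas 𝓘(ℝ, E) ∞ M, x ∈ e.source ∧ e.source ⊆ s ∧ ∀ y ∈ e.source, e y = f y := by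
  set φ := chartAt E x with hφ
  have hφm : φ ∈ maximalAtlas 𝓘(ℝ, E) ∞ M := chart_mem_maximalAtlas x
  have hxφ : x ∈ φ.source := mem_chart_source E x
  set F : E → E := fun y => f (φ.symm y) with hF
  set t : Set E := φ.target ∩ φ.symm ⁻¹' s with ht
  have hto : IsOpen t := φ.isOpen_inter_preimage_symm hs
  have hFt : ContDiffOn ℝ ∞ F t := by
    rw [← contMDiffOn_iff_contDiffOn]
    exact hf.comp ((contMDiffOn_symm_of_mem_maximalAtlas hφm).mono inter_subset_left)
      inter_subset_right
  have hxt : φ x ∈ t := ⟨φ.map_source hxφ, by simpa [φ.left_inv hxφ] using hx⟩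
  have hFx : ∀ y ∈ t, ContDiffAt ℝ ∞ F y := fun y hy => hFt.contDiffAt (hto.mem_nhds hy)
  have hder : fderiv ℝ F (φ x) = mD E E f x := by
    rw [← mD_eq_fderiv]
    have h1 := mD_comp (E := E) (E' := E) (E'' := E) (g := f) (f := φ.symm) (φ x)
      (by rw [φ.left_inv hxφ]; exact ((hf.contMDiffAt (hs.mem_nhds hx)).mdifferentiableAt (by simp)))
      ((contMDiffAt_symm_of_mem_maximalAtlas hφm hxt.1).mdifferentiableAt (by simp))
    have h2 : (mD E E φ x).comp (mD E E φ.symm (φ x)) = ContinuousLinearMap.id ℝ E := by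
      have h3 := mD_comp (E := E) (E' := E) (E'' := E) (g := φ) (f := φ.symm) (φ x)
        (by rw [φ.left_inv hxφ]
            exact ((contMDiffAt_of_mem_maximalAtlas hφm hxφ).mdifferentiableAt (by simp)))
        ((contMDiffAt_symm_of_mem_maximalAtlas hφm hxt.1).mdifferentiableAt (by simp))
      rw [φ.left_inv hxφ] at h3
      rw [← h3, ← mD_id (φ x)]
      apply mD_congr
      filter_upwards [φ.open_target.mem_nhds hxt.1] with y hy using φ.right_inv hy
    have h4 : mD E E φ x = ContinuousLinearMap.id ℝ E := mD_extChartAt_self x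
    rw [h4, ContinuousLinearMap.id_comp] at h2
    rw [h1, h2, φ.left_inv hxφ, ContinuousLinearMap.comp_id]
  set A : E ≃L[ℝ] E := (LinearEquiv.ofBijective (mD E E f x : E →ₗ[ℝ] E) hb).toContinuousLinearEquiv
  have hA : (A : E →L[ℝ] E) = fderiv ℝ F (φ x) := by
    rw [hder]; rfl
  have hAd : HasFDerivAt F (A : E →L[ℝ] E) (φ x) := by
    rw [hA]; exact ((hFx _ hxt).differentiableAt (by simp)).hasFDerivAt
  set h := (hFx _ hxt).toOpenPartialHomeomorph F hAd (by simp) with hh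
  have hxh : φ x ∈ h.source := (hFx _ hxt).mem_toOpenPartialHomeomorph_source hAd (by simp)
  have hcont : ContinuousOn (fderiv ℝ F) t := hFt.continuousOn_fderiv_of_isOpen hto (by simp)
  -- The inverse function theorem gives smoothness of the inverse only where the derivative is
  -- invertible. Invertible maps form an open set, so restricting to `u` makes the inverse smooth on
  -- a whole neighbourhood.
  set u : Set E := t ∩ fderiv ℝ F ⁻¹' (range ((↑) : (E ≃L[ℝ] E) → E →L[ℝ] E)) with hu
  have huo : IsOpen u := hcont.isOpen_inter_preimage hto ContinuousLinearEquiv.isOpen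
  have hxu : φ x ∈ u := ⟨hxt, A, hA⟩
  set h' := h.restrOpen u huo with hh'
  have hsym : ∀ y ∈ h'.target, ContDiffAt ℝ ∞ h.symm y := by
    intro y hy
    have hy1 := h'.map_target hy
    have hy' : h.symm y ∈ h.source ∩ u := by simpa [hh'] using hy1
    have hyt : y ∈ h.target := by
      have := h'.right_inv hy
      rw [← this]
      exact h.map_source hy'.1
    obtain ⟨B, hB⟩ := hy'.2.2
    refine h.contDiffAt_symm (f₀' := B) hyt ?_ (hFx _ hy'.2.1)
    rw [hB]
    exact ((hFx _ hy'.2.1).differentiableAt (by simp)).hasFDerivAt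
  refine ⟨φ.trans h', ?_, ?_, ?_, ?_⟩
  · apply OpenPartialHomeomorph.mem_maximalAtlas_of_contMDiffOn
    · have : ContMDiffOn 𝓘(ℝ, E) 𝓘(ℝ, E) ∞ F u :=
        contMDiffOn_iff_contDiffOn.2 (hFt.mono inter_subset_left)
      refine this.comp ((contMDiffOn_of_mem_maximalAtlas hφm).mono ?_) ?_
      · intro y hy; exact hy.1
      · intro y hy
        have : φ y ∈ h.source ∩ u := by simpa [hh'] using hy.2
        exact this.2
    · have : ContMDiffOn 𝓘(ℝ, E) 𝓘(ℝ, E) ∞ h.symm h'.target :=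
        contMDiffOn_iff_contDiffOn.2 fun y hy => (hsym y hy).contDiffWithinAt
      refine (contMDiffOn_symm_of_mem_maximalAtlas hφm).comp (this.mono ?_) ?_
      · intro y hy; exact hy.1
      · intro y hy; exact hy.2
  · exact ⟨hxφ, by simpa [hh'] using ⟨hxh, hxu⟩⟩
  · intro y hy
    have h1 : φ y ∈ h.source ∩ u := by simpa [hh'] using hy.2
    have h2 := h1.2.1.2
    rw [mem_preimage, φ.left_inv hy.1] at h2
    exact h2
  · intro y hy
    have : (φ.trans h') y = f (φ.symm (φ y)) := rfl
    rw [this, φ.left_inv hy.1]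

/-- A submersion is a linear projection in a suitable chart. -/
theorem exists_straightening_chart {V C : Type*} [NormedAddCommGroup V] [NormedSpace ℝ V]
    [FiniteDimensional ℝ V] [NormedAddCommGroup C] [NormedSpace ℝ C] [FiniteDimensional ℝ C]
    (hdim : Module.finrank ℝ E = Module.finrank ℝ V + Module.finrank ℝ C)
    {q : M → V} {s : Set M} (hs : IsOpen s) {x : M} (hx : x ∈ s)
    (hq : ContMDiffOn 𝓘(ℝ, E) 𝓘(ℝ, V) ∞ q s) (hsurj : Surjective (mD E V q x)) :
    ∃ e ∈ maximalAtlas 𝓘(ℝ, E) ∞ M, ∃ Λ : E ≃L[ℝ] V × C,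
      x ∈ e.source ∧ e.source ⊆ s ∧ ∀ y ∈ e.source, (Λ (e y)).1 = q y := by
  set A : E →L[ℝ] V := mD E V q x with hA
  have hker : Module.finrank ℝ (LinearMap.ker (A : E →ₗ[ℝ] V)) = Module.finrank ℝ C := by
    have h1 := LinearMap.finrank_range_add_finrank_ker (A : E →ₗ[ℝ] V)
    rw [LinearMap.range_eq_top.2 hsurj, finrank_top] at h1
    omega
  obtain ⟨P₀, hP₀⟩ := Submodule.exists_isCompl (LinearMap.ker (A : E →ₗ[ℝ] V))
  set B₀ : LinearMap.ker (A : E →ₗ[ℝ] V) ≃ₗ[ℝ] C := LinearEquiv.ofFinrankEq _ _ hker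
  set B : E →L[ℝ] C := LinearMap.toContinuousLinearMap
    (B₀.toLinearMap ∘ₗ Submodule.projectionOnto _ _ hP₀) with hB
  have hinj : Injective (A.prod B) := by
    rw [injective_iff_map_eq_zero]
    intro v hv
    have h1 : A v = 0 := congrArg Prod.fst hv
    have h2 : B v = 0 := congrArg Prod.snd hv
    have h3 : Submodule.projectionOnto _ _ hP₀ v = 0 := by
      apply B₀.injective
      rw [map_zero]; exact h2
    have h4 : (Submodule.projectionOnto _ _ hP₀ v : E) = v :=
      congrArg Subtype.val (Submodule.projectionOnto_apply_left hP₀ ⟨v, h1⟩)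
    rw [← h4, h3]; rfl
  set Λ : E ≃L[ℝ] V × C := (LinearEquiv.ofInjectiveOfFinrankEq ((A.prod B : E →L[ℝ] V × C) : E →ₗ[ℝ] V × C)
    hinj (by rw [Module.finrank_prod, hdim])).toContinuousLinearEquiv with hΛ
  have hΛa : ∀ v, Λ v = (A v, B v) := fun v => rfl
  -- `q` is completed by the coordinates `B` along the kernel of its differential. Composing with
  -- the inverse of `Λ = (A, B)` makes the differential of `f` at `x` the identity.
  set f : M → E := fun y => Λ.symm (q y, B (extChartAt 𝓘(ℝ, E) x y)) with hf
  set s' := s ∩ (chartAt E x).source with hs'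
  have hBs : ContMDiffOn 𝓘(ℝ, E) 𝓘(ℝ, C) ∞ (fun y => B (extChartAt 𝓘(ℝ, E) x y)) s' :=
    (B.contMDiff (n := ∞)).comp_contMDiffOn ((contMDiffOn_extChartAt (x := x)).mono inter_subset_right)
  have hqB : ContMDiffOn 𝓘(ℝ, E) 𝓘(ℝ, V × C) ∞
      (fun y => (q y, B (extChartAt 𝓘(ℝ, E) x y))) s' :=
    (hq.mono inter_subset_left).prodMk_space hBs
  have hfs : ContMDiffOn 𝓘(ℝ, E) 𝓘(ℝ, E) ∞ f s' :=
    ((Λ.symm : V × C →L[ℝ] E).contMDiff (n := ∞)).comp_contMDiffOn hqB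
  have hs'o : IsOpen s' := hs.inter (chartAt E x).open_source
  have hxs' : x ∈ s' := ⟨hx, mem_chart_source E x⟩
  have hΛf : ∀ y, Λ (f y) = (q y, B (extChartAt 𝓘(ℝ, E) x y)) := fun y => Λ.apply_symm_apply _
  have hfd : MDifferentiableAt 𝓘(ℝ, E) 𝓘(ℝ, E) f x :=
    (hfs.contMDiffAt (hs'o.mem_nhds hxs')).mdifferentiableAt (by simp)
  have key : ∀ v, Λ (mD E E f x v) = Λ v := by
    intro v
    rw [hΛa, hΛa]
    have e1 : A (mD E E f x v) = A v := by
      have := mD_comp_apply (E := E) (E' := E) (E'' := V) (g := A) (f := f) x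
        A.mdifferentiableAt hfd v
      rw [mD_eq_fderiv, A.fderiv] at this
      rw [← this]
      have h5 : (fun y => A (f y)) = q := by
        ext1 y; exact congrArg Prod.fst (hΛf y)
      rw [h5]
    have e2 : B (mD E E f x v) = B v := by
      have := mD_comp_apply (E := E) (E' := E) (E'' := C) (g := B) (f := f) x
        B.mdifferentiableAt hfd v
      rw [mD_eq_fderiv, B.fderiv] at this
      rw [← this]
      have h5 : (fun y => B (f y)) = fun y => B (extChartAt 𝓘(ℝ, E) x y) := by
        ext1 y; exact congrArg Prod.snd (hΛf y)
      rw [h5, mD_comp_apply (E := E) (E' := E) (E'' := C) (g := B) x B.mdifferentiableAt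
        ((contMDiffAt_extChartAt (n := ∞)).mdifferentiableAt (by simp)), mD_eq_fderiv, B.fderiv,
        mD_extChartAt_self]
      rfl
    rw [e1, e2]
  have hb : Bijective (mD E E f x) := by
    have : (mD E E f x) = ContinuousLinearMap.id ℝ E := by
      ext v; exact Λ.injective (key v)
    rw [this]; exact bijective_id
  obtain ⟨e, he, hxe, hes, hef⟩ := exists_chart_of_bijective hs'o hxs' hfs hb
  exact ⟨e, he, Λ, hxe, fun y hy => (hes hy).1, fun y hy => by rw [hef y hy, hΛf]⟩

end Straightening

end QHam

namespace QHam
open Set Filter Topology Function IsManifold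

/-! ### Manifold structures on submanifolds and on quotients. -/

section Construction

/-- A family of compatible charts defines a manifold. -/
theorem exists_manifold_of_charts {H : Type*} [NormedAddCommGroup H] [NormedSpace ℝ H]
    {X : Type*} [TopologicalSpace X] {J : Type*} (φ : J → OpenPartialHomeomorph X H)
    (hcov : ∀ x, ∃ j, x ∈ (φ j).source)
    (hcomp : ∀ i j, ∀ z ∈ ((φ i).symm.trans (φ j)).source,
      ContDiffAt ℝ ∞ (fun w => φ j ((φ i).symm w)) z) :
    ∃ _ : ChartedSpace H X, IsManifold 𝓘(ℝ, H) ∞ X ∧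
      ∀ j, φ j ∈ maximalAtlas 𝓘(ℝ, H) ∞ X := by
  choose c hc using hcov
  let cs : ChartedSpace H X :=
    { atlas := range φ
      chartAt := fun x => φ (c x)
      mem_chart_source := hc
      chart_mem_atlas := fun x => mem_range_self _ }
  have hm : IsManifold 𝓘(ℝ, H) ∞ X := by
    apply isManifold_of_contDiffOn
    rintro _ _ ⟨i, rfl⟩ ⟨j, rfl⟩ z hz
    exact (hcomp i j z hz.1).contDiffWithinAt
  exact ⟨cs, hm, fun j => subset_maximalAtlas (mem_range_self j)⟩

/-- Serves the dimensions that do not occur in `M_K`, possibly larger than that of `M`: every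
stratum must carry a manifold structure, also an empty one. -/
theorem exists_manifold_of_isEmpty {E : Type*} [NormedAddCommGroup E] [NormedSpace ℝ E]
    {M : Type*} [TopologicalSpace M] [ChartedSpace E M]
    {X : Type*} [TopologicalSpace X] [IsEmpty X] (ι : X → M) (d : ℕ) :
    ∃ _ : ChartedSpace (EuclideanSpace ℝ (Fin d)) X, IsManifold (𝓡 d) ∞ X ∧
      Manifold.IsSmoothEmbedding (𝓡 d) 𝓘(ℝ, E) ∞ ι := by
  obtain ⟨cs, hm, -⟩ := exists_manifold_of_charts (H := EuclideanSpace ℝ (Fin d)) (X := X)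
    (J := PEmpty.{1}) (fun j => j.elim) (fun x => isEmptyElim x) (fun j => j.elim)
  refine ⟨cs, hm, ?_, ?_⟩
  · exact ⟨PUnit, inferInstance, inferInstance, fun x => isEmptyElim x⟩
  · exact ⟨⟨Subsingleton.elim _ _⟩, fun x => isEmptyElim x⟩

variable {E : Type*} [NormedAddCommGroup E] [NormedSpace ℝ E] [FiniteDimensional ℝ E]
  {M : Type*} [TopologicalSpace M] [ChartedSpace E M] [IsManifold 𝓘(ℝ, E) ∞ M]
  {X : Type*} [TopologicalSpace X]

omit [ChartedSpace E M] [FiniteDimensional ℝ E] [IsManifold 𝓘(ℝ, E) ∞ M] in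
/-- The chart induced on the zero set of a linear projection. -/
theorem exists_chart_of_slice {V C : Type*} [NormedAddCommGroup V] [NormedSpace ℝ V]
    [NormedAddCommGroup C] [NormedSpace ℝ C] [Nonempty X] {ι : X → M} (hι : IsEmbedding ι)
    (e : OpenPartialHomeomorph M E) (Λ : E ≃L[ℝ] V × C)
    (h : ∀ y ∈ e.source, y ∈ range ι ↔ (Λ (e y)).1 = 0) :
    ∃ φ : OpenPartialHomeomorph X C, φ.source = ι ⁻¹' e.source ∧
      (∀ y, φ y = (Λ (e (ι y))).2) ∧
      (∀ w ∈ φ.target, Λ.symm (0, w) ∈ e.target ∧ ι (φ.symm w) = e.symm (Λ.symm (0, w))) := by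
  have hinv : ∀ w, Λ.symm (0, w) ∈ e.target →
      ι (invFun ι (e.symm (Λ.symm (0, w)))) = e.symm (Λ.symm (0, w)) := by
    intro w hw
    apply invFun_eq
    have := (h _ (e.map_target hw)).2 (by rw [e.right_inv hw]; simp)
    exact this
  let φ : OpenPartialHomeomorph X C :=
    { toFun := fun y => (Λ (e (ι y))).2
      invFun := fun w => invFun ι (e.symm (Λ.symm (0, w)))
      source := ι ⁻¹' e.source
      target := {w | Λ.symm (0, w) ∈ e.target}
      map_source' := by
        intro y hy
        have h1 : (Λ (e (ι y))).1 = 0 := (h _ hy).1 (mem_range_self y)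
        have h2 : ((0 : V), (Λ (e (ι y))).2) = Λ (e (ι y)) := by rw [← h1]
        rw [mem_ofPred_eq, h2, Λ.symm_apply_apply]
        exact e.map_source hy
      map_target' := by
        intro w hw
        rw [mem_preimage, hinv w hw]
        exact e.map_target hw
      left_inv' := by
        intro y hy
        have h1 : (Λ (e (ι y))).1 = 0 := (h _ hy).1 (mem_range_self y)
        have h2 : ((0 : V), (Λ (e (ι y))).2) = Λ (e (ι y)) := by rw [← h1]
        rw [h2, Λ.symm_apply_apply, e.left_inv hy]
        exact leftInverse_invFun hι.injective y
      right_inv' := by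
        intro w hw
        rw [hinv w hw, e.right_inv hw, Λ.apply_symm_apply]
      open_source := e.open_source.preimage hι.continuous
      open_target := by
        have : Continuous fun w : C => Λ.symm ((0 : V), w) := by fun_prop
        exact e.open_target.preimage this
      continuousOn_toFun := by
        have h1 : ContinuousOn (fun y => e (ι y)) (ι ⁻¹' e.source) :=
          e.continuousOn.comp hι.continuous.continuousOn fun y hy => hy
        exact (Λ.continuous.comp_continuousOn h1).snd
      continuousOn_invFun := by
        rw [hι.isInducing.continuousOn_iff]
        have h1 : ContinuousOn (fun w => e.symm (Λ.symm ((0 : V), w)))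
            {w | Λ.symm ((0 : V), w) ∈ e.target} :=
          e.continuousOn_symm.comp (by fun_prop) fun w hw => hw
        exact h1.congr fun w hw => hinv w hw }
  exact ⟨φ, rfl, fun y => rfl, fun w hw => ⟨hw, hinv w hw⟩⟩

/-- A subspace that is locally the zero set of a submersion is an embedded submanifold. -/
theorem exists_submanifold {ι : X → M} (hι : IsEmbedding ι) (c d : ℕ)
    (hdim : Module.finrank ℝ E = c + d)
    (h : ∀ x : X, ∃ (s : Set M) (q : M → EuclideanSpace ℝ (Fin c)), IsOpen s ∧ ι x ∈ s ∧
      ContMDiffOn 𝓘(ℝ, E) (𝓡 c) ∞ q s ∧ Surjective (mD E (EuclideanSpace ℝ (Fin c)) q (ι x)) ∧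
      ∀ y ∈ s, y ∈ range ι ↔ q y = 0) :
    ∃ _ : ChartedSpace (EuclideanSpace ℝ (Fin d)) X, IsManifold (𝓡 d) ∞ X ∧
      Manifold.IsSmoothEmbedding (𝓡 d) 𝓘(ℝ, E) ∞ ι := by
  have h1 : ∀ x : X, ∃ e ∈ maximalAtlas 𝓘(ℝ, E) ∞ M,
      ∃ Λ : E ≃L[ℝ] EuclideanSpace ℝ (Fin c) × EuclideanSpace ℝ (Fin d),
      ∃ φ : OpenPartialHomeomorph X (EuclideanSpace ℝ (Fin d)),
      ι x ∈ e.source ∧ φ.source = ι ⁻¹' e.source ∧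
      (∀ y, φ y = (Λ (e (ι y))).2) ∧
      (∀ w ∈ φ.target, Λ.symm (0, w) ∈ e.target ∧ ι (φ.symm w) = e.symm (Λ.symm (0, w))) := by
    intro x
    obtain ⟨s, q, hs, hxs, hq, hsurj, hy⟩ := h x
    obtain ⟨e, he, Λ, hxe, hes, hΛ⟩ := exists_straightening_chart
      (C := EuclideanSpace ℝ (Fin d)) (by simpa using hdim) hs hxs hq hsurj
    have : Nonempty X := ⟨x⟩
    obtain ⟨φ, h1, h2, h3⟩ := exists_chart_of_slice hι e Λ
      (fun y hye => by rw [hy y (hes hye), hΛ y hye])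
    exact ⟨e, he, Λ, φ, hxe, h1, h2, h3⟩
  choose e he Λ φ hxe hsrc hφ hφs using h1
  obtain ⟨cs, hm, hat⟩ := exists_manifold_of_charts φ
    (fun x => ⟨x, by rw [hsrc]; exact hxe x⟩) (by
      intro i j z hz
      have hz1 : z ∈ (φ i).target := hz.1
      have hz2 : (φ i).symm z ∈ (φ j).source := hz.2
      rw [hsrc, mem_preimage, (hφs i z hz1).2] at hz2
      have h1 : ContDiffAt ℝ ∞ (fun w => (Λ j (e j ((e i).symm ((Λ i).symm (0, w))))).2) z := by
        rw [← contMDiffAt_iff_contDiffAt]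
        have a1 : ContMDiffAt (𝓡 d) 𝓘(ℝ, E) ∞ (fun w => (Λ i).symm (0, w)) z := by
          rw [contMDiffAt_iff_contDiffAt]; fun_prop
        have a2 := (contMDiffAt_symm_of_mem_maximalAtlas (he i) (hφs i z hz1).1).comp z a1
        have a3 := (contMDiffAt_of_mem_maximalAtlas (he j) hz2).comp z a2
        have a4 : ContMDiff 𝓘(ℝ, E) (𝓡 d) ∞ (fun v => (Λ j v).2) := by
          rw [contMDiff_iff_contDiff]; fun_prop
        exact a4.contMDiffAt.comp z a3
      refine h1.congr_of_eventuallyEq ?_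
      filter_upwards [(φ i).open_target.mem_nhds hz1] with w hw
      rw [hφ j, (hφs i w hw).2])
  refine ⟨cs, hm, ?_, hι⟩
  have : Manifold.IsImmersionOfComplement (EuclideanSpace ℝ (Fin c)) (𝓡 d) 𝓘(ℝ, E) ∞ ι := by
    intro x
    -- The factors are exchanged because the normal form of an immersion puts the complement last,
    -- whereas `Λ` lists the equations first.
    refine Manifold.IsImmersionAtOfComplement.mk_of_continuousAt hι.continuous.continuousAt
      ((ContinuousLinearEquiv.prodComm ℝ _ _).trans (Λ x).symm) (φ x) (e x)
      (by rw [hsrc]; exact hxe x) (hxe x) (hat x) (he x) ?_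
    intro w hw
    have hw' : w ∈ (φ x).target := by simpa using hw
    have h1 := hφs x w hw'
    simp only [comp_apply, OpenPartialHomeomorph.extend_coe, OpenPartialHomeomorph.extend_coe_symm,
      modelWithCornersSelf_coe, modelWithCornersSelf_coe_symm, id]
    rw [h1.2, (e x).right_inv h1.1]
    rfl
  exact this.isImmersion

omit [ChartedSpace E M] [IsManifold 𝓘(ℝ, E) ∞ M] [FiniteDimensional ℝ E] in
/-- The chart induced on a quotient by an invariant submersion. -/
theorem exists_chart_of_quotient {V C : Type*} [NormedAddCommGroup V] [NormedSpace ℝ V]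
    [NormedAddCommGroup C] [NormedSpace ℝ C] [Nonempty X] {p : M → X} (hpc : Continuous p)
    (hpo : IsOpenMap p) (hps : Surjective p) {q : M → V} (hqc : Continuous q)
    (hqp : ∀ g₁ g₂, p g₁ = p g₂ → q g₁ = q g₂) {s : Set M}
    (hpq : ∀ g₁ ∈ s, ∀ g₂ ∈ s, q g₁ = q g₂ → p g₁ = p g₂)
    (e : OpenPartialHomeomorph M E) (hes : e.source ⊆ s) (Λ : E ≃L[ℝ] V × C)
    (h : ∀ y ∈ e.source, (Λ (e y)).1 = q y) :
    ∃ φ : OpenPartialHomeomorph X V, φ.source = p '' e.source ∧ ∀ g, φ (p g) = q g := by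
  set qb : X → V := fun x => q (surjInv hps x) with hqb
  have hqbp : ∀ g, qb (p g) = q g := fun g => hqp _ _ (surjInv_eq hps _)
  have hqbc : Continuous qb := by
    rw [(IsOpenQuotientMap.mk hps hpc hpo).isQuotientMap.continuous_iff]
    have : qb ∘ p = q := funext hqbp
    rw [this]; exact hqc
  have hinj : InjOn qb (p '' e.source) := by
    rintro _ ⟨g₁, h₁, rfl⟩ _ ⟨g₂, h₂, rfl⟩ heq
    rw [hqbp, hqbp] at heq
    exact hpq _ (hes h₁) _ (hes h₂) heq
  -- In the straightening chart `q` is a linear projection, hence open; this makes the induced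
  -- injection an open embedding.
  have hopen : ∀ A ⊆ e.source, IsOpen A → IsOpen (q '' A) := by
    intro A hA hAo
    have h1 : IsOpen (e '' A) := e.isOpen_image_of_subset_source hAo hA
    have h2 : IsOpen (Prod.fst '' (Λ '' (e '' A))) :=
      isOpenMap_fst _ (Λ.toHomeomorph.isOpenMap _ h1)
    rw [image_image, image_image] at h2
    rwa [image_congr fun y hy => h y (hA hy)] at h2
  refine ⟨OpenPartialHomeomorph.ofContinuousOpenRestrict (hinj.toPartialEquiv qb _)
    hqbc.continuousOn ?_ (hpo _ e.open_source), rfl, hqbp⟩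
  intro O hO
  obtain ⟨O', hO', rfl⟩ := isOpen_induced_iff.1 hO
  have : (domRestrict (p '' e.source) qb) '' (Subtype.val ⁻¹' O') = q '' (p ⁻¹' O' ∩ e.source) := by
    ext w
    constructor
    · rintro ⟨⟨_, g, hg, rfl⟩, hx, rfl⟩
      exact ⟨g, ⟨hx, hg⟩, (hqbp g).symm⟩
    · rintro ⟨g, ⟨hg1, hg2⟩, rfl⟩
      exact ⟨⟨p g, g, hg2, rfl⟩, hg1, hqbp g⟩
  change IsOpen ((domRestrict (p '' e.source) qb) '' (Subtype.val ⁻¹' O'))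
  rw [this]
  exact hopen _ inter_subset_right ((hO'.preimage hpc).inter e.open_source)

/-- A quotient that is locally the space of fibres of an invariant submersion is a manifold. -/
theorem exists_quotient_manifold {p : M → X} (hpc : Continuous p)
    (hpo : IsOpenMap p) (hps : Surjective p) (b c : ℕ) (hdim : Module.finrank ℝ E = b + c)
    (h : ∀ g : M, ∃ (s : Set M) (q : M → EuclideanSpace ℝ (Fin b)), IsOpen s ∧ g ∈ s ∧
      ContMDiff 𝓘(ℝ, E) (𝓡 b) ∞ q ∧ Surjective (mD E (EuclideanSpace ℝ (Fin b)) q g) ∧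
      (∀ g₁ g₂, p g₁ = p g₂ → q g₁ = q g₂) ∧
      (∀ g₁ ∈ s, ∀ g₂ ∈ s, q g₁ = q g₂ → p g₁ = p g₂)) :
    ∃ _ : ChartedSpace (EuclideanSpace ℝ (Fin b)) X, IsManifold (𝓡 b) ∞ X ∧
      Manifold.IsSubmersion 𝓘(ℝ, E) (𝓡 b) ∞ p := by
  have h1 : ∀ g : M, ∃ (q : M → EuclideanSpace ℝ (Fin b)), ∃ e ∈ maximalAtlas 𝓘(ℝ, E) ∞ M,
      ∃ Λ : E ≃L[ℝ] EuclideanSpace ℝ (Fin b) × EuclideanSpace ℝ (Fin c),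
      ∃ φ : OpenPartialHomeomorph X (EuclideanSpace ℝ (Fin b)),
      ContMDiff 𝓘(ℝ, E) (𝓡 b) ∞ q ∧ g ∈ e.source ∧ (∀ y ∈ e.source, (Λ (e y)).1 = q y) ∧
      φ.source = p '' e.source ∧ ∀ y, φ (p y) = q y := by
    intro g
    obtain ⟨s, q, hs, hgs, hq, hsurj, hqp, hpq⟩ := h g
    obtain ⟨e, he, Λ, hxe, hes, hΛ⟩ := exists_straightening_chart
      (C := EuclideanSpace ℝ (Fin c)) (by simpa using hdim) hs hgs hq.contMDiffOn hsurj
    have : Nonempty X := ⟨p g⟩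
    obtain ⟨φ, h1, h2⟩ := exists_chart_of_quotient hpc hpo hps hq.continuous hqp hpq e hes Λ hΛ
    exact ⟨q, e, he, Λ, φ, hq, hxe, hΛ, h1, h2⟩
  choose q e he Λ φ hq hxe hΛ hsrc hφ using h1
  obtain ⟨cs, hm, hat⟩ := exists_manifold_of_charts φ
    (fun x => ⟨surjInv hps x, by
      rw [hsrc]; exact ⟨surjInv hps x, hxe _, surjInv_eq hps x⟩⟩) (by
      intro i j z hz
      have hz1 : z ∈ (φ i).target := hz.1
      have h0 := (φ i).map_target hz1
      rw [hsrc] at h0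
      obtain ⟨g, hg, hgz⟩ := h0
      have hqz : q i g = z := by rw [← hφ, hgz, (φ i).right_inv hz1]
      -- Freezing the fibre coordinate at `w₀` gives a smooth local section of `p` through `g`. The
      -- transition map is `q j` composed with this section.
      set w₀ := (Λ i (e i g)).2 with hw₀
      have hpt : (Λ i).symm (z, w₀) = e i g := by
        rw [← hqz, ← hΛ i g hg, hw₀, Prod.mk.eta, (Λ i).symm_apply_apply]
      have a0 : Continuous fun w => (Λ i).symm (w, w₀) := by fun_prop
      have hev : ∀ᶠ w in 𝓝 z, (Λ i).symm (w, w₀) ∈ (e i).target := by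
        apply a0.continuousAt.eventually_mem
        rw [hpt]
        exact (e i).open_target.mem_nhds ((e i).map_source hg)
      have h1 : ContDiffAt ℝ ∞ (fun w => q j ((e i).symm ((Λ i).symm (w, w₀)))) z := by
        rw [← contMDiffAt_iff_contDiffAt]
        have a1 : ContMDiffAt (𝓡 b) 𝓘(ℝ, E) ∞ (fun w => (Λ i).symm (w, w₀)) z := by
          rw [contMDiffAt_iff_contDiffAt]; fun_prop
        have a2 := (contMDiffAt_symm_of_mem_maximalAtlas (he i) hev.self_of_nhds).comp z a1
        exact (hq j).contMDiffAt.comp z a2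
      refine h1.congr_of_eventuallyEq ?_
      filter_upwards [hev] with w hw
      have h2 : φ i (p ((e i).symm ((Λ i).symm (w, w₀)))) = w := by
        rw [hφ, ← hΛ i _ ((e i).map_target hw), (e i).right_inv hw, (Λ i).apply_symm_apply]
      have h3 : (φ i).symm w = p ((e i).symm ((Λ i).symm (w, w₀))) := by
        conv_lhs => rw [← h2]
        apply (φ i).left_inv
        rw [hsrc]
        exact mem_image_of_mem p ((e i).map_target hw)
      rw [h3, hφ])
  refine ⟨cs, hm, ?_⟩
  have : Manifold.IsSubmersionOfComplement (EuclideanSpace ℝ (Fin c)) 𝓘(ℝ, E) (𝓡 b) ∞ p := by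
    intro g
    refine Manifold.IsSubmersionAtOfComplement.mk_of_continuousAt hpc.continuousAt
      (Λ g) (e g) (φ g) (hxe g) (by rw [hsrc]; exact mem_image_of_mem p (hxe g)) (he g) (hat g) ?_
    intro w hw
    have hw' : w ∈ (e g).target := by simpa using hw
    simp only [comp_apply, OpenPartialHomeomorph.extend_coe, OpenPartialHomeomorph.extend_coe_symm,
      modelWithCornersSelf_coe, modelWithCornersSelf_coe_symm, id]
    rw [hφ, ← hΛ g _ ((e g).map_target hw'), (e g).right_inv hw']
  exact this.isSubmersion

end Construction

end QHam

namespace QHam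
open Set Filter Topology Function IsManifold

/-! ### Left-invariant families of functions have constant rank. -/

section ConstantRank

/-- The map to `ℝ^r` with given components. -/
def toEuclid {X : Type*} {r : ℕ} (f : Fin r → X → ℝ) (x : X) : EuclideanSpace ℝ (Fin r) :=
  WithLp.toLp 2 fun i => f i x

theorem toEuclid_eq_iff {X : Type*} {r : ℕ} {f : Fin r → X → ℝ} {x y : X} :
    toEuclid f x = toEuclid f y ↔ ∀ i, f i x = f i y := by
  constructor
  · intro h i
    exact congrArg (fun w : EuclideanSpace ℝ (Fin r) => w i) h
  · intro h
    unfold toEuclid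
    congr 1
    exact funext h

variable {E : Type*} [NormedAddCommGroup E] [NormedSpace ℝ E]
  {M : Type*} [TopologicalSpace M] [ChartedSpace E M]

theorem contMDiff_toEuclid {r : ℕ} {f : Fin r → M → ℝ}
    (hf : ∀ i, ContMDiff 𝓘(ℝ, E) 𝓘(ℝ, ℝ) ∞ (f i)) :
    ContMDiff 𝓘(ℝ, E) (𝓡 r) ∞ (toEuclid f) := by
  have h1 : ContMDiff 𝓘(ℝ, E) 𝓘(ℝ, Fin r → ℝ) ∞ (fun x i => f i x) := contMDiff_pi_space.2 hf
  exact ((EuclideanSpace.equiv (Fin r) ℝ).symm :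
    (Fin r → ℝ) →L[ℝ] EuclideanSpace ℝ (Fin r)).contMDiff.comp h1

theorem mD_toEuclid {r : ℕ} {f : Fin r → M → ℝ}
    (hf : ∀ i, ContMDiff 𝓘(ℝ, E) 𝓘(ℝ, ℝ) ∞ (f i)) (x : M) (v : E) (i : Fin r) :
    mD E (EuclideanSpace ℝ (Fin r)) (toEuclid f) x v i = mD E ℝ (f i) x v := by
  have h := mD_comp_apply (E := E) (E' := EuclideanSpace ℝ (Fin r)) (E'' := ℝ)
    (g := (EuclideanSpace.proj i : EuclideanSpace ℝ (Fin r) →L[ℝ] ℝ)) (f := toEuclid f) x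
    (ContinuousLinearMap.mdifferentiableAt _)
    ((contMDiff_toEuclid hf).contMDiffAt.mdifferentiableAt (by simp)) v
  rw [mD_eq_fderiv, ContinuousLinearMap.fderiv] at h
  exact h.symm

theorem mD_chart_symm_comp {e : OpenPartialHomeomorph M E} (he : e ∈ maximalAtlas 𝓘(ℝ, E) ∞ M)
    {x : M} (hx : x ∈ e.source) (v : E) :
    mD E E e.symm (e x) (mD E E e x v) = v := by
  rw [← mD_comp_apply (E := E) (E' := E) (E'' := E) x
    ((contMDiffAt_symm_of_mem_maximalAtlas he (e.map_source hx)).mdifferentiableAt (by simp))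
    ((contMDiffAt_of_mem_maximalAtlas he hx).mdifferentiableAt (by simp))]
  have : (fun y => e.symm (e y)) =ᶠ[𝓝 x] fun y => y := by
    filter_upwards [e.open_source.mem_nhds hx] with y hy using e.left_inv hy
  rw [mD_congr this, mD_id]; rfl

theorem mD_chart_comp_symm {e : OpenPartialHomeomorph M E} (he : e ∈ maximalAtlas 𝓘(ℝ, E) ∞ M)
    {x : M} (hx : x ∈ e.source) (v : E) :
    mD E E e x (mD E E e.symm (e x) v) = v := by
  have h1 : MDifferentiableAt 𝓘(ℝ, E) 𝓘(ℝ, E) e (e.symm (e x)) := by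
    rw [e.left_inv hx]; exact (contMDiffAt_of_mem_maximalAtlas he hx).mdifferentiableAt (by simp)
  have h := mD_comp_apply (E := E) (E' := E) (E'' := E) (g := e) (f := e.symm) (e x) h1
    ((contMDiffAt_symm_of_mem_maximalAtlas he (e.map_source hx)).mdifferentiableAt (by simp)) v
  rw [e.left_inv hx] at h
  rw [← h]
  have : (fun y => e (e.symm y)) =ᶠ[𝓝 (e x)] fun y => y := by
    filter_upwards [e.open_target.mem_nhds (e.map_source hx)] with y hy using e.right_inv hy
  rw [mD_congr this, mD_id]; rfl

theorem mD_chart_bijective {e : OpenPartialHomeomorph M E} (he : e ∈ maximalAtlas 𝓘(ℝ, E) ∞ M)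
    {x : M} (hx : x ∈ e.source) : Bijective (mD E E e x) :=
  ⟨LeftInverse.injective (mD_chart_symm_comp he hx),
    RightInverse.surjective (mD_chart_comp_symm he hx)⟩

/-- Finitely many functionals of a family, independent and with the same common kernel. -/
theorem exists_independent_functionals {J : Type*} [FiniteDimensional ℝ E] (α : J → E →L[ℝ] ℝ) :
    ∃ (r : ℕ) (idx : Fin r → J),
      Surjective (fun v : E => fun i => α (idx i) v) ∧
      ∀ v, (∀ i, α (idx i) v = 0) → ∀ j, α j v = 0 := by
  obtain ⟨κ, a, -, hspan, hli⟩ := exists_linearIndependent' ℝ α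
  have : Finite κ := hli.finite
  obtain ⟨r, ⟨ε⟩⟩ := Finite.exists_equiv_fin κ
  refine ⟨r, fun i => a (ε.symm i), ?_, ?_⟩
  · have hli' : LinearIndependent ℝ fun i => α (a (ε.symm i)) := hli.comp _ ε.symm.injective
    set A : E →ₗ[ℝ] (Fin r → ℝ) := LinearMap.pi fun i => (α (a (ε.symm i)) : E →ₗ[ℝ] ℝ) with hA
    suffices h : LinearMap.range A = ⊤ from LinearMap.range_eq_top.1 h
    by_contra hne
    -- A functional killing a proper range would be a nontrivial linear relation between the chosen
    -- independent functionals.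
    obtain ⟨φ, hφ, hφA⟩ := Submodule.exists_le_ker_of_lt_top _ (lt_top_iff_ne_top.2 hne)
    apply hφ
    have hsum : ∑ i, φ (Pi.single i 1) • α (a (ε.symm i)) = 0 := by
      ext v
      have h1 : φ (A v) = 0 := hφA (LinearMap.mem_range_self A v)
      rw [LinearMap.pi_apply_eq_sum_univ φ (A v)] at h1
      rw [sum_apply]
      simp only [smul_apply, smul_eq_mul, zero_apply]
      rw [← h1]
      refine Finset.sum_congr rfl fun i _ => ?_
      rw [smul_eq_mul, mul_comm]
      congr 2
      ext k
      simp [Pi.single_apply, eq_comm]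
    have h0 := Fintype.linearIndependent_iff.1 hli' _ hsum
    apply LinearMap.pi_ext'
    intro i
    ext
    simpa using h0 i
  · intro v hv j
    have hj : α j ∈ Submodule.span ℝ (range (α ∘ a)) := by
      rw [hspan]; exact Submodule.subset_span (mem_range_self j)
    generalize α j = β at hj
    induction hj using Submodule.span_induction with
    | mem x hx =>
      obtain ⟨k, rfl⟩ := hx
      simpa using hv (ε k)
    | zero => rfl
    | add x y _ _ hx hy => simp [hx, hy]
    | smul c x _ hx => simp [hx]

variable {G : Type*} [TopologicalSpace G] [ChartedSpace E G] [Group G] [LieGroup 𝓘(ℝ, E) ∞ G]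

/-- A left-invariant family of functions on a Lie group has constant rank: near `1`, finitely many
of them, forming a submersion, determine all the others. -/
theorem exists_submersion_of_family [FiniteDimensional ℝ E] {J : Type*} (f : J → G → ℝ)
    (hf : ∀ j, ContMDiff 𝓘(ℝ, E) 𝓘(ℝ, ℝ) ∞ (f j))
    (hcl : ∀ j g, ∃ k, ∀ x, f k x = f j (g * x)) :
    ∃ (r : ℕ) (idx : Fin r → J) (V : Set G), IsOpen V ∧ (1 : G) ∈ V ∧
      Surjective (mD E (EuclideanSpace ℝ (Fin r)) (toEuclid fun i => f (idx i)) 1) ∧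
      ∀ g ∈ V, ∀ g' ∈ V, toEuclid (fun i => f (idx i)) g = toEuclid (fun i => f (idx i)) g' →
        ∀ j, f j g = f j g' := by
  have hman : IsManifold 𝓘(ℝ, E) ∞ G := inferInstance
  obtain ⟨r, idx, hsurj, hker⟩ := exists_independent_functionals fun j => mD E ℝ (f j) (1 : G)
  set q := toEuclid fun i => f (idx i) with hq
  have hqs : ContMDiff 𝓘(ℝ, E) (𝓡 r) ∞ q := contMDiff_toEuclid fun i => hf _
  have hqsurj : Surjective (mD E (EuclideanSpace ℝ (Fin r)) q (1 : G)) := by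
    intro w
    obtain ⟨v, hv⟩ := hsurj w
    refine ⟨v, ?_⟩
    ext i
    rw [hq, mD_toEuclid fun i => hf _]
    exact congrFun hv i
  set n := Module.finrank ℝ E with hn
  have hrank : ∀ g : G, Surjective (mD E (EuclideanSpace ℝ (Fin r)) q g) →
      Module.finrank ℝ (LinearMap.ker (mD E (EuclideanSpace ℝ (Fin r)) q g).toLinearMap) + r = n := by
    intro g hg
    have h1 := LinearMap.finrank_range_add_finrank_ker
      (mD E (EuclideanSpace ℝ (Fin r)) q g).toLinearMap
    rw [LinearMap.range_eq_top.2 hg, finrank_top, finrank_euclideanSpace_fin] at h1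
    omega
  have hrn : n = r + (n - r) := by have := hrank 1 hqsurj; omega
  obtain ⟨e, he, Λ, h1e, -, hΛ⟩ := exists_straightening_chart
    (C := EuclideanSpace ℝ (Fin (n - r))) (by simpa using hrn) isOpen_univ (mem_univ (1 : G))
    hqs.contMDiffOn hqsurj
  have hsurjg : ∀ g ∈ e.source, Surjective (mD E (EuclideanSpace ℝ (Fin r)) q g) := by
    intro g hg w
    obtain ⟨v, hv⟩ := (mD_chart_bijective he hg).2 (Λ.symm (w, 0))
    refine ⟨v, ?_⟩
    set A : E →L[ℝ] EuclideanSpace ℝ (Fin r) :=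
      (ContinuousLinearMap.fst ℝ _ _).comp (Λ : E →L[ℝ] EuclideanSpace ℝ (Fin r) × EuclideanSpace ℝ (Fin (n - r))) with hA
    have h1 : q =ᶠ[𝓝 g] fun y => A (e y) := by
      filter_upwards [e.open_source.mem_nhds hg] with y hy using (hΛ y hy).symm
    rw [mD_congr h1, mD_comp_apply (E := E) (E' := E) (E'' := EuclideanSpace ℝ (Fin r)) g
      A.mdifferentiableAt
      ((contMDiffAt_of_mem_maximalAtlas he hg).mdifferentiableAt (by simp)), mD_eq_fderiv,
      A.fderiv, hv, hA]
    simp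
  -- The common kernel `Kg` of the family at `g` lies in the kernel of `dq` at `g`. By invariance of
  -- the family, left translation embeds in `Kg` the common kernel at `1`, which is the kernel of
  -- `dq` at `1`. Both kernels of `dq` have the same dimension since `q` is a submersion at both
  -- points, so all three spaces agree in dimension.
  have hkerg : ∀ g ∈ e.source, ∀ v, mD E (EuclideanSpace ℝ (Fin r)) q g v = 0 →
      ∀ j, mD E ℝ (f j) g v = 0 := by
    intro g hg
    set Kg : Submodule ℝ E := ⨅ j, LinearMap.ker (mD E ℝ (f j) g).toLinearMap with hKg
    set K1 : Submodule ℝ E := LinearMap.ker (mD E (EuclideanSpace ℝ (Fin r)) q (1 : G)).toLinearMap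
    set Kq : Submodule ℝ E := LinearMap.ker (mD E (EuclideanSpace ℝ (Fin r)) q g).toLinearMap
    have hle : Kg ≤ Kq := by
      intro v hv
      rw [hKg, Submodule.mem_iInf] at hv
      change mD E (EuclideanSpace ℝ (Fin r)) q g v = 0
      ext i
      rw [hq, mD_toEuclid fun i => hf _]
      exact hv (idx i)
    set L : E →L[ℝ] E := mD E E (fun x : G => g * x) 1 with hL
    have hLd : ∀ a x : G, MDifferentiableAt 𝓘(ℝ, E) 𝓘(ℝ, E) (fun x : G => a * x) x :=
      fun a x => (contMDiff_mul_left (n := ∞)).contMDiffAt.mdifferentiableAt (by simp)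
    have hLinj : Injective L := by
      have : LeftInverse (mD E E (fun x : G => g⁻¹ * x) (g * 1)) L := by
        intro v
        rw [hL, ← mD_comp_apply (E := E) (E' := E) (E'' := E) (g := fun x : G => g⁻¹ * x)
          (f := fun x : G => g * x) 1 (hLd _ _) (hLd _ _)]
        simp only [inv_mul_cancel_left]
        rw [mD_id]; rfl
      exact this.injective
    have hLK : ∀ v ∈ K1, L v ∈ Kg := by
      intro v hv
      rw [hKg, Submodule.mem_iInf]
      intro j
      obtain ⟨k, hk⟩ := hcl j g
      have h1 : mD E ℝ (f k) (1 : G) v = 0 := by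
        apply hker v
        intro i
        rw [← mD_toEuclid (fun i => hf (idx i)) 1 v i]
        have hv' : mD E (EuclideanSpace ℝ (Fin r)) q (1 : G) v = 0 := hv
        rw [← hq, hv']; rfl
      have h2 : f k = fun x => f j (g * x) := funext hk
      rw [h2, mD_comp_apply (E := E) (E' := E) (E'' := ℝ) (g := f j) (f := fun x : G => g * x) 1
        ((hf j).contMDiffAt.mdifferentiableAt (by simp)) (hLd _ _), mul_one] at h1
      exact h1
    have hdim : Module.finrank ℝ K1 ≤ Module.finrank ℝ Kg := by
      apply LinearMap.finrank_le_finrank_of_injective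
        (f := (L : E →ₗ[ℝ] E).restrict hLK)
      intro v w hvw
      exact Subtype.ext (hLinj (congrArg Subtype.val hvw))
    have heq : Kg = Kq := Submodule.eq_of_le_of_finrank_le hle (by
      have a1 := hrank 1 hqsurj
      have a2 := hrank g (hsurjg g hg)
      have a3 : Module.finrank ℝ Kq = Module.finrank ℝ K1 := by
        simp only [Kq, K1]; omega
      rw [a3]; exact hdim)
    intro v hv j
    have hv' : v ∈ Kg := by rw [heq]; exact hv
    rw [hKg, Submodule.mem_iInf] at hv'
    exact hv' j
  -- For the sup norm a ball of the product is a product of balls. Inside it the fibres of `q` are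
  -- balls, hence connected, and every `f j`, having zero derivative along them, is constant on
  -- them.
  obtain ⟨ε, hε, hball⟩ := Metric.isOpen_iff.1 (Λ.toHomeomorph.isOpenMap _ e.open_target)
    (Λ (e 1)) (mem_image_of_mem Λ (e.map_source h1e))
  have hΛc : ContinuousOn (fun g => Λ (e g)) e.source := Λ.continuous.comp_continuousOn e.continuousOn
  refine ⟨r, idx, e.source ∩ (fun g => Λ (e g)) ⁻¹' (Metric.ball (Λ (e 1)) ε),
    hΛc.isOpen_inter_preimage e.open_source Metric.isOpen_ball,
    ⟨h1e, Metric.mem_ball_self hε⟩, hqsurj, ?_⟩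
  intro g hg g' hg' hqq j
  set z := q g with hz
  set c₀ := (Λ (e 1)).2 with hc₀
  have hzb : z ∈ Metric.ball (Λ (e 1)).1 ε := by
    have := hg.2
    rw [mem_preimage, ← Prod.mk.eta (p := Λ (e 1)), ← ball_prod_same] at this
    rw [hz, ← hΛ g hg.1]
    exact this.1
  have hcb : ∀ h ∈ e.source ∩ (fun g => Λ (e g)) ⁻¹' (Metric.ball (Λ (e 1)) ε),
      (Λ (e h)).2 ∈ Metric.ball c₀ ε := by
    intro h hh
    have := hh.2
    rw [mem_preimage, ← Prod.mk.eta (p := Λ (e 1)), ← ball_prod_same] at this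
    exact this.2
  have htarget : ∀ c ∈ Metric.ball c₀ ε, Λ.symm (z, c) ∈ e.target := by
    intro c hc
    have : (z, c) ∈ Λ '' e.target := hball (by
      rw [← Prod.mk.eta (p := Λ (e 1)), ← ball_prod_same]; exact ⟨hzb, hc⟩)
    obtain ⟨y, hy, hyz⟩ := this
    rw [← hyz, Λ.symm_apply_apply]; exact hy
  set γ : EuclideanSpace ℝ (Fin (n - r)) → G := fun c => e.symm (Λ.symm (z, c)) with hγ
  have hγs : ∀ c ∈ Metric.ball c₀ ε, ContMDiffAt (𝓡 (n - r)) 𝓘(ℝ, E) ∞ γ c := by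
    intro c hc
    have a1 : ContMDiffAt (𝓡 (n - r)) 𝓘(ℝ, E) ∞ (fun c => Λ.symm (z, c)) c := by
      rw [contMDiffAt_iff_contDiffAt]; fun_prop
    exact (contMDiffAt_symm_of_mem_maximalAtlas he (htarget c hc)).comp c a1
  have hqγ : ∀ c ∈ Metric.ball c₀ ε, q (γ c) = z := by
    intro c hc
    rw [← hΛ _ (e.map_target (htarget c hc)), e.right_inv (htarget c hc), Λ.apply_symm_apply]
  have hconst := IsOpen.is_const_of_fderiv_eq_zero (𝕜 := ℝ) (f := fun c => f j (γ c))
    (s := Metric.ball c₀ ε) (x := (Λ (e g)).2) (y := (Λ (e g')).2) Metric.isOpen_ball (convex_ball c₀ ε).isPreconnected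
    (fun c hc => by
      have := (hf j).contMDiffAt.comp c (hγs c hc)
      rw [contMDiffAt_iff_contDiffAt] at this
      exact (this.differentiableAt (by simp)).differentiableWithinAt)
    (fun c hc => by
      ext1 w
      have hγd := (hγs c hc).mdifferentiableAt (by simp)
      rw [← mD_eq_fderiv, mD_comp_apply (E := EuclideanSpace ℝ (Fin (n - r))) (E' := E) (E'' := ℝ)
        (g := f j) (f := γ) c ((hf j).contMDiffAt.mdifferentiableAt (by simp)) hγd]
      apply hkerg _ (e.map_target (htarget c hc))
      rw [← mD_comp_apply (E := EuclideanSpace ℝ (Fin (n - r))) (E' := E)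
        (E'' := EuclideanSpace ℝ (Fin r)) (g := q) (f := γ) c
        (hqs.contMDiffAt.mdifferentiableAt (by simp)) hγd]
      have : (fun c => q (γ c)) =ᶠ[𝓝 c] fun _ => z := by
        filter_upwards [Metric.isOpen_ball.mem_nhds hc] with c' hc' using hqγ c' hc'
      rw [mD_congr this, mD_const]; rfl)
  have hγg : ∀ h ∈ e.source, q h = z → γ (Λ (e h)).2 = h := by
    intro h hh hqh
    rw [hγ]
    dsimp only
    rw [← hqh, ← hΛ h hh, Prod.mk.eta, Λ.symm_apply_apply, e.left_inv hh]
  have := hconst (hcb g hg) (hcb g' hg')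
  rwa [hγg g hg.1 rfl, hγg g' hg'.1 hqq.symm] at this

end ConstantRank

end QHam

namespace QHam
open Set Filter Topology Function IsManifold MeasureTheory

/-! ### Differentiation under the integral over a compact space. -/

section Average

variable {F : Type*} [NormedAddCommGroup F] [NormedSpace ℝ F]
  {U : Type*} [TopologicalSpace U] [ChartedSpace F U] [IsManifold 𝓘(ℝ, F) ∞ U] [CompactSpace U]
  {E : Type*} [NormedAddCommGroup E] [NormedSpace ℝ E] [FiniteDimensional ℝ E]
  {T : Type*} [TopologicalSpace T] [CompactSpace T]

omit [CompactSpace U] [FiniteDimensional ℝ E] in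
-- Keeps the class of integrands stable under differentiation in the linear variable, as the
-- induction in `contDiffOn_integral_param` requires.
theorem contMDiffOn_fderiv_param {V : Type*} [NormedAddCommGroup V] [NormedSpace ℝ V]
    {s : Set E} (hs : IsOpen s) {f : E → U → V}
    (hf : ContMDiffOn ((𝓘(ℝ, E)).prod 𝓘(ℝ, F)) 𝓘(ℝ, V) ∞ (uncurry f) (s ×ˢ univ)) :
    ContMDiffOn ((𝓘(ℝ, E)).prod 𝓘(ℝ, F)) 𝓘(ℝ, E →L[ℝ] V) ∞
      (uncurry fun x u => fderiv ℝ (fun y => f y u) x) (s ×ˢ univ) := by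
  rintro ⟨x, u⟩ ⟨hx, -⟩
  have hopen : IsOpen (s ×ˢ (univ : Set U)) := hs.prod isOpen_univ
  have h1 : ContMDiffAt (((𝓘(ℝ, E)).prod 𝓘(ℝ, F)).prod 𝓘(ℝ, E)) 𝓘(ℝ, V) ∞
      (uncurry fun (p : E × U) (y : E) => f y p.2) ((x, u), (x, u).1) := by
    have h2 : ContMDiffAt (((𝓘(ℝ, E)).prod 𝓘(ℝ, F)).prod 𝓘(ℝ, E)) ((𝓘(ℝ, E)).prod 𝓘(ℝ, F)) ∞
        (fun p : (E × U) × E => (p.2, p.1.2)) ((x, u), (x, u).1) :=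
      contMDiffAt_snd.prodMk (contMDiffAt_snd.comp _ contMDiffAt_fst)
    have h3 := hf.contMDiffAt (hopen.mem_nhds (show (x, u) ∈ s ×ˢ univ from ⟨hx, mem_univ u⟩))
    exact h3.comp ((x, u), (x, u).1) h2
  have h4 := ContMDiffAt.mfderiv (m := ∞) (fun (p : E × U) (y : E) => f y p.2) Prod.fst h1
    contMDiffAt_fst (by simp)
  have e : inTangentCoordinates 𝓘(ℝ, E) 𝓘(ℝ, V) Prod.fst (fun p : E × U => f p.1 p.2)
      (fun p => mfderiv 𝓘(ℝ, E) 𝓘(ℝ, V) (fun y => f y p.2) p.1) (x, u) =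
      fun p : E × U => fderiv ℝ (fun y => f y p.2) p.1 :=
    (inTangentCoordinates_model_space (I := 𝓘(ℝ, E)) (I' := 𝓘(ℝ, V)) Prod.fst
      (fun p : E × U => f p.1 p.2) (fun p => mfderiv 𝓘(ℝ, E) 𝓘(ℝ, V) (fun y => f y p.2) p.1)
      (x, u)).trans (funext fun p => mfderiv_eq_fderiv)
  rw [e] at h4
  exact h4.contMDiffWithinAt

variable [MeasurableSpace T] [BorelSpace T] (ν : Measure T) [IsFiniteMeasure ν]
  {j : T → U} (hj : Continuous j)

omit [IsManifold 𝓘(ℝ, F) ∞ U] [CompactSpace U] [CompactSpace T] [MeasurableSpace T]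
  [BorelSpace T] [FiniteDimensional ℝ E] in
include hj in
theorem continuous_param {V : Type*} [NormedAddCommGroup V] [NormedSpace ℝ V]
    {s : Set E} {f : E → U → V}
    (hf : ContMDiffOn ((𝓘(ℝ, E)).prod 𝓘(ℝ, F)) 𝓘(ℝ, V) ∞ (uncurry f) (s ×ˢ univ)) {x : E}
    (hx : x ∈ s) : Continuous fun t => f x (j t) :=
  hf.continuousOn.comp_continuous (f := fun t => (x, j t)) (by fun_prop) fun t => ⟨hx, mem_univ _⟩

include hj in
-- Integrals run over a compact space `T` mapped continuously to the manifold `U`. In the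
-- applications `T` is a closed subgroup, of which only the topology is used, while smoothness is
-- that of the integrand on `U`. The derivative is dominated by its bound on the compact product of
-- a closed ball and `U`.
theorem hasFDerivAt_integral_param {V : Type*} [NormedAddCommGroup V] [NormedSpace ℝ V]
    [FiniteDimensional ℝ V] {s : Set E} (hs : IsOpen s) {f : E → U → V}
    (hf : ContMDiffOn ((𝓘(ℝ, E)).prod 𝓘(ℝ, F)) 𝓘(ℝ, V) ∞ (uncurry f) (s ×ˢ univ)) {x : E}
    (hx : x ∈ s) :
    HasFDerivAt (fun x => ∫ t, f x (j t) ∂ν) (∫ t, fderiv ℝ (fun y => f y (j t)) x ∂ν) x := by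
  have hf' := contMDiffOn_fderiv_param hs hf
  obtain ⟨δ, hδ, hball⟩ := Metric.isOpen_iff.1 hs x hx
  have hcl : Metric.closedBall x (δ / 2) ⊆ s :=
    (Metric.closedBall_subset_ball (half_lt_self hδ)).trans hball
  have hcpt : IsCompact (Metric.closedBall x (δ / 2) ×ˢ (univ : Set U)) :=
    (isCompact_closedBall _ _).prod isCompact_univ
  obtain ⟨C, hC⟩ := hcpt.exists_bound_of_continuousOn
    (hf'.continuousOn.mono (prod_mono hcl subset_rfl))
  have hcont : ∀ y ∈ s, Continuous fun t => f y (j t) := fun y hy => continuous_param hj hf hy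
  have hsc : SecondCountableTopology V := inferInstance
  have hsc' : SecondCountableTopology (E →L[ℝ] V) := by
    have := FiniteDimensional.proper_real (E →L[ℝ] V)
    infer_instance
  refine hasFDerivAt_integral_of_dominated_of_fderiv_le (bound := fun _ => C)
    (F' := fun y t => fderiv ℝ (fun y => f y (j t)) y)
    (Metric.closedBall_mem_nhds x (half_pos hδ)) ?_ ?_ ?_ ?_ ?_ ?_
  · filter_upwards [hs.mem_nhds hx] with y hy using (hcont y hy).aestronglyMeasurable
  · exact (hcont x hx).integrable_of_hasCompactSupport (HasCompactSupport.of_compactSpace _)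
  · exact (continuous_param hj hf' hx).aestronglyMeasurable
  · exact Eventually.of_forall fun t y hy => hC (y, j t) ⟨hy, mem_univ _⟩
  · exact integrable_const C
  · refine Eventually.of_forall fun t y hy => ?_
    have h1 : ContMDiffAt 𝓘(ℝ, E) 𝓘(ℝ, V) ∞ (fun y => f y (j t)) y := by
      have h2 := hf.contMDiffAt ((hs.prod isOpen_univ).mem_nhds
        (show (y, j t) ∈ s ×ˢ univ from ⟨hcl hy, mem_univ _⟩))
      exact h2.comp y (contMDiffAt_id.prodMk contMDiffAt_const)
    rw [contMDiffAt_iff_contDiffAt] at h1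
    exact (h1.differentiableAt (by simp)).hasFDerivAt

end Average

/-! ### Mean values over a compact group. -/

section Average

variable {F : Type*} [NormedAddCommGroup F] [NormedSpace ℝ F]
  {U : Type*} [TopologicalSpace U] [ChartedSpace F U] [IsManifold 𝓘(ℝ, F) ∞ U] [CompactSpace U]
  {T : Type*} [TopologicalSpace T] [CompactSpace T]

/-- The derivative of the integral is the integral of the derivative, an integrand of the same kind
with values in a space of linear maps. Hence the induction over all target spaces `V`; the Euclidean
source keeps these spaces of linear maps in the universe of `V`. -/
theorem contDiffOn_integral_param [MeasurableSpace T] [BorelSpace T] (ν : Measure T)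
    [IsFiniteMeasure ν] {j : T → U} (hj : Continuous j) {m : ℕ}
    {s : Set (EuclideanSpace ℝ (Fin m))} (hs : IsOpen s) (n : ℕ) :
    ∀ {V : Type*} [NormedAddCommGroup V] [NormedSpace ℝ V] [FiniteDimensional ℝ V]
      {f : EuclideanSpace ℝ (Fin m) → U → V},
      ContMDiffOn ((𝓡 m).prod 𝓘(ℝ, F)) 𝓘(ℝ, V) ∞ (uncurry f) (s ×ˢ univ) →
      ContDiffOn ℝ n (fun x => ∫ t, f x (j t) ∂ν) s := by
  induction n with
  | zero =>
    intro V _ _ _ f hf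
    rw [Nat.cast_zero, contDiffOn_zero]
    exact fun x hx =>
      (hasFDerivAt_integral_param ν hj hs hf hx).continuousAt.continuousWithinAt
  | succ n ih =>
    intro V _ _ _ f hf
    rw [Nat.cast_succ, contDiffOn_succ_iff_fderiv_of_isOpen hs]
    refine ⟨fun x hx => (hasFDerivAt_integral_param ν hj hs hf
      hx).differentiableAt.differentiableWithinAt, fun h => by simp at h, ?_⟩
    exact (ih (contMDiffOn_fderiv_param hs hf)).congr fun x hx =>
      (hasFDerivAt_integral_param ν hj hs hf hx).fderiv

variable [Group T] [IsTopologicalGroup T]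

/-- The mean value of a function on a compact group. -/
def avg {V : Type*} [NormedAddCommGroup V] [NormedSpace ℝ V] (f : T → V) : V :=
  let _ : MeasurableSpace T := borel T
  have _ : BorelSpace T := ⟨rfl⟩
  ∫ t, f t ∂(Measure.haarMeasure (⊤ : TopologicalSpace.PositiveCompacts T))

section

variable {V : Type*} [NormedAddCommGroup V] [NormedSpace ℝ V]

theorem avg_const [CompleteSpace V] (c : V) : avg (fun _ : T => c) = c := by
  let _ : MeasurableSpace T := borel T
  have _ : BorelSpace T := ⟨rfl⟩
  have h := Measure.haarMeasure_self (K₀ := (⊤ : TopologicalSpace.PositiveCompacts T))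
  rw [TopologicalSpace.PositiveCompacts.coe_top] at h
  unfold avg
  rw [integral_const, Measure.real, h]
  simp

theorem avg_mul_left (f : T → V) (s : T) : avg (fun t => f (s * t)) = avg f := by
  let _ : MeasurableSpace T := borel T
  have _ : BorelSpace T := ⟨rfl⟩
  exact integral_mul_left_eq_self f s

theorem avg_clm {W : Type*} [NormedAddCommGroup W] [NormedSpace ℝ W] [CompleteSpace V]
    [CompleteSpace W] (L : V →L[ℝ] W) {f : T → V} (hf : Continuous f) :
    avg (fun t => L (f t)) = L (avg f) := by
  let _ : MeasurableSpace T := borel T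
  have _ : BorelSpace T := ⟨rfl⟩
  exact L.integral_comp_comm
    (hf.integrable_of_hasCompactSupport (HasCompactSupport.of_compactSpace _))

theorem avg_pos {f : T → ℝ} (hf : Continuous f) (h0 : ∀ t, 0 ≤ f t) {t : T} (ht : f t ≠ 0) :
    0 < avg f := by
  let _ : MeasurableSpace T := borel T
  have _ : BorelSpace T := ⟨rfl⟩
  exact hf.integral_pos_of_hasCompactSupport_nonneg_nonzero
    (HasCompactSupport.of_compactSpace _) h0 ht

variable {E : Type*} [NormedAddCommGroup E] [NormedSpace ℝ E] [FiniteDimensional ℝ E]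
  {M : Type*} [TopologicalSpace M] [ChartedSpace E M] [IsManifold 𝓘(ℝ, E) ∞ M]
  [FiniteDimensional ℝ V] {j : T → U} (hj : Continuous j) {Φ : M → U → V}
  (hΦ : ContMDiff ((𝓘(ℝ, E)).prod 𝓘(ℝ, F)) 𝓘(ℝ, V) ∞ (uncurry Φ))

include hj hΦ in
theorem contMDiffAt_mD_avg (x : M) :
    ContMDiffAt 𝓘(ℝ, E) 𝓘(ℝ, V) ∞ (fun y => avg fun t => Φ y (j t)) x ∧
    ∀ v, mD E V (fun y => avg fun t => Φ y (j t)) x v = avg fun t => mD E V (fun y => Φ y (j t)) x v := by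
  let _ : MeasurableSpace T := borel T
  have _ : BorelSpace T := ⟨rfl⟩
  set ν := Measure.haarMeasure (⊤ : TopologicalSpace.PositiveCompacts T) with hν
  have : IsFiniteMeasure ν := CompactSpace.isFiniteMeasure
  set e := chartAt E x
  have he : e ∈ maximalAtlas 𝓘(ℝ, E) ∞ M := chart_mem_maximalAtlas x
  have hxe : x ∈ e.source := mem_chart_source E x
  set ε := toEuclidean (E := E)
  set s : Set (EuclideanSpace ℝ (Fin (Module.finrank ℝ E))) := ε.symm ⁻¹' e.target with hs
  have hso : IsOpen s := e.open_target.preimage ε.symm.continuous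
  set γ : EuclideanSpace ℝ (Fin (Module.finrank ℝ E)) → M := fun y => e.symm (ε.symm y) with hγ
  have hγs : ContMDiffOn (𝓡 (Module.finrank ℝ E)) 𝓘(ℝ, E) ∞ γ s :=
    (contMDiffOn_symm_of_mem_maximalAtlas he).comp
      (ε.symm : EuclideanSpace ℝ (Fin (Module.finrank ℝ E)) →L[ℝ] E).contMDiff.contMDiffOn
      fun y hy => hy
  set f : EuclideanSpace ℝ (Fin (Module.finrank ℝ E)) → U → V := fun y u => Φ (γ y) u with hf
  have hfs : ContMDiffOn ((𝓡 (Module.finrank ℝ E)).prod 𝓘(ℝ, F)) 𝓘(ℝ, V) ∞ (uncurry f)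
      (s ×ˢ univ) := by
    have h1 : ContMDiffOn ((𝓡 (Module.finrank ℝ E)).prod 𝓘(ℝ, F)) ((𝓘(ℝ, E)).prod 𝓘(ℝ, F)) ∞
        (fun p : EuclideanSpace ℝ (Fin (Module.finrank ℝ E)) × U => (γ p.1, p.2)) (s ×ˢ univ) :=
      (hγs.comp contMDiffOn_fst fun p hp => hp.1).prodMk contMDiffOn_snd
    exact hΦ.comp_contMDiffOn h1
  set A := fun y => ∫ t, f y (j t) ∂ν with hA
  have hAs : ContDiffOn ℝ ∞ A s :=
    contDiffOn_infty.2 fun n => contDiffOn_integral_param ν hj hso n hfs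
  set z := ε (e x) with hz
  have hzs : z ∈ s := by
    rw [hs, mem_preimage, hz, ε.symm_apply_apply]
    exact e.map_source hxe
  have hAz : ContMDiffAt (𝓡 (Module.finrank ℝ E)) 𝓘(ℝ, V) ∞ A z := by
    rw [contMDiffAt_iff_contDiffAt]; exact hAs.contDiffAt (hso.mem_nhds hzs)
  have hεe : ContMDiffAt 𝓘(ℝ, E) (𝓡 (Module.finrank ℝ E)) ∞ (fun y => ε (e y)) x :=
    (ε : E →L[ℝ] EuclideanSpace ℝ (Fin (Module.finrank ℝ E))).contMDiff.contMDiffAt.comp x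
      (contMDiffAt_of_mem_maximalAtlas he hxe)
  have hγε : ∀ y ∈ e.source, γ (ε (e y)) = y := by
    intro y hy
    rw [hγ]; dsimp only
    rw [ε.symm_apply_apply, e.left_inv hy]
  have hev : (fun y => avg fun t => Φ y (j t)) =ᶠ[𝓝 x] fun y => A (ε (e y)) := by
    filter_upwards [e.open_source.mem_nhds hxe] with y hy
    rw [hA]
    simp only [hf, hγε y hy]
    rfl
  constructor
  · have h : ContMDiffAt 𝓘(ℝ, E) 𝓘(ℝ, V) ∞ (fun y => A (ε (e y))) x :=
      ContMDiffAt.comp (g := A) (f := fun y => ε (e y)) x hAz hεe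
    exact h.congr_of_eventuallyEq hev
  · intro v
    rw [mD_congr hev, mD_comp_apply (E := E) (E' := EuclideanSpace ℝ (Fin (Module.finrank ℝ E)))
      (E'' := V) (g := A) x (hAz.mdifferentiableAt (by simp)) (hεe.mdifferentiableAt (by simp)),
      mD_eq_fderiv, (hasFDerivAt_integral_param ν hj hso hfs hzs).fderiv]
    have hcont := continuous_param hj (contMDiffOn_fderiv_param hso hfs) hzs
    rw [ContinuousLinearMap.integral_apply
      (hcont.integrable_of_hasCompactSupport (HasCompactSupport.of_compactSpace _))]
    unfold avg
    refine integral_congr_ae (Eventually.of_forall fun t => ?_)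
    dsimp only
    have h1 : (fun y => Φ y (j t)) =ᶠ[𝓝 x] fun y => f (ε (e y)) (j t) := by
      filter_upwards [e.open_source.mem_nhds hxe] with y hy
      simp only [hf, hγε y hy]
    have h2 : ContMDiffAt (𝓡 (Module.finrank ℝ E)) 𝓘(ℝ, V) ∞ (fun y => f y (j t)) z := by
      have h2 := hfs.contMDiffAt ((hso.prod isOpen_univ).mem_nhds
        (show (z, j t) ∈ s ×ˢ univ from ⟨hzs, mem_univ _⟩))
      exact h2.comp z (contMDiffAt_id.prodMk contMDiffAt_const)
    rw [mD_congr h1, mD_comp_apply (E := E) (E' := EuclideanSpace ℝ (Fin (Module.finrank ℝ E)))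
      (E'' := V) (g := fun y => f y (j t)) x (h2.mdifferentiableAt (by simp))
      (hεe.mdifferentiableAt (by simp)), mD_eq_fderiv]

include hj hΦ in
theorem contMDiff_avg : ContMDiff 𝓘(ℝ, E) 𝓘(ℝ, V) ∞ (fun y => avg fun t => Φ y (j t)) :=
  fun x => (contMDiffAt_mD_avg hj hΦ x).1

end

end Average

end QHam

namespace QHam
open Set Filter Topology Function IsManifold

section Smooth

variable {E : Type*} [NormedAddCommGroup E] [NormedSpace ℝ E]
  {M : Type*} [TopologicalSpace M] [ChartedSpace E M]
  {E' : Type*} [NormedAddCommGroup E'] [NormedSpace ℝ E']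
  {M' : Type*} [TopologicalSpace M'] [ChartedSpace E' M']
  {E'' : Type*} [NormedAddCommGroup E''] [NormedSpace ℝ E'']
  {M'' : Type*} [TopologicalSpace M''] [ChartedSpace E'' M'']

theorem mD_comp_at {g : M' → M''} {f : M → M'} (x : M)
    (hg : ContMDiffAt 𝓘(ℝ, E') 𝓘(ℝ, E'') ∞ g (f x)) (hf : ContMDiffAt 𝓘(ℝ, E) 𝓘(ℝ, E') ∞ f x)
    (v : E) :
    mD E E'' (fun y => g (f y)) x v = mD E' E'' g (f x) (mD E E' f x v) :=
  mD_comp_apply x (hg.mdifferentiableAt (by simp)) (hf.mdifferentiableAt (by simp)) v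

theorem mD_comp_smooth {g : M' → M''} {f : M → M'}
    (hg : ContMDiff 𝓘(ℝ, E') 𝓘(ℝ, E'') ∞ g) (hf : ContMDiff 𝓘(ℝ, E) 𝓘(ℝ, E') ∞ f) (x : M)
    (v : E) :
    mD E E'' (fun y => g (f y)) x v = mD E' E'' g (f x) (mD E E' f x v) :=
  mD_comp_at x hg.contMDiffAt hf.contMDiffAt v

theorem mD_bijective_of_inverse {f : M → M'} {g : M' → M}
    (hf : ContMDiff 𝓘(ℝ, E) 𝓘(ℝ, E') ∞ f) (hg : ContMDiff 𝓘(ℝ, E') 𝓘(ℝ, E) ∞ g)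
    (hl : LeftInverse g f) (hr : Function.RightInverse g f) (x : M) : Bijective (mD E E' f x) := by
  have h1 : ∀ v, mD E' E g (f x) (mD E E' f x v) = v := by
    intro v
    rw [← mD_comp_smooth hg hf]
    have : (fun y => g (f y)) = fun y => y := funext hl
    rw [this, mD_id]; rfl
  have h2 : ∀ v, mD E E' f x (mD E' E g (f x) v) = v := by
    intro v
    have h := mD_comp_smooth hf hg (f x) v
    have h3 : (fun y => f (g y)) = fun y => y := funext hr
    rw [h3, mD_id, hl] at h
    exact h.symm
  exact ⟨LeftInverse.injective h1, Function.RightInverse.surjective h2⟩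

end Smooth

/-! ### A closed subgroup and its cosets as fibres of submersions. -/

section CosetSubmersion

variable {F : Type*} [NormedAddCommGroup F] [NormedSpace ℝ F] [FiniteDimensional ℝ F]
  {G : Type*} [TopologicalSpace G] [ChartedSpace F G] [Group G] [LieGroup 𝓘(ℝ, F) ∞ G]

omit [FiniteDimensional ℝ F] in
theorem mD_mul_left_bijective (g x : G) : Bijective (mD F F (fun h : G => g * h) x) :=
  mD_bijective_of_inverse (g := fun h : G => g⁻¹ * h) contMDiff_mul_left contMDiff_mul_left
    (fun h => inv_mul_cancel_left g h) (fun h => mul_inv_cancel_left g h) x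

variable [T2Space G] [CompactSpace G]

/-- Average over right translations by `H` a nonnegative smooth function with zero set `H`. Outside
`H` the average stays positive, because the integrand is continuous, nonnegative and nonzero at `t =
1`. -/
theorem exists_coset_invariant_function (H : Subgroup G) (hH : IsClosed (H : Set G)) :
    ∃ f : G → ℝ, ContMDiff 𝓘(ℝ, F) 𝓘(ℝ, ℝ) ∞ f ∧ (∀ g, ∀ h ∈ H, f (g * h) = f g) ∧
      ∀ g, f g = 0 ↔ g ∈ H := by
  have : IsTopologicalGroup G := topologicalGroup_of_lieGroup 𝓘(ℝ, F) ∞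
  have : CompactSpace H := isCompact_iff_compactSpace.1 hH.isCompact
  obtain ⟨f, hf, hr, h0, -⟩ := exists_contMDiff_zero_iff_one_iff_of_isClosed (n := (⊤ : ℕ∞)) 𝓘(ℝ, F) hH
    isClosed_empty (disjoint_empty _)
  have hpos : ∀ g, 0 ≤ f g := fun g => (hr ⟨g, rfl⟩).1
  have hΦ : ContMDiff ((𝓘(ℝ, F)).prod 𝓘(ℝ, F)) 𝓘(ℝ, ℝ) ∞ (uncurry fun g u : G => f (g * u)) :=
    hf.comp (contMDiff_mul 𝓘(ℝ, F) ∞)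
  refine ⟨fun g => avg fun t : H => f (g * t), contMDiff_avg continuous_subtype_val hΦ, ?_, ?_⟩
  · intro g h hh
    have := avg_mul_left (fun t : H => f (g * t)) ⟨h, hh⟩
    dsimp only
    rw [← this]
    simp [mul_assoc]
  · intro g
    constructor
    · intro h
      by_contra hg
      have h1 : f (g * ((1 : H) : G)) ≠ 0 := by
        rw [Subgroup.coe_one, mul_one]
        exact fun h2 => hg ((h0 g).2 h2)
      have h2 := avg_pos (T := H) (f := fun t : H => f (g * t))
        (hf.continuous.comp (continuous_const.mul continuous_subtype_val)) (fun t => hpos _) h1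
      exact h2.ne' h
    · intro h
      have h1 : (fun t : H => f (g * t)) = fun _ => 0 :=
        funext fun t => (h0 _).1 (H.mul_mem h t.2)
      dsimp only
      rw [h1, avg_const]

/-- Around each point, the fibres of the projection to the coset space of a closed subgroup are
the fibres of a smooth submersion to a Euclidean space. -/
theorem exists_coset_submersion (H : Subgroup G) (hH : IsClosed (H : Set G)) :
    ∃ r d : ℕ, Module.finrank ℝ F = r + d ∧
      ∀ g₀ : G, ∃ (s : Set G) (q : G → EuclideanSpace ℝ (Fin r)), IsOpen s ∧ g₀ ∈ s ∧
      ContMDiff 𝓘(ℝ, F) (𝓡 r) ∞ q ∧ Surjective (mD F (EuclideanSpace ℝ (Fin r)) q g₀) ∧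
      (∀ g, ∀ h ∈ H, q (g * h) = q g) ∧ ∀ g ∈ s, ∀ g' ∈ s, q g = q g' → g⁻¹ * g' ∈ H := by
  have : IsTopologicalGroup G := topologicalGroup_of_lieGroup 𝓘(ℝ, F) ∞
  obtain ⟨f, hf, hfH, hf0⟩ := exists_coset_invariant_function (F := F) H hH
  -- The family consists of all left translates of `f`: it is stable under left translation, and
  -- each member is invariant under right translation by `H`.
  obtain ⟨r, idx, V, hV, h1V, hsurj, hinj⟩ := exists_submersion_of_family (fun u g : G => f (u * g))
    (fun u => hf.comp contMDiff_mul_left) (fun u g => ⟨u * g, fun x => by rw [mul_assoc]⟩)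
  set q := toEuclid fun i g => f (idx i * g) with hq
  have hqs : ContMDiff 𝓘(ℝ, F) (𝓡 r) ∞ q :=
    contMDiff_toEuclid fun i => hf.comp contMDiff_mul_left
  have hr : r ≤ Module.finrank ℝ F := by
    simpa using LinearMap.finrank_le_finrank_of_surjective
      (f := (mD F (EuclideanSpace ℝ (Fin r)) q 1 : F →ₗ[ℝ] EuclideanSpace ℝ (Fin r))) hsurj
  refine ⟨r, Module.finrank ℝ F - r, by omega, fun g₀ => ⟨(fun g => g₀⁻¹ * g) ⁻¹' V,
    fun g => q (g₀⁻¹ * g), hV.preimage (continuous_const_mul _), by simpa using h1V,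
    hqs.comp contMDiff_mul_left, ?_, ?_, ?_⟩⟩
  · have h : ∀ v, mD F (EuclideanSpace ℝ (Fin r)) (fun g => q (g₀⁻¹ * g)) g₀ v =
        mD F (EuclideanSpace ℝ (Fin r)) q 1 (mD F F (fun g => g₀⁻¹ * g) g₀ v) := by
      intro v
      rw [mD_comp_smooth hqs contMDiff_mul_left, inv_mul_cancel]
    intro w
    obtain ⟨v, hv⟩ := hsurj w
    obtain ⟨v', hv'⟩ := (mD_mul_left_bijective g₀⁻¹ g₀).2 v
    exact ⟨v', by rw [h, hv', hv]⟩
  · intro g h hh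
    refine toEuclid_eq_iff.2 fun i => ?_
    have := hfH (idx i * (g₀⁻¹ * g)) h hh
    simpa [mul_assoc] using this
  · intro g hg g' hg' h
    -- The translate with index `(g₀⁻¹ g)⁻¹` takes the value `f 1 = 0` at `g₀⁻¹ g` and `f (g⁻¹ g')`
    -- at `g₀⁻¹ g'`. Their equality puts `g⁻¹ g'` in the zero set `H`.
    have h1 := hinj _ hg _ hg' h (g₀⁻¹ * g)⁻¹
    dsimp only at h1
    rw [inv_mul_cancel] at h1
    have h2 := (hf0 1).2 H.one_mem
    rw [h2] at h1
    have h3 := (hf0 _).1 h1.symm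
    simpa [mul_assoc] using h3

end CosetSubmersion

/-! ### Local sections of submersions and descent of smoothness. -/

section Section

variable {E : Type*} [NormedAddCommGroup E] [NormedSpace ℝ E]
  {M : Type*} [TopologicalSpace M] [ChartedSpace E M]
  {E' : Type*} [NormedAddCommGroup E'] [NormedSpace ℝ E']
  {M' : Type*} [TopologicalSpace M'] [ChartedSpace E' M']
  {E'' : Type*} [NormedAddCommGroup E''] [NormedSpace ℝ E'']
  {M'' : Type*} [TopologicalSpace M''] [ChartedSpace E'' M'']

/-- A submersion has smooth local sections. -/
theorem exists_local_section {f : M → M'}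
    (hf : Manifold.IsSubmersion 𝓘(ℝ, E) 𝓘(ℝ, E') ∞ f) (x : M) :
    ∃ s : M' → M, s (f x) = x ∧ ContMDiffAt 𝓘(ℝ, E') 𝓘(ℝ, E) ∞ s (f x) ∧
      ∀ᶠ y in 𝓝 (f x), f (s y) = y := by
  have h := hf.isSubmersionAt x
  set e := h.domChart
  set e' := h.codChart
  set Λ := h.equiv
  have hw : ∀ y ∈ e.source, e' (f y) = (Λ (e y)).1 := by
    intro y hy
    have h0 : e y ∈ (e.extend 𝓘(ℝ, E)).target := by simpa using e.map_source hy
    have h1 := h.writtenInCharts h0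
    have h2 : (e.extend 𝓘(ℝ, E)).symm (e y) = y := by simpa using e.left_inv hy
    simp only [comp_apply] at h1
    rw [h2] at h1
    exact h1
  set γ : E' → E := fun z => Λ.symm (z, (Λ (e x)).2) with hγ
  have hγs : ContDiff ℝ ∞ γ := Λ.symm.contDiff.comp (contDiff_id.prodMk contDiff_const)
  have hxe : x ∈ e.source := h.mem_domChart_source
  have hxe' : f x ∈ e'.source := h.mem_codChart_source
  have hγx : γ (e' (f x)) = e x := by
    rw [hγ]; dsimp only
    rw [hw x hxe]; simp
  have hsx : e.symm (γ (e' (f x))) = x := by rw [hγx, e.left_inv hxe]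
  have h1 : ContMDiffAt 𝓘(ℝ, E') 𝓘(ℝ, E) ∞ (fun y => γ (e' y)) (f x) :=
    hγs.contMDiff.contMDiffAt.comp (f x)
      (contMDiffAt_of_mem_maximalAtlas h.codChart_mem_maximalAtlas hxe')
  have h2 : ContMDiffAt 𝓘(ℝ, E') 𝓘(ℝ, E) ∞ (fun y => e.symm (γ (e' y))) (f x) := by
    refine ContMDiffAt.comp (g := e.symm) (f := fun y => γ (e' y)) (f x) ?_ h1
    rw [hγx]
    exact contMDiffAt_symm_of_mem_maximalAtlas h.domChart_mem_maximalAtlas (e.map_source hxe)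
  refine ⟨fun y => e.symm (γ (e' y)), hsx, h2, ?_⟩
  have h3 : ∀ᶠ y in 𝓝 (f x), γ (e' y) ∈ e.target :=
    h1.continuousAt.eventually_mem (e.open_target.mem_nhds (by rw [hγx]; exact e.map_source hxe))
  have h4 : ∀ᶠ y in 𝓝 (f x), f (e.symm (γ (e' y))) ∈ e'.source := by
    have h5 : ContinuousAt (fun y => f (e.symm (γ (e' y)))) (f x) := by
      refine ContinuousAt.comp (g := f) ?_ h2.continuousAt
      exact hf.contMDiff.continuous.continuousAt
    exact h5.eventually_mem (e'.open_source.mem_nhds (by rw [hsx]; exact hxe'))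
  filter_upwards [h3, h4, e'.open_source.mem_nhds hxe'] with y hy1 hy2 hy3
  apply e'.injOn hy2 hy3
  rw [hw _ (e.map_target hy1), e.right_inv hy1, hγ]
  simp

theorem mD_surjective_of_isSubmersion {f : M → M'}
    (hf : Manifold.IsSubmersion 𝓘(ℝ, E) 𝓘(ℝ, E') ∞ f) (x : M) : Surjective (mD E E' f x) := by
  obtain ⟨s, hsx, hs, hfs⟩ := exists_local_section hf x
  intro w
  refine ⟨mD E' E s (f x) w, ?_⟩
  have h := mD_comp_at (g := f) (f := s) (f x) hf.contMDiff.contMDiffAt hs w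
  rw [hsx] at h
  rw [← h, mD_congr (g := fun y => y) hfs, mD_id]; rfl

theorem contMDiffAt_of_comp_submersion {f : M → M'}
    (hf : Manifold.IsSubmersion 𝓘(ℝ, E) 𝓘(ℝ, E') ∞ f) {g : M' → M''} (x : M)
    (hg : ContMDiffAt 𝓘(ℝ, E) 𝓘(ℝ, E'') ∞ (fun y => g (f y)) x) :
    ContMDiffAt 𝓘(ℝ, E') 𝓘(ℝ, E'') ∞ g (f x) := by
  obtain ⟨s, hsx, hs, hfs⟩ := exists_local_section hf x
  have h1 : ContMDiffAt 𝓘(ℝ, E') 𝓘(ℝ, E'') ∞ (fun y => g (f (s y))) (f x) :=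
    ContMDiffAt.comp (g := fun y => g (f y)) (f := s) (f x) (by rw [hsx]; exact hg) hs
  refine h1.congr_of_eventuallyEq ?_
  filter_upwards [hfs] with y hy
  rw [hy]

theorem contMDiffAt_of_comp_submersion_prod {f : M → M'}
    (hf : Manifold.IsSubmersion 𝓘(ℝ, E) 𝓘(ℝ, E') ∞ f)
    {E₁ : Type*} [NormedAddCommGroup E₁] [NormedSpace ℝ E₁]
    {M₁ : Type*} [TopologicalSpace M₁] [ChartedSpace E₁ M₁] {g : M' × M₁ → M''} (x : M) (z : M₁)
    (hg : ContMDiffAt ((𝓘(ℝ, E)).prod 𝓘(ℝ, E₁)) 𝓘(ℝ, E'') ∞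
      (fun y : M × M₁ => g (f y.1, y.2)) (x, z)) :
    ContMDiffAt ((𝓘(ℝ, E')).prod 𝓘(ℝ, E₁)) 𝓘(ℝ, E'') ∞ g (f x, z) := by
  obtain ⟨s, hsx, hs, hfs⟩ := exists_local_section hf x
  have h0 : ContMDiffAt ((𝓘(ℝ, E')).prod 𝓘(ℝ, E₁)) ((𝓘(ℝ, E)).prod 𝓘(ℝ, E₁)) ∞
      (fun y : M' × M₁ => (s y.1, y.2)) (f x, z) :=
    (ContMDiffAt.comp (g := s) (f := Prod.fst) (f x, z) hs contMDiffAt_fst).prodMk contMDiffAt_snd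
  have h1 : ContMDiffAt ((𝓘(ℝ, E')).prod 𝓘(ℝ, E₁)) 𝓘(ℝ, E'') ∞
      (fun y : M' × M₁ => g (f (s y.1), y.2)) (f x, z) :=
    ContMDiffAt.comp (g := fun y : M × M₁ => g (f y.1, y.2)) (f := fun y : M' × M₁ => (s y.1, y.2))
      (f x, z) (by dsimp only; rw [hsx]; exact hg) h0
  refine h1.congr_of_eventuallyEq ?_
  filter_upwards [continuous_fst.continuousAt.eventually hfs] with y hy
  rw [hy]

end Section

end QHam

namespace QHam
open Set Filter Topology Function IsManifold

/-! ### Lie group structures on closed subgroups and on quotients. -/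

section SubgroupQuotient

variable {F : Type*} [NormedAddCommGroup F] [NormedSpace ℝ F] [FiniteDimensional ℝ F]
  {G : Type*} [TopologicalSpace G] [ChartedSpace F G] [Group G] [LieGroup 𝓘(ℝ, F) ∞ G]
  [T2Space G] [CompactSpace G]

/-- Near a point `x` of `H` the fibre of the coset submersion through `x` is `x H = H`, so `H` is
cut out by `q - q x`. The group operations are smooth because smoothness of a continuous map can be
tested after an immersion. -/
theorem exists_lieSubgroup (H : Subgroup G) (hH : IsClosed (H : Set G)) :
    ∃ (a : ℕ) (_ : ChartedSpace (EuclideanSpace ℝ (Fin a)) H), LieGroup (𝓡 a) ∞ H ∧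
      Manifold.IsSmoothEmbedding (𝓡 a) 𝓘(ℝ, F) ∞ H.subtype := by
  have : IsTopologicalGroup G := topologicalGroup_of_lieGroup 𝓘(ℝ, F) ∞
  obtain ⟨r, d, hdim, h⟩ := exists_coset_submersion (F := F) H hH
  have hi : IsEmbedding H.subtype := IsEmbedding.subtypeVal
  obtain ⟨cs, hm, hs⟩ := exists_submanifold (E := F) hi r d hdim (by
    intro x
    obtain ⟨s, q, hs, hxs, hq, hsurj, hqH, hqs⟩ := h x
    refine ⟨s, fun y => q y - q x, hs, hxs, (hq.sub contMDiff_const).contMDiffOn, ?_, ?_⟩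
    · have h1 : ∀ v, mD F (EuclideanSpace ℝ (Fin r)) (fun y => q y - q x) (x : G) v =
          mD F (EuclideanSpace ℝ (Fin r)) q (x : G) v := by
        intro v
        rw [mD_comp_smooth (g := fun z : EuclideanSpace ℝ (Fin r) => z - q x)
          (contDiff_id.sub contDiff_const).contMDiff hq, mD_eq_fderiv, fderiv_sub_const]
        simp
      intro w
      obtain ⟨v, hv⟩ := hsurj w
      exact ⟨v, (h1 v).trans hv⟩
    · intro y hy
      rw [sub_eq_zero]
      constructor
      · rintro ⟨z, rfl⟩
        have h1 := hqH x ((x : G)⁻¹ * z) (H.mul_mem (H.inv_mem x.2) z.2)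
        rw [mul_inv_cancel_left] at h1
        exact h1
      · intro h1
        have h2 := hqs x hxs y hy h1.symm
        exact ⟨⟨y, by simpa using H.mul_mem x.2 h2⟩, rfl⟩)
  refine ⟨d, cs, ?_, hs⟩
  have hsub : ContMDiff (𝓡 d) 𝓘(ℝ, F) ∞ H.subtype := hs.contMDiff
  have key {E₁ H₁ M₁ : Type _} [NormedAddCommGroup E₁] [NormedSpace ℝ E₁] [TopologicalSpace H₁]
      [TopologicalSpace M₁] {I : ModelWithCorners ℝ E₁ H₁} [ChartedSpace H₁ M₁] (f : M₁ → H)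
      (hf : Continuous f) (hf' : ContMDiff I 𝓘(ℝ, F) ∞ (fun y => (f y : G))) :
      ContMDiff I (𝓡 d) ∞ f :=
    fun y => (ContMDiffAt.iff_comp_isImmersionAt (hs.isImmersion.isImmersionAt _)).2
      ⟨hf.continuousAt, hf' y⟩
  refine { contMDiff_mul := key _ continuous_mul ?_, contMDiff_inv := key _ continuous_inv ?_ }
  · have h1 : ContMDiff ((𝓡 d).prod (𝓡 d)) ((𝓘(ℝ, F)).prod 𝓘(ℝ, F)) ∞
        (fun p : H × H => ((p.1 : G), (p.2 : G))) := hsub.prodMap hsub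
    exact (contMDiff_mul 𝓘(ℝ, F) ∞).comp h1
  · exact (contMDiff_inv 𝓘(ℝ, F) ∞).comp hsub

/-- The charts come from the same submersion, now read on its image. The group operations of the
quotient are those of `G` composed with smooth local sections of the projection. -/
theorem exists_lieQuotient (H : Subgroup G) [H.Normal] (hH : IsClosed (H : Set G)) :
    ∃ (b : ℕ) (_ : ChartedSpace (EuclideanSpace ℝ (Fin b)) (G ⧸ H)), LieGroup (𝓡 b) ∞ (G ⧸ H) ∧
      Manifold.IsSubmersion 𝓘(ℝ, F) (𝓡 b) ∞ (QuotientGroup.mk' H) := by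
  have : IsTopologicalGroup G := topologicalGroup_of_lieGroup 𝓘(ℝ, F) ∞
  obtain ⟨b, c, hdim, h⟩ := exists_coset_submersion (F := F) H hH
  have hpc : Continuous (QuotientGroup.mk' H) := QuotientGroup.continuous_mk
  have hpo : IsOpenMap (QuotientGroup.mk' H) := QuotientGroup.isOpenMap_coe
  obtain ⟨cs, hm, hs⟩ := exists_quotient_manifold (E := F) hpc hpo (QuotientGroup.mk'_surjective H)
    b c hdim (by
    intro g
    obtain ⟨s, q, hs, hgs, hq, hsurj, hqH, hqs⟩ := h g
    refine ⟨s, q, hs, hgs, hq, hsurj, ?_, ?_⟩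
    · intro g₁ g₂ h12
      have h1 := hqH g₁ _ (QuotientGroup.eq.1 h12)
      rw [mul_inv_cancel_left] at h1
      exact h1.symm
    · intro g₁ hg₁ g₂ hg₂ h12
      exact QuotientGroup.eq.2 (hqs g₁ hg₁ g₂ hg₂ h12))
  refine ⟨b, cs, ?_, hs⟩
  have hp := hs.contMDiff
  refine { contMDiff_mul := ?_, contMDiff_inv := ?_ }
  · rintro ⟨x, y⟩
    obtain ⟨x, rfl⟩ := QuotientGroup.mk'_surjective H x
    obtain ⟨y, rfl⟩ := QuotientGroup.mk'_surjective H y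
    obtain ⟨s, hsx, hs1, hfs⟩ := exists_local_section hs x
    obtain ⟨t, hty, ht1, hft⟩ := exists_local_section hs y
    have h1 : ContMDiffAt ((𝓡 b).prod (𝓡 b)) ((𝓘(ℝ, F)).prod 𝓘(ℝ, F)) ∞
        (fun p : (G ⧸ H) × (G ⧸ H) => (s p.1, t p.2))
        (QuotientGroup.mk' H x, QuotientGroup.mk' H y) := hs1.prodMap' ht1
    have h2 : ContMDiffAt ((𝓡 b).prod (𝓡 b)) (𝓡 b) ∞
        (fun p : (G ⧸ H) × (G ⧸ H) => QuotientGroup.mk' H (s p.1 * t p.2))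
        (QuotientGroup.mk' H x, QuotientGroup.mk' H y) :=
      ((hp.comp (contMDiff_mul 𝓘(ℝ, F) ∞)).contMDiffAt).comp _ h1
    refine h2.congr_of_eventuallyEq ?_
    filter_upwards [continuous_fst.continuousAt.eventually hfs,
      continuous_snd.continuousAt.eventually hft] with p hp1 hp2
    rw [map_mul, hp1, hp2]
  · intro x
    obtain ⟨x, rfl⟩ := QuotientGroup.mk'_surjective H x
    refine contMDiffAt_of_comp_submersion hs x ?_
    have h1 : (fun y : G => (QuotientGroup.mk' H y)⁻¹) = fun y => QuotientGroup.mk' H y⁻¹ :=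
      funext fun y => (map_inv _ _).symm
    rw [h1]
    exact (hp.comp (contMDiff_inv 𝓘(ℝ, F) ∞)).contMDiffAt

end SubgroupQuotient

end QHam

namespace QHam
open Set Filter Topology Function IsManifold

/-! ### Linearizing a compact group near a fixed point, for an action on `M` as well as for
conjugation in `U`. -/

section Linearization

variable {F : Type*} [NormedAddCommGroup F] [NormedSpace ℝ F]
  {U : Type*} [TopologicalSpace U] [ChartedSpace F U] [Group U] [LieGroup 𝓘(ℝ, F) ∞ U]
  {E : Type*} [NormedAddCommGroup E] [NormedSpace ℝ E] [FiniteDimensional ℝ E]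
  {M : Type*} [TopologicalSpace M] [ChartedSpace E M] [IsManifold 𝓘(ℝ, E) ∞ M]

/-- The preferred chart at a point, centered and extended to a global smooth map. -/
theorem exists_global_chart [T2Space M] (x : M) : ∃ h : M → E, ContMDiff 𝓘(ℝ, E) 𝓘(ℝ, E) ∞ h ∧
    h x = 0 ∧ mD E E h x = ContinuousLinearMap.id ℝ E := by
  obtain ⟨f⟩ : Nonempty (SmoothBumpFunction 𝓘(ℝ, E) x) := inferInstance
  set φ : M → E := fun y => chartAt E x y - chartAt E x x with hφ
  have hφs : ContMDiffOn 𝓘(ℝ, E) 𝓘(ℝ, E) ∞ φ (chartAt E x).source :=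
    contMDiffOn_chart.sub contMDiffOn_const
  refine ⟨fun y => f y • φ y, f.contMDiff_smul hφs, by simp [hφ], ?_⟩
  have h1 : (fun y => f y • φ y) =ᶠ[𝓝 x] φ := by
    filter_upwards [f.eventuallyEq_one] with y hy
    rw [hy]; simp
  ext v
  have h2 := mD_comp_at (g := fun z : E => z - chartAt E x x) (f := chartAt E x) x
    (contDiff_id.sub contDiff_const).contMDiff.contMDiffAt
    (contMDiffAt_of_mem_maximalAtlas (chart_mem_maximalAtlas x) (mem_chart_source E x)) v
  have h3 : mD E E (chartAt E x) x = ContinuousLinearMap.id ℝ E := mD_extChartAt_self x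
  rw [mD_congr h1, hφ, h2, h3, mD_eq_fderiv, fderiv_sub_const]
  simp

variable {a : U → M → M}
  (ha : ContMDiff ((𝓘(ℝ, F)).prod 𝓘(ℝ, E)) 𝓘(ℝ, E) ∞ (uncurry a))

omit [FiniteDimensional ℝ E] [IsManifold 𝓘(ℝ, E) ∞ M] [Group U] [LieGroup 𝓘(ℝ, F) ∞ U] in
include ha in
theorem contMDiff_action (g : U) : ContMDiff 𝓘(ℝ, E) 𝓘(ℝ, E) ∞ (a g) :=
  ha.comp (contMDiff_const.prodMk contMDiff_id)

omit [FiniteDimensional ℝ E] in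
include ha in
-- Composing with a globally defined `h : M → E` puts the differentials at `x` of all the maps `a u`
-- in one vector space, so that they vary smoothly with `u` even when `a u x` leaves every chart at
-- `x`.
theorem contMDiff_mD_action {h : M → E} (hh : ContMDiff 𝓘(ℝ, E) 𝓘(ℝ, E) ∞ h) (x : M) :
    ContMDiff 𝓘(ℝ, F) 𝓘(ℝ, E →L[ℝ] E) ∞ (fun u => mD E E (fun y => h (a u y)) x) := by
  set e := chartAt E x with he
  have hem : e ∈ maximalAtlas 𝓘(ℝ, E) ∞ M := chart_mem_maximalAtlas x
  have hxe : x ∈ e.source := mem_chart_source E x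
  have h1 : ContMDiffOn ((𝓘(ℝ, E)).prod 𝓘(ℝ, F)) 𝓘(ℝ, E) ∞
      (uncurry fun (y : E) (u : U) => h (a u (e.symm y))) (e.target ×ˢ univ) := by
    have h2 : ContMDiffOn ((𝓘(ℝ, E)).prod 𝓘(ℝ, F)) ((𝓘(ℝ, F)).prod 𝓘(ℝ, E)) ∞
        (fun p : E × U => (p.2, e.symm p.1)) (e.target ×ˢ univ) :=
      contMDiffOn_snd.prodMk ((contMDiffOn_symm_of_mem_maximalAtlas hem).comp contMDiffOn_fst
        fun p hp => hp.1)
    exact (hh.comp ha).comp_contMDiffOn h2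
  have h2 := contMDiffOn_fderiv_param e.open_target h1
  have h3 : ContMDiff 𝓘(ℝ, F) ((𝓘(ℝ, E)).prod 𝓘(ℝ, F)) ∞ (fun u : U => (e x, u)) :=
    contMDiff_const.prodMk contMDiff_id
  have h4 := h2.comp_contMDiff h3 fun u => ⟨e.map_source hxe, mem_univ _⟩
  refine h4.congr fun u => ?_
  ext v
  simp only [comp_apply, uncurry]
  have h5 := mD_comp_at (g := fun y => h (a u y)) (f := e.symm) (e x)
    (hh.comp (contMDiff_action ha u)).contMDiffAt
    (contMDiffAt_symm_of_mem_maximalAtlas hem (e.map_source hxe)) v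
  have h6 : mD E E e x = ContinuousLinearMap.id ℝ E := mD_extChartAt_self x
  have h7 := mD_chart_symm_comp hem hxe v
  rw [h6] at h7
  rw [← mD_eq_fderiv, h5, e.left_inv hxe]
  exact congrArg _ h7.symm

variable (h1 : ∀ x, a 1 x = x) (hmul : ∀ g h x, a (g * h) x = a g (a h x))
  (K : Subgroup U) {x : M} (hx : ∀ k ∈ K, a k x = x)

omit [FiniteDimensional ℝ E] [IsManifold 𝓘(ℝ, E) ∞ M] [LieGroup 𝓘(ℝ, F) ∞ U] in
include ha hmul hx in
theorem mD_action_mul {g h : U} (hh : h ∈ K) (v : E) :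
    mD E E (a (g * h)) x v = mD E E (a g) x (mD E E (a h) x v) := by
  have h2 : a (g * h) = fun y => a g (a h y) := funext (hmul g h)
  rw [h2, mD_comp_smooth (contMDiff_action ha g) (contMDiff_action ha h), hx h hh]

omit [FiniteDimensional ℝ E] [IsManifold 𝓘(ℝ, E) ∞ M] [LieGroup 𝓘(ℝ, F) ∞ U]
  [TopologicalSpace U] [ChartedSpace F U] in
include h1 in
theorem mD_action_one (v : E) : mD E E (a 1) x v = v := by
  have h2 : a 1 = fun y => y := funext h1
  rw [h2, mD_id]; rfl

omit [FiniteDimensional ℝ E] in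
include ha hx in
theorem continuous_mD_action [T2Space M] [FiniteDimensional ℝ E] :
    Continuous (fun k : K => mD E E (a k) x) := by
  obtain ⟨h, hh, -, hd⟩ := exists_global_chart (E := E) x
  have h2 := (contMDiff_mD_action ha hh x).continuous.comp (continuous_subtype_val (p := (· ∈ K)))
  convert h2 using 1
  funext k
  ext v
  simp only [comp_apply]
  rw [mD_comp_smooth hh (contMDiff_action ha k), hx k k.2, hd]; rfl

/-- The vectors tangent at a fixed point which are fixed by the isotropy representation. -/
def fixedVectors (a : U → M → M) (K : Subgroup U) (x : M) : Submodule ℝ E where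
  carrier := {v | ∀ k ∈ K, mD E E (a k) x v = v}
  add_mem' hv hw k hk := by rw [map_add, hv k hk, hw k hk]
  zero_mem' k _ := map_zero _
  smul_mem' c v hv k hk := by rw [map_smul, hv k hk]

variable [CompactSpace K] [IsTopologicalGroup K] [T2Space M]

/-- The projection onto the fixed vectors obtained by averaging. -/
def fixedProj (a : U → M → M) (K : Subgroup U) [CompactSpace K] [IsTopologicalGroup K] (x : M) :
    E →L[ℝ] E := avg fun k : K => mD E E (a k) x

include ha hx in
theorem fixedProj_apply (v : E) :
    fixedProj a K x v = avg fun k : K => mD E E (a k) x v :=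
  (avg_clm (ContinuousLinearMap.apply ℝ E v) (continuous_mD_action ha K hx)).symm

include ha hx in
-- A continuous linear map commutes with averaging. This transfers invariant conditions from a
-- vector to its `K`-average: below `L` is the contraction of the `2`-form, then `Ad u + Id`, then
-- the differential of an orbit map.
theorem clm_fixedProj {W : Type*} [NormedAddCommGroup W] [NormedSpace ℝ W] [CompleteSpace W]
    (L : E →L[ℝ] W) {v : E} (hv : ∀ k ∈ K, L (mD E E (a k) x v) = L v) :
    L (fixedProj a K x v) = L v := by
  rw [fixedProj_apply ha K hx,
    ← avg_clm L ((continuous_mD_action ha K hx).clm_apply continuous_const)]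
  have : (fun t : K => L (mD E E (a t) x v)) = fun _ => L v := funext fun t => hv t t.2
  rw [this, avg_const]

include ha hmul hx in
theorem fixedProj_mem (v : E) : fixedProj a K x v ∈ fixedVectors a K x := by
  intro k hk
  rw [fixedProj_apply ha K hx,
    ← avg_clm (mD E E (a k) x) ((continuous_mD_action ha K hx).clm_apply continuous_const)]
  have := avg_mul_left (fun t : K => mD E E (a t) x v) ⟨k, hk⟩
  rw [← this]
  congr 1
  funext t
  exact (mD_action_mul ha hmul K hx t.2 v).symm

include ha h1 hmul hx in
/-- Near a fixed point, the action of a compact group is isomorphic to a linear one. -/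
theorem exists_linearization [CompactSpace U] : ∃ ψ : M → E, ContMDiff 𝓘(ℝ, E) 𝓘(ℝ, E) ∞ ψ ∧ ψ x = 0 ∧
    mD E E ψ x = ContinuousLinearMap.id ℝ E ∧
    ∀ k ∈ K, ∀ y, ψ (a k y) = mD E E (a k) x (ψ y) := by
  obtain ⟨h, hh, hx0, hd⟩ := exists_global_chart (E := E) x
  set A : U → E →L[ℝ] E := fun u => mD E E (fun y => h (a u y)) x with hA
  have hAs : ContMDiff 𝓘(ℝ, F) 𝓘(ℝ, E →L[ℝ] E) ∞ A := contMDiff_mD_action ha hh x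
  have hAK : ∀ k ∈ K, A k = mD E E (a k) x := by
    intro k hk
    ext v
    rw [hA]; dsimp only
    rw [mD_comp_smooth hh (contMDiff_action ha k), hx k hk, hd]; rfl
  -- For `k` in `K` the integrand is `dk ∘ h ∘ k⁻¹`. Its average over `K` is equivariant, and has
  -- differential the identity at `x` since `dk` and `dk⁻¹` cancel. Replacing `dk` by `A u` extends
  -- the integrand smoothly to all of `U`.
  set Φ : M → U → E := fun y u => A u (h (a u⁻¹ y)) with hΦ
  have hΦs : ContMDiff ((𝓘(ℝ, E)).prod 𝓘(ℝ, F)) 𝓘(ℝ, E) ∞ (uncurry Φ) := by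
    have h2 : ContMDiff ((𝓘(ℝ, E)).prod 𝓘(ℝ, F)) 𝓘(ℝ, E) ∞
        (fun p : M × U => h (a p.2⁻¹ p.1)) :=
      hh.comp (ha.comp (((contMDiff_inv 𝓘(ℝ, F) ∞).comp contMDiff_snd).prodMk contMDiff_fst))
    exact (hAs.comp contMDiff_snd).clm_apply h2
  have hcont : ∀ y, Continuous fun k : K => Φ y k := fun y =>
    hΦs.continuous.comp (continuous_const.prodMk continuous_subtype_val)
  refine ⟨fun y => avg fun k : K => Φ y k, contMDiff_avg continuous_subtype_val hΦs, ?_, ?_, ?_⟩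
  · have h2 : (fun k : K => Φ x k) = fun _ => 0 := by
      funext k
      rw [hΦ]; dsimp only
      rw [hx _ (K.inv_mem k.2), hx0, map_zero]
    dsimp only
    rw [h2, avg_const]
  · ext v
    rw [(contMDiffAt_mD_avg continuous_subtype_val hΦs x).2 v]
    have h2 : (fun k : K => mD E E (fun y => Φ y k) x v) = fun _ => v := by
      funext k
      have h3 := mD_comp_smooth (g := A k) (f := fun y => h (a (k : U)⁻¹ y))
        (A k).contMDiff (hh.comp (contMDiff_action ha _)) x v
      have h4 := mD_comp_smooth (g := h) (f := a (k : U)⁻¹) hh (contMDiff_action ha _) x v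
      rw [hΦ]; dsimp only
      rw [h3, h4, hx _ (K.inv_mem k.2), hd, mD_eq_fderiv, ContinuousLinearMap.fderiv, hAK k k.2]
      change mD E E (a k) x (mD E E (a (k : U)⁻¹) x v) = v
      rw [← mD_action_mul ha hmul K hx (K.inv_mem k.2), mul_inv_cancel, mD_action_one h1]
    rw [h2, avg_const]; rfl
  · intro k hk y
    dsimp only
    rw [← avg_clm (mD E E (a k) x) (hcont y), ← avg_mul_left (fun t : K => Φ (a k y) t) ⟨k, hk⟩]
    congr 1
    funext t
    rw [hΦ]; dsimp only
    rw [Subgroup.coe_mul, hAK _ (K.mul_mem hk t.2), mD_action_mul ha hmul K hx t.2, hAK _ t.2,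
      mul_inv_rev, ← hmul, mul_assoc, inv_mul_cancel, mul_one]

end Linearization

end QHam

namespace QHam
open Set Filter Topology Function IsManifold

/-! ### Semicontinuity of stabilizers. -/

section Stabilizer

variable {F : Type*} [NormedAddCommGroup F] [NormedSpace ℝ F] [FiniteDimensional ℝ F]
  {U : Type*} [TopologicalSpace U] [ChartedSpace F U]

theorem exists_local_section_of_surjective [IsManifold 𝓘(ℝ, F) ∞ U] {r : ℕ}
    {q : U → EuclideanSpace ℝ (Fin r)} (hq : ContMDiff 𝓘(ℝ, F) (𝓡 r) ∞ q) {x : U}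
    (hsurj : Surjective (mD F (EuclideanSpace ℝ (Fin r)) q x)) :
    ∃ s : EuclideanSpace ℝ (Fin r) → U, s (q x) = x ∧ ContMDiffAt (𝓡 r) 𝓘(ℝ, F) ∞ s (q x) ∧
      ∀ᶠ t in 𝓝 (q x), q (s t) = t := by
  have hr : r ≤ Module.finrank ℝ F := by
    simpa using LinearMap.finrank_le_finrank_of_surjective
      (f := (mD F (EuclideanSpace ℝ (Fin r)) q x : F →ₗ[ℝ] EuclideanSpace ℝ (Fin r))) hsurj
  obtain ⟨e, he, Λ, hxe, -, hΛ⟩ := exists_straightening_chart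
    (C := EuclideanSpace ℝ (Fin (Module.finrank ℝ F - r)))
    (by rw [finrank_euclideanSpace_fin, finrank_euclideanSpace_fin]; omega)
    isOpen_univ (mem_univ x) hq.contMDiffOn hsurj
  set γ : EuclideanSpace ℝ (Fin r) → F := fun t => Λ.symm (t, (Λ (e x)).2) with hγ
  have hγs : ContDiff ℝ ∞ γ := Λ.symm.contDiff.comp (contDiff_id.prodMk contDiff_const)
  have hγx : γ (q x) = e x := by
    rw [hγ]; dsimp only
    rw [← hΛ x hxe]; simp
  refine ⟨fun t => e.symm (γ t), by dsimp only; rw [hγx, e.left_inv hxe], ?_, ?_⟩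
  · refine ContMDiffAt.comp (g := e.symm) (f := γ) (q x) ?_ hγs.contMDiff.contMDiffAt
    rw [hγx]
    exact contMDiffAt_symm_of_mem_maximalAtlas he (e.map_source hxe)
  · have h3 : ∀ᶠ t in 𝓝 (q x), γ t ∈ e.target :=
      hγs.continuous.continuousAt.eventually_mem
        (e.open_target.mem_nhds (by rw [hγx]; exact e.map_source hxe))
    filter_upwards [h3] with t ht
    rw [← hΛ _ (e.map_target ht), e.right_inv ht, hγ]
    simp

variable [Group U] [LieGroup 𝓘(ℝ, F) ∞ U] [CompactSpace U]
  {E : Type*} [NormedAddCommGroup E] [NormedSpace ℝ E] [FiniteDimensional ℝ E]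
  {M : Type*} [TopologicalSpace M] [ChartedSpace E M] [IsManifold 𝓘(ℝ, E) ∞ M] [T2Space M]

omit [FiniteDimensional ℝ E] [T2Space M] in
/-- A smooth family of maps which contains the identity is locally uniformly injective. -/
theorem eventually_injective_of_family {T : Type*} [NormedAddCommGroup T] [NormedSpace ℝ T]
    {R : T × M → T} {t₀ : T} {x : M} (hR : ContMDiffAt ((𝓘(ℝ, T)).prod 𝓘(ℝ, E)) 𝓘(ℝ, T) ∞ R (t₀, x))
    (hid : ∀ᶠ t in 𝓝 t₀, R (t, x) = t) :
    ∃ O ∈ 𝓝 t₀, ∃ W ∈ 𝓝 x, ∀ t ∈ O, ∀ t' ∈ O, ∀ y ∈ W, R (t, y) = R (t', y) → t = t' := by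
  set e := chartAt E x
  have he : e ∈ maximalAtlas 𝓘(ℝ, E) ∞ M := chart_mem_maximalAtlas x
  have hxe : x ∈ e.source := mem_chart_source E x
  set S : T × E → T := fun p => R (p.1, e.symm p.2) with hS
  have hSs : ContDiffAt ℝ ∞ S (t₀, e x) := by
    have h1 : ContMDiffAt ((𝓘(ℝ, T)).prod 𝓘(ℝ, E)) ((𝓘(ℝ, T)).prod 𝓘(ℝ, E)) ∞
        (fun p : T × E => (p.1, e.symm p.2)) (t₀, e x) :=
      contMDiffAt_fst.prodMk (ContMDiffAt.comp (g := e.symm) (f := Prod.snd) (t₀, e x)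
        (contMDiffAt_symm_of_mem_maximalAtlas he (e.map_source hxe)) contMDiffAt_snd)
    have h2 : ContMDiffAt ((𝓘(ℝ, T)).prod 𝓘(ℝ, E)) 𝓘(ℝ, T) ∞ S (t₀, e x) := by
      refine ContMDiffAt.comp (g := R) (f := fun p : T × E => (p.1, e.symm p.2)) (t₀, e x) ?_ h1
      dsimp only
      rw [e.left_inv hxe]
      exact hR
    rw [← modelWithCornersSelf_prod, chartedSpaceSelf_prod] at h2
    exact contMDiffAt_iff_contDiffAt.1 h2
  have hst := hSs.hasStrictFDerivAt (by simp)
  set D := fderiv ℝ S (t₀, e x)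
  have hD : ∀ τ : T, D (τ, 0) = τ := by
    intro τ
    have h1 : HasFDerivAt (fun t : T => S (t, e x)) (D.comp (ContinuousLinearMap.inl ℝ T E)) t₀ :=
      HasFDerivAt.comp (g := S) t₀ hst.hasFDerivAt (hasFDerivAt_prodMk_left t₀ (e x))
    have h2 : HasFDerivAt (fun t : T => S (t, e x)) (ContinuousLinearMap.id ℝ T) t₀ := by
      refine (hasFDerivAt_id t₀).congr_of_eventuallyEq ?_
      filter_upwards [hid] with t ht
      rw [hS]; dsimp only
      rw [e.left_inv hxe, ht]; rfl
    have h3 := h1.unique h2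
    exact congrArg (fun A : T →L[ℝ] T => A τ) h3
  -- Since `D (τ, 0) = τ`, strict differentiability with constant `1/2` turns `R (t, y) = R (t', y)`
  -- into `‖t - t'‖ ≤ ‖t - t'‖ / 2`.
  have h4 := hst.isLittleO.def (show (0 : ℝ) < 1 / 2 by norm_num)
  rw [nhds_prod_eq (X := T × E), eventually_iff, mem_prod_self_iff, nhds_prod_eq] at h4
  obtain ⟨t, ht, h5⟩ := h4
  obtain ⟨O, hO, W, hW, hOW⟩ := mem_prod_iff.1 ht
  refine ⟨O, hO, e.source ∩ e ⁻¹' W, inter_mem (e.open_source.mem_nhds hxe)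
    ((contMDiffAt_of_mem_maximalAtlas he hxe).continuousAt hW), ?_⟩
  intro t ht t' ht' y hy h
  have h6 : ‖S (t, e y) - S (t', e y) - D ((t, e y) - (t', e y))‖ ≤
      1 / 2 * ‖(t, e y) - (t', e y)‖ :=
    h5 (mk_mem_prod (hOW (mk_mem_prod ht hy.2)) (hOW (mk_mem_prod ht' hy.2)))
  have h7 : S (t, e y) - S (t', e y) = 0 := by
    rw [hS]; dsimp only
    rw [e.left_inv hy.1, h, sub_self]
  rw [h7, Prod.mk_sub_mk, sub_self, hD, zero_sub, norm_neg, Prod.norm_mk, norm_zero,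
    max_eq_left (norm_nonneg _)] at h6
  have h8 : ‖t - t'‖ = 0 := by linarith [norm_nonneg (t - t')]
  exact sub_eq_zero.1 (norm_eq_zero.1 h8)

variable {a : U → M → M}
  (ha : ContMDiff ((𝓘(ℝ, F)).prod 𝓘(ℝ, E)) 𝓘(ℝ, E) ∞ (uncurry a))
  (h1 : ∀ x, a 1 x = x) (hmul : ∀ g h x, a (g * h) x = a g (a h x))

include ha h1 hmul in
/-- Near a point with stabilizer `K`, all the fixed points of `K` have stabilizer `K`. -/
theorem eventually_stabilizer (K : Subgroup U) {x : M} (hx : ∀ g, a g x = x ↔ g ∈ K) :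
    ∀ᶠ y in 𝓝 x, (∀ k ∈ K, a k y = y) → ∀ g, a g y = y → g ∈ K := by
  have : IsTopologicalGroup U := topologicalGroup_of_lieGroup 𝓘(ℝ, F) ∞
  obtain ⟨h, hh, hx0, hd⟩ := exists_global_chart (E := E) x
  obtain ⟨e, -, hxe, -, heh⟩ := exists_chart_of_bijective isOpen_univ (mem_univ x)
    hh.contMDiffOn (by rw [hd]; exact bijective_id)
  have hac : Continuous fun p : U × M => a p.1 p.2 := ha.continuous
  have horb : ContMDiff 𝓘(ℝ, F) 𝓘(ℝ, E) ∞ (fun g => a g x) :=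
    ha.comp (contMDiff_id.prodMk contMDiff_const)
  -- The family consists of all coordinates `l` of `h` along the left translates of the orbit map.
  -- It is left-invariant, and close to `1` its common level sets are the cosets of `K`, as `hsep`
  -- shows.
  obtain ⟨r, idx, V, hV, h1V, hsurj, hinj⟩ := exists_submersion_of_family
    (fun (j : U × (E →L[ℝ] ℝ)) (g : U) => j.2 (h (a (j.1 * g) x)))
    (fun j => j.2.contMDiff.comp (hh.comp (horb.comp contMDiff_mul_left)))
    (fun j g => ⟨(j.1 * g, j.2), fun y => by rw [mul_assoc]⟩)
  set q := toEuclid fun i g => (idx i).2 (h (a ((idx i).1 * g) x)) with hq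
  set Q : M → EuclideanSpace ℝ (Fin r) := toEuclid fun i y => (idx i).2 (h (a (idx i).1 y)) with hQ
  have hqQ : ∀ g, q g = Q (a g x) := by
    intro g
    rw [hq, hQ]
    unfold toEuclid
    simp only [hmul]
  have hqs : ContMDiff 𝓘(ℝ, F) (𝓡 r) ∞ q := contMDiff_toEuclid fun i =>
    (idx i).2.contMDiff.comp (hh.comp (horb.comp contMDiff_mul_left))
  have hQs : ContMDiff 𝓘(ℝ, E) (𝓡 r) ∞ Q := contMDiff_toEuclid fun i =>
    (idx i).2.contMDiff.comp (hh.comp (contMDiff_action ha _))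
  obtain ⟨s, hs1, hs, hqs'⟩ := exists_local_section_of_surjective hqs hsurj
  -- A local section `s` of `q` is a slice transverse to the cosets of `K`. Moving `y` along it and
  -- reading `Q` gives the identity in `t` at `y = x`, so for `y` close to `x` the slice parameter
  -- is still recovered.
  have hR : ContMDiffAt ((𝓡 r).prod 𝓘(ℝ, E)) (𝓡 r) ∞
      (fun p : EuclideanSpace ℝ (Fin r) × M => Q (a (s p.1) p.2)) (q 1, x) := by
    have h2 : ContMDiffAt ((𝓡 r).prod 𝓘(ℝ, E)) ((𝓘(ℝ, F)).prod 𝓘(ℝ, E)) ∞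
        (fun p : EuclideanSpace ℝ (Fin r) × M => (s p.1, p.2)) (q 1, x) :=
      (ContMDiffAt.comp (g := s) (f := Prod.fst) (q 1, x) hs contMDiffAt_fst).prodMk contMDiffAt_snd
    exact (hQs.comp ha).contMDiffAt.comp _ h2
  obtain ⟨O, hO, W, hW, hOW⟩ := eventually_injective_of_family hR (by
    filter_upwards [hqs'] with t ht
    rw [← hqQ, ht])
  have hsep : ∀ g ∈ V, ∀ g' ∈ V, a (g⁻¹ * g') x ∈ e.source → q g = q g' → g⁻¹ * g' ∈ K := by
    intro g hg g' hg' hgg h2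
    rw [← hx]
    apply e.injOn hgg hxe
    rw [heh _ hgg, heh _ hxe]
    have h3 := hinj g hg g' hg' h2
    refine (SeparatingDual.eq_iff_forall_dual_eq (R := ℝ)).2 ?_
    intro l
    have h4 := h3 (g⁻¹, l)
    dsimp only at h4
    rw [inv_mul_cancel, h1] at h4
    exact h4.symm
  have hcq : ContinuousAt q 1 := hqs.continuous.continuousAt
  have hscont : ContinuousAt (fun g => s (q g)) 1 :=
    ContinuousAt.comp (g := s) (f := q) hs.continuousAt hcq
  have hV' : ∀ᶠ g in 𝓝 (1 : U), g ∈ V ∧ q g ∈ O ∧ s (q g) ∈ V ∧ q (s (q g)) = q g ∧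
      a ((s (q g))⁻¹ * g) x ∈ e.source ∧ a ((1 : U)⁻¹ * g) x ∈ e.source := by
    refine Filter.Eventually.and (hV.mem_nhds h1V) (Filter.Eventually.and (hcq hO) ((hscont.eventually_mem ?_).and
      ((hcq.eventually hqs').and (Filter.Eventually.and ?_ ?_))))
    · rw [hs1]; exact hV.mem_nhds h1V
    · have h2 : ContinuousAt (fun g => a ((s (q g))⁻¹ * g) x) 1 := by
        refine ContinuousAt.comp (g := fun g => a g x) horb.continuous.continuousAt ?_
        exact hscont.inv.mul continuousAt_id
      refine h2.eventually_mem (e.open_source.mem_nhds ?_)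
      rw [hs1, inv_mul_cancel, h1]; exact hxe
    · have h2 : ContinuousAt (fun g => a ((1 : U)⁻¹ * g) x) 1 :=
        (horb.continuous.comp (continuous_const_mul _)).continuousAt
      refine h2.eventually_mem (e.open_source.mem_nhds ?_)
      rw [inv_mul_cancel, h1]; exact hxe
  obtain ⟨V', hV's, hV'o, h1V'⟩ := mem_nhds_iff.1 hV'
  -- Write `g = s (q g) * k` with `k` in `K`. As `k` fixes `y`, also `s (q g)` fixes `y`, just as `s
  -- (q 1) = 1` does. Injectivity in the slice parameter gives `q g = q 1`, whence `g` is in `K`.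
  have hnear : ∀ g ∈ V', ∀ y ∈ W, (∀ k ∈ K, a k y = y) → a g y = y → g ∈ K := by
    intro g hg y hy hyK hgy
    obtain ⟨hg1, hg2, hg3, hg4, hg5, hg6⟩ := hV's hg
    have hk := hsep _ hg3 g hg1 hg5 hg4
    have h2 : a (s (q g)) y = y := by
      conv_lhs => rw [← hyK _ hk]
      rw [← hmul, mul_inv_cancel_left, hgy]
    have h3 : q g = q 1 := hOW _ hg2 _ (mem_of_mem_nhds hO) y hy (by
      dsimp only
      rw [hs1, h1, h2])
    have h4 := hsep 1 h1V g hg1 hg6 h3.symm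
    simpa using h4
  -- The complement of `V' K` is compact and its elements all move `x`; hence they all move every
  -- point close to `x`.
  set Z : Set U := (⋃ k ∈ K, (fun g => g * k⁻¹) ⁻¹' V')ᶜ with hZ
  have hZc : IsCompact Z := by
    apply IsClosed.isCompact
    rw [hZ, isClosed_compl_iff]
    exact isOpen_biUnion fun k _ => hV'o.preimage (continuous_mul_const _)
  have hfar : ∀ᶠ y in 𝓝 x, ∀ g ∈ Z, a g y ≠ y := by
    refine hZc.eventually_forall_of_forall_eventually fun g hg => ?_
    have h2 : a g x ≠ x := by
      intro h3
      have h4 := (hx g).1 h3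
      apply hg
      simp only [mem_iUnion]
      exact ⟨g, h4, by simpa using h1V'⟩
    have h3 : IsOpen {p : M × U | a p.2 p.1 ≠ p.1} :=
      isOpen_ne_fun (hac.comp (continuous_snd.prodMk continuous_fst)) continuous_fst
    exact h3.mem_nhds h2
  filter_upwards [hW, hfar] with y hyW hyZ hyK g hgy
  by_cases hg : g ∈ Z
  · exact absurd hgy (hyZ g hg)
  · rw [hZ, notMem_compl_iff] at hg
    simp only [mem_iUnion] at hg
    obtain ⟨k, hk, hgk⟩ := hg
    have h2 := hnear _ hgk y hyW hyK (by rw [hmul, hyK _ (K.inv_mem hk), hgy])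
    simpa using K.mul_mem h2 hk

end Stabilizer

end QHam

namespace QHam
open Set Filter Topology Function IsManifold

/-! ### Local retractions of immersions. -/

section Immersion

variable {E : Type*} [NormedAddCommGroup E] [NormedSpace ℝ E]
  {M : Type*} [TopologicalSpace M] [ChartedSpace E M]
  {E' : Type*} [NormedAddCommGroup E'] [NormedSpace ℝ E']
  {M' : Type*} [TopologicalSpace M'] [ChartedSpace E' M']

/-- An immersion has smooth local retractions. -/
theorem exists_local_retraction {f : M → M'}
    (hf : Manifold.IsImmersion 𝓘(ℝ, E) 𝓘(ℝ, E') ∞ f) (x : M) :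
    ∃ s : M' → M, ContMDiffAt 𝓘(ℝ, E') 𝓘(ℝ, E) ∞ s (f x) ∧ ∀ᶠ y in 𝓝 x, s (f y) = y := by
  have h := hf.isImmersionAt x
  set e := h.domChart
  set e' := h.codChart
  set Λ := h.equiv
  have hxe : x ∈ e.source := h.mem_domChart_source
  have hxe' : f x ∈ e'.source := h.mem_codChart_source
  have hw : ∀ y ∈ e.source, e' (f y) = Λ (e y, 0) := by
    intro y hy
    have h0 : e y ∈ (e.extend 𝓘(ℝ, E)).target := by simpa using e.map_source hy
    have h1 := h.writtenInCharts h0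
    have h2 : (e.extend 𝓘(ℝ, E)).symm (e y) = y := by simpa using e.left_inv hy
    simp only [comp_apply] at h1
    rw [h2] at h1
    exact h1
  have hl : ∀ y ∈ e.source, (Λ.symm (e' (f y))).1 = e y := by
    intro y hy
    rw [hw y hy]; simp
  refine ⟨fun z => e.symm (Λ.symm (e' z)).1, ?_, ?_⟩
  · have h1 : ContMDiffAt 𝓘(ℝ, E') 𝓘(ℝ, E) ∞ (fun z => (Λ.symm (e' z)).1) (f x) :=
      ContMDiffAt.comp (g := fun z => (Λ.symm z).1) (f := e') (f x)
        (contDiff_fst.comp Λ.symm.contDiff).contMDiff.contMDiffAt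
        (contMDiffAt_of_mem_maximalAtlas h.codChart_mem_maximalAtlas hxe')
    refine ContMDiffAt.comp (g := e.symm) (f := fun z => (Λ.symm (e' z)).1) (f x) ?_ h1
    rw [hl x hxe]
    exact contMDiffAt_symm_of_mem_maximalAtlas h.domChart_mem_maximalAtlas (e.map_source hxe)
  · filter_upwards [e.open_source.mem_nhds hxe] with y hy
    rw [hl y hy, e.left_inv hy]

theorem mD_injective_of_isImmersion {f : M → M'} [IsManifold 𝓘(ℝ, E) ∞ M] [IsManifold 𝓘(ℝ, E') ∞ M']
    (hf : Manifold.IsImmersion 𝓘(ℝ, E) 𝓘(ℝ, E') ∞ f) (x : M) : Injective (mD E E' f x) := by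
  obtain ⟨s, hs, hsf⟩ := exists_local_retraction hf x
  refine LeftInverse.injective (g := mD E' E s (f x)) fun v => ?_
  rw [← mD_comp_at (g := s) (f := f) x hs hf.contMDiff.contMDiffAt, mD_congr (g := fun y => y) hsf,
    mD_id]; rfl

theorem contMDiff_of_comp_embedding [IsManifold 𝓘(ℝ, E) ∞ M] [IsManifold 𝓘(ℝ, E') ∞ M'] {f : M → M'}
    (hf : Manifold.IsSmoothEmbedding 𝓘(ℝ, E) 𝓘(ℝ, E') ∞ f)
    {E₁ : Type*} [NormedAddCommGroup E₁] [NormedSpace ℝ E₁] {H₁ : Type*} [TopologicalSpace H₁]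
    {I : ModelWithCorners ℝ E₁ H₁} {M₁ : Type*} [TopologicalSpace M₁] [ChartedSpace H₁ M₁]
    {g : M₁ → M} (hg : ContMDiff I 𝓘(ℝ, E') ∞ (fun y => f (g y))) : ContMDiff I 𝓘(ℝ, E) ∞ g := by
  have hgc : Continuous g := hf.isEmbedding.continuous_iff.2 hg.continuous
  exact fun y => (ContMDiffAt.iff_comp_isImmersionAt (hf.isImmersion.isImmersionAt _)).2
      ⟨hgc.continuousAt, hg y⟩

end Immersion

/-! ### Local structure of `M_K` and its decomposition by dimension. -/

section Strata

variable {F : Type*} [NormedAddCommGroup F] [NormedSpace ℝ F] [FiniteDimensional ℝ F]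
  {U : Type*} [TopologicalSpace U] [ChartedSpace F U] [Group U] [hLie : LieGroup 𝓘(ℝ, F) ∞ U]
  [CompactSpace U]
  {E : Type*} [NormedAddCommGroup E] [NormedSpace ℝ E] [FiniteDimensional ℝ E]
  {M : Type*} [TopologicalSpace M] [ChartedSpace E M] [IsManifold 𝓘(ℝ, E) ∞ M] [T2Space M]
  [MulAction U M] [hsm : ContMDiffSMul 𝓘(ℝ, F) 𝓘(ℝ, E) ∞ U M]
  {K : Subgroup U} (hK : IsClosed (K : Set U))

/-- The vectors tangent to `M` at `x` fixed by the isotropy representation of `K`. -/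
abbrev fixedTangent (E : Type*) [NormedAddCommGroup E] [NormedSpace ℝ E] [ChartedSpace E M]
    (K : Subgroup U) (x : M) : Submodule ℝ E :=
  fixedVectors (E := E) (fun (g : U) (y : M) => g • y) K x

omit [TopologicalSpace U] [CompactSpace U] [TopologicalSpace M] [T2Space M] in
theorem smul_eq_of_mem_isotropy {x : M} (hx : x ∈ Isotropy M K) (g : U) : g • x = x ↔ g ∈ K := by
  have hx' : MulAction.stabilizer U x = K := hx
  rw [← hx', MulAction.mem_stabilizer_iff]

omit [TopologicalSpace U] [CompactSpace U] [TopologicalSpace M] [T2Space M] in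
theorem mem_isotropy_iff {x : M} : x ∈ Isotropy M K ↔ ∀ g : U, g • x = x ↔ g ∈ K := by
  refine ⟨smul_eq_of_mem_isotropy, fun h => ?_⟩
  ext g
  rw [MulAction.mem_stabilizer_iff, h]

omit [FiniteDimensional ℝ F] hLie [CompactSpace U] [FiniteDimensional ℝ E]
  [IsManifold 𝓘(ℝ, E) ∞ M] [T2Space M] in
variable (F U E M) in
theorem contMDiff_smul_uncurry :
    ContMDiff ((𝓘(ℝ, F)).prod 𝓘(ℝ, E)) 𝓘(ℝ, E) ∞ (uncurry fun (g : U) (y : M) => g • y) :=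
  contMDiff_smul (I := 𝓘(ℝ, F)) (I' := 𝓘(ℝ, E)) (n := ∞) (G := U) (M := M)

variable (F E) in
include hK hLie hsm in
-- In the linearizing chart the points fixed by `K` are those in the fixed subspace, and
-- `eventually_stabilizer` upgrades "fixed by `K`" to "stabilizer `K`". At a nearby point `y` of
-- `M_K` the differential of `ψ` intertwines the isotropy representations at `y` and at `x`, which
-- makes the dimension locally constant.
theorem isotropy_local_structure {x : M} (hx : x ∈ Isotropy M K) :
    ∃ (s : Set M) (ψ : M → E), IsOpen s ∧ x ∈ s ∧ ContMDiff 𝓘(ℝ, E) 𝓘(ℝ, E) ∞ ψ ∧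
      mD E E ψ x = ContinuousLinearMap.id ℝ E ∧
      (∀ y ∈ s, y ∈ Isotropy M K ↔ ψ y ∈ fixedTangent E K x) ∧
      ∀ y ∈ s, y ∈ Isotropy M K → Module.finrank ℝ (fixedTangent E K y) =
        Module.finrank ℝ (fixedTangent E K x) := by
  have : IsTopologicalGroup U := topologicalGroup_of_lieGroup 𝓘(ℝ, F) ∞
  have : CompactSpace K := isCompact_iff_compactSpace.1 hK.isCompact
  have ha := contMDiff_smul_uncurry F U E M
  have hx' := smul_eq_of_mem_isotropy hx
  obtain ⟨ψ, hψ, hψx, hψd, hψK⟩ := exists_linearization ha (fun y => one_smul U y)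
    (fun g h y => mul_smul g h y) K (fun k hk => (hx' k).2 hk)
  obtain ⟨e, he, hxe, -, heψ⟩ := exists_chart_of_bijective isOpen_univ (mem_univ x)
    hψ.contMDiffOn (by rw [hψd]; exact bijective_id)
  -- The whole `K`-orbit of `y` must stay where `ψ` is injective, in order to deduce `k • y = y`
  -- from `ψ (k • y) = ψ y`.
  have h1 : ∀ᶠ y in 𝓝 x, ∀ k ∈ (K : Set U), k • y ∈ e.source := by
    refine hK.isCompact.eventually_forall_of_forall_eventually fun k hk => ?_
    have h2 : IsOpen {p : M × U | p.2 • p.1 ∈ e.source} :=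
      e.open_source.preimage (ha.continuous.comp (continuous_snd.prodMk continuous_fst))
    refine h2.mem_nhds ?_
    change k • x ∈ e.source
    rw [(hx' k).2 hk]; exact hxe
  have h2 := eventually_stabilizer ha (fun y => one_smul U y) (fun g h y => mul_smul g h y) K hx'
  obtain ⟨s, hs, hso, hxs⟩ := mem_nhds_iff.1 (h1.and h2)
  refine ⟨s, ψ, hso, hxs, hψ, hψd, ?_, ?_⟩
  · intro y hy
    obtain ⟨hy1, hy2⟩ := hs hy
    constructor
    · intro hyK k hk
      rw [← hψK k hk, (smul_eq_of_mem_isotropy hyK k).2 hk]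
    · intro hyK
      have h3 : ∀ k ∈ K, k • y = y := by
        intro k hk
        have hye : y ∈ e.source := by simpa using hy1 1 K.one_mem
        apply e.injOn (hy1 k hk) hye
        rw [heψ _ (hy1 k hk), heψ _ hye, hψK k hk]
        exact hyK k hk
      exact mem_isotropy_iff.2 fun g => ⟨hy2 h3 g, h3 g⟩
  · intro y hy hyK
    have hye : y ∈ e.source := by simpa using (hs hy).1 1 K.one_mem
    have hyK' := smul_eq_of_mem_isotropy hyK
    have hb : Bijective (mD E E ψ y) := by
      have h3 := mD_chart_bijective he hye
      rwa [mD_congr (show e =ᶠ[𝓝 y] ψ from by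
        filter_upwards [e.open_source.mem_nhds hye] with z hz using heψ z hz)] at h3
    have hint : ∀ k ∈ K, ∀ v, mD E E ψ y (mD E E (fun z : M => k • z) y v) =
        mD E E (fun z : M => k • z) x (mD E E ψ y v) := by
      intro k hk v
      have h3 := mD_comp_smooth hψ (contMDiff_action ha k) y v
      rw [(hyK' k).2 hk] at h3
      rw [← h3, funext (hψK k hk),
        mD_comp_smooth (mD E E (fun z : M => k • z) x).contMDiff hψ, mD_eq_fderiv,
        ContinuousLinearMap.fderiv]
    set Ψ : E ≃ₗ[ℝ] E := LinearEquiv.ofBijective (mD E E ψ y : E →ₗ[ℝ] E) hb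
    have h4 : (fixedTangent E K y).map (Ψ : E →ₗ[ℝ] E) = fixedTangent E K x := by
      ext w
      rw [Submodule.mem_map]
      constructor
      · rintro ⟨v, hv, rfl⟩ k hk
        have h5 := hint k hk v
        rw [hv k hk] at h5
        exact h5.symm
      · intro hw
        obtain ⟨v, rfl⟩ := hb.2 w
        refine ⟨v, fun k hk => hb.1 ?_, rfl⟩
        rw [hint k hk, hw k hk]
    rw [← h4, LinearEquiv.finrank_map_eq]

omit [FiniteDimensional ℝ F] hLie [CompactSpace U] [FiniteDimensional ℝ E]
  [IsManifold 𝓘(ℝ, E) ∞ M] [T2Space M] in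
variable (F) in
include hsm in
-- As `n` normalizes `K`, its differential exchanges the vectors fixed by `K` at `x` and at `n • x`.
-- This is why the strata are stable under `L_K`.
theorem finrank_fixedTangent_smul {n : U} (hn : n ∈ Nor K) {x : M} (hx : x ∈ Isotropy M K) :
    Module.finrank ℝ (fixedTangent E K (n • x)) = Module.finrank ℝ (fixedTangent E K x) := by
  have ha := contMDiff_smul_uncurry F U E M
  have hb : Bijective (mD E E (fun y : M => n • y) x) :=
    mD_bijective_of_inverse (g := fun y : M => n⁻¹ • y) (contMDiff_action ha n)
      (contMDiff_action ha n⁻¹) (fun y => inv_smul_smul n y) (fun y => smul_inv_smul n y) x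
  have hint : ∀ k : U, n⁻¹ * k * n ∈ K → ∀ v, mD E E (fun z : M => k • z) (n • x)
      (mD E E (fun z : M => n • z) x v) =
        mD E E (fun z : M => n • z) x (mD E E (fun z : M => (n⁻¹ * k * n) • z) x v) := by
    intro k hk v
    have h3 := mD_comp_smooth (contMDiff_action ha k) (contMDiff_action ha n) x v
    have h4 := mD_comp_smooth (contMDiff_action ha n) (contMDiff_action ha (n⁻¹ * k * n)) x v
    rw [(smul_eq_of_mem_isotropy hx _).2 hk] at h4
    rw [← h3, ← h4]
    congr 2
    funext z
    rw [smul_smul, smul_smul]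
    congr 1
    group
  have hconj : ∀ k, k ∈ K ↔ n⁻¹ * k * n ∈ K := by
    intro k
    have h := Subgroup.mem_normalizer_iff.1 hn (n⁻¹ * k * n)
    rw [show n * (n⁻¹ * k * n) * n⁻¹ = k by group] at h
    exact h.symm
  set Ψ : E ≃ₗ[ℝ] E := LinearEquiv.ofBijective (mD E E (fun y : M => n • y) x : E →ₗ[ℝ] E) hb
  have h4 : (fixedTangent E K x).map (Ψ : E →ₗ[ℝ] E) = fixedTangent E K (n • x) := by
    ext w
    rw [Submodule.mem_map]
    constructor
    · rintro ⟨v, hv, rfl⟩ k hk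
      have h5 := hint k ((hconj k).1 hk) v
      rw [hv _ ((hconj k).1 hk)] at h5
      exact h5
    · intro hw
      obtain ⟨v, rfl⟩ := hb.2 w
      refine ⟨v, fun k hk => hb.1 ?_, rfl⟩
      have hk' : n⁻¹ * (n * k * n⁻¹) * n = k := by group
      have h5 := hint (n * k * n⁻¹) (by rw [hk']; exact hk) v
      rw [hk', hw _ ((hconj _).2 (by rw [hk']; exact hk))] at h5
      exact h5.symm
  rw [← h4, LinearEquiv.finrank_map_eq]

variable (F E M K) in
/-- The points of `M_K` at which the fixed tangent space has dimension `d`. -/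
def stratum (d : ℕ) : SubMulAction (LK K) (Isotropy M K) where
  carrier := {x | Module.finrank ℝ (fixedTangent E K (x : M)) = d}
  smul_mem' := by
    intro l x hx
    obtain ⟨n, rfl⟩ := QuotientGroup.mk'_surjective _ l
    change Module.finrank ℝ (fixedTangent E K ((n : U) • (x : M))) = d
    rw [finrank_fixedTangent_smul F n.2 x.2]
    exact hx

end Strata

end QHam

namespace QHam
open Set Filter Topology Function IsManifold

/-! ### The strata as embedded submanifolds. -/

section StratumManifold

variable {F : Type*} [NormedAddCommGroup F] [NormedSpace ℝ F] [FiniteDimensional ℝ F]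
  {U : Type*} [TopologicalSpace U] [ChartedSpace F U] [Group U] [hLie : LieGroup 𝓘(ℝ, F) ∞ U]
  [CompactSpace U]
  {E : Type*} [NormedAddCommGroup E] [NormedSpace ℝ E] [FiniteDimensional ℝ E]
  {M : Type*} [TopologicalSpace M] [ChartedSpace E M] [IsManifold 𝓘(ℝ, E) ∞ M] [T2Space M]
  [MulAction U M] [hsm : ContMDiffSMul 𝓘(ℝ, F) 𝓘(ℝ, E) ∞ U M]
  {K : Subgroup U} (hK : IsClosed (K : Set U))

omit [FiniteDimensional ℝ F] hLie [CompactSpace U] [FiniteDimensional ℝ E]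
  [IsManifold 𝓘(ℝ, E) ∞ M] [T2Space M] in
theorem mem_stratum {d : ℕ} {x : Isotropy M K} :
    x ∈ stratum F E M K d ↔ Module.finrank ℝ (fixedTangent E K (x : M)) = d := Iff.rfl

include hK in
theorem isOpen_stratum (d : ℕ) : IsOpen (stratum F E M K d : Set (Isotropy M K)) := by
  rw [isOpen_iff_mem_nhds]
  intro x hx
  obtain ⟨s, ψ, hs, hxs, -, -, -, hdim⟩ := isotropy_local_structure F E hK x.2
  filter_upwards [(hs.preimage continuous_subtype_val).mem_nhds hxs] with y hy
  exact (hdim y hy y.2).trans hx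

include hK in
theorem exists_stratum_manifold (d : ℕ) :
    ∃ _ : ChartedSpace (EuclideanSpace ℝ (Fin d)) (stratum F E M K d),
      IsManifold (𝓡 d) ∞ (stratum F E M K d) ∧
      Manifold.IsSmoothEmbedding (𝓡 d) 𝓘(ℝ, E) ∞
        (fun y : stratum F E M K d => ((y : Isotropy M K) : M)) := by
  rcases isEmpty_or_nonempty (stratum F E M K d) with he | ⟨⟨x₀⟩⟩
  · exact exists_manifold_of_isEmpty _ d
  have hle : d ≤ Module.finrank ℝ E := by
    have h := Submodule.finrank_le (fixedTangent E K ((x₀ : Isotropy M K) : M))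
    have h' := mem_stratum.1 x₀.2
    omega
  refine exists_submanifold (IsEmbedding.subtypeVal.comp IsEmbedding.subtypeVal)
    (Module.finrank ℝ E - d) d (by omega) fun x => ?_
  obtain ⟨s, ψ, hs, hxs, hψ, hψd, hiff, hdim⟩ := isotropy_local_structure F E hK x.1.2
  set V := fixedTangent E K ((x : Isotropy M K) : M) with hV
  have hVd : Module.finrank ℝ V = d := mem_stratum.1 x.2
  have hq : Module.finrank ℝ (E ⧸ V) =
      Module.finrank ℝ (EuclideanSpace ℝ (Fin (Module.finrank ℝ E - d))) := by
    have h := Submodule.finrank_quotient_add_finrank V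
    rw [finrank_euclideanSpace_fin]; omega
  -- `A` is the projection from `E` to `E ⧸ V` in coordinates; near `x` the equation of the stratum
  -- is `A (ψ y) = 0`.
  set A : E →ₗ[ℝ] EuclideanSpace ℝ (Fin (Module.finrank ℝ E - d)) :=
    (LinearEquiv.ofFinrankEq _ _ hq : (E ⧸ V) →ₗ[ℝ] _) ∘ₗ V.mkQ with hA
  have hAsurj : Surjective A :=
    (LinearEquiv.ofFinrankEq _ _ hq).surjective.comp (Submodule.mkQ_surjective V)
  have hA0 : ∀ v, A v = 0 ↔ v ∈ V := by
    intro v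
    rw [hA, LinearMap.comp_apply, LinearEquiv.coe_coe, LinearEquiv.map_eq_zero_iff,
      Submodule.mkQ_apply, Submodule.Quotient.mk_eq_zero]
  have hAs : ContMDiff 𝓘(ℝ, E) (𝓡 (Module.finrank ℝ E - d)) ∞ A :=
    A.toContinuousLinearMap.contMDiff
  refine ⟨s, fun y => A (ψ y), hs, hxs, (hAs.comp hψ).contMDiffOn, ?_, ?_⟩
  · intro w
    obtain ⟨v, hv⟩ := hAsurj w
    refine ⟨v, ?_⟩
    have h1 : mD E (EuclideanSpace ℝ (Fin (Module.finrank ℝ E - d))) A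
        (ψ ((x : Isotropy M K) : M)) = A.toContinuousLinearMap := by
      rw [mD_eq_fderiv]
      exact A.toContinuousLinearMap.fderiv
    have h2 := mD_comp_smooth hAs hψ ((x : Isotropy M K) : M) v
    rw [h1, hψd] at h2
    exact h2.trans hv
  · intro y hy
    rw [hA0, ← hiff y hy]
    constructor
    · rintro ⟨z, rfl⟩
      exact z.1.2
    · intro hyK
      exact ⟨⟨⟨y, hyK⟩, mem_stratum.2 ((hdim y hy hyK).trans hVd)⟩, rfl⟩

omit [FiniteDimensional ℝ F] hLie [CompactSpace U] [T2Space M] in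
-- `K` acts as the identity on `M_K`, so its tangent vectors are fixed by `K`. Equality follows by
-- dimension, the stratum being defined by the dimension of the fixed space.
theorem range_mD_stratum {d : ℕ} [ChartedSpace (EuclideanSpace ℝ (Fin d)) (stratum F E M K d)]
    [IsManifold (𝓡 d) ∞ (stratum F E M K d)]
    (hs : Manifold.IsSmoothEmbedding (𝓡 d) 𝓘(ℝ, E) ∞
        (fun y : stratum F E M K d => ((y : Isotropy M K) : M))) (y : stratum F E M K d) :
    LinearMap.range (mD (EuclideanSpace ℝ (Fin d)) E
      (fun y : stratum F E M K d => ((y : Isotropy M K) : M)) y :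
        EuclideanSpace ℝ (Fin d) →ₗ[ℝ] E) = fixedTangent E K ((y : Isotropy M K) : M) := by
  have ha := contMDiff_smul_uncurry F U E M
  apply Submodule.eq_of_le_of_finrank_eq
  · rintro _ ⟨v, rfl⟩ k hk
    have h := mD_comp_smooth (contMDiff_action ha k) hs.contMDiff y v
    have h2 : (fun z : stratum F E M K d => k • ((z : Isotropy M K) : M)) =
        fun z : stratum F E M K d => ((z : Isotropy M K) : M) :=
      funext fun z => (smul_eq_of_mem_isotropy z.1.2 k).2 hk
    rw [h2] at h
    exact h.symm
  · rw [LinearMap.finrank_range_of_inj (mD_injective_of_isImmersion hs.isImmersion y),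
      finrank_euclideanSpace_fin]
    exact (mem_stratum.1 y.2).symm

end StratumManifold

end QHam

namespace QHam
open Set Filter Topology Function IsManifold

theorem minSmoothness_two_le_infty : minSmoothness ℝ 2 ≤ ∞ := by
  rw [minSmoothness_of_isRCLikeNormedField]
  exact WithTop.coe_le_coe.2 (le_top : (2 : ℕ∞) ≤ ⊤)

/-! ### Smoothness and exterior derivative of pulled-back forms. -/

section VectorSpaceForms

variable {E : Type*} [NormedAddCommGroup E] [NormedSpace ℝ E]
  {E' : Type*} [NormedAddCommGroup E'] [NormedSpace ℝ E'] {k : ℕ}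

theorem finiteDimensional_continuousMultilinearMap [FiniteDimensional ℝ E] :
    FiniteDimensional ℝ (ContinuousMultilinearMap ℝ (fun _ : Fin k => E) ℝ) :=
  Module.Finite.of_injective
    (ContinuousMultilinearMap.toMultilinearMapLinear :
      ContinuousMultilinearMap ℝ (fun _ : Fin k => E) ℝ →ₗ[ℝ] _)
    ContinuousMultilinearMap.toMultilinearMap_injective

/-- Alternating maps embed linearly in the finite-dimensional space of multilinear maps; a linear
left inverse of the embedding brings smoothness back. -/
theorem contDiffOn_alternating_iff [FiniteDimensional ℝ E] {f : E' → E [⋀^Fin k]→L[ℝ] ℝ}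
    {s : Set E'} (h : ContDiffOn ℝ ∞ (fun x => (f x).toContinuousMultilinearMap) s) :
    ContDiffOn ℝ ∞ f s := by
  have := finiteDimensional_continuousMultilinearMap (E := E) (k := k)
  obtain ⟨l, hl⟩ := LinearMap.exists_leftInverse_of_injective
    (ContinuousAlternatingMap.toContinuousMultilinearMapLI (𝕜 := ℝ) (E := E) (F := ℝ)
      (ι := Fin k)).toLinearMap
    (LinearMap.ker_eq_bot.2 (LinearIsometry.injective _))
  have h1 := l.toContinuousLinearMap.contDiff.comp_contDiffOn h (n := ∞)
  refine h1.congr fun x _ => ?_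
  exact (LinearMap.congr_fun hl (f x)).symm

theorem contDiffOn_form_pullback [FiniteDimensional ℝ E'] {α : E → E [⋀^Fin k]→L[ℝ] ℝ} {t : Set E}
    (hα : ContDiffOn ℝ ∞ α t) {g : E' → E} {s : Set E'} (hs : IsOpen s) (hg : ContDiffOn ℝ ∞ g s)
    (hgt : MapsTo g s t) :
    ContDiffOn ℝ ∞ (fun x => (α (g x)).compContinuousLinearMap (fderiv ℝ g x)) s := by
  apply contDiffOn_alternating_iff
  have h1 : ContDiffOn ℝ ∞ (fderiv ℝ g) s := hg.fderiv_of_isOpen hs (by simp)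
  have h2 : ContDiffOn ℝ ∞ (fun x => ContinuousMultilinearMap.compContinuousLinearMapContinuousMultilinear
      ℝ (fun _ : Fin k => E') (fun _ : Fin k => E) ℝ (fun _ => fderiv ℝ g x)) s :=
    (ContinuousMultilinearMap.contDiff _).comp_contDiffOn (contDiffOn_pi.2 fun _ => h1)
  have h3 : ContDiffOn ℝ ∞ (fun x => (α (g x)).toContinuousMultilinearMap) s :=
    (ContinuousAlternatingMap.toContinuousMultilinearMapLI (𝕜 := ℝ) (E := E) (F := ℝ)
      (ι := Fin k)).contDiff.comp_contDiffOn (hα.comp hg hgt)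
  exact h2.clm_apply h3

end VectorSpaceForms

section Forms

variable {E : Type*} [NormedAddCommGroup E] [NormedSpace ℝ E]
  {M : Type*} [TopologicalSpace M] [ChartedSpace E M] [IsManifold 𝓘(ℝ, E) ∞ M]
  {E' : Type*} [NormedAddCommGroup E'] [NormedSpace ℝ E']
  {S : Type*} [TopologicalSpace S] [ChartedSpace E' S] [IsManifold 𝓘(ℝ, E') ∞ S] {k : ℕ}

/-- The values of a form on vectors of the model space. -/
def FormField.ev (σ : FormField E M k) (x : M) (w : Fin k → E) : ℝ := σ x w

omit [IsManifold 𝓘(ℝ, E) ∞ M] [IsManifold 𝓘(ℝ, E') ∞ S] in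
theorem FormField.ev_pullback (σ : FormField E M k) (f : S → M) (s : S) (w : Fin k → E') :
    (σ.pullback f).ev s w = σ.ev (f s) fun i => mD E' E f s (w i) := rfl

omit [IsManifold 𝓘(ℝ, E) ∞ M] in
theorem FormField.inChart_apply (σ : FormField E M k) (x₀ : M) (y : E) (w : Fin k → E) :
    σ.inChart x₀ y w = σ.ev ((chartAt E x₀).symm y) fun i => mD E E (chartAt E x₀).symm y (w i) := rfl

omit [IsManifold 𝓘(ℝ, E) ∞ M] in
theorem FormField.d_apply (σ : FormField E M k) (x : M) (w : Fin (k + 1) → E) :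
    σ.d.ev x w = extDeriv (σ.inChart x) (chartAt E x x) fun i => mD E E (chartAt E x) x (w i) := rfl

omit [IsManifold 𝓘(ℝ, E) ∞ M] in
theorem FormField.ext_ev {σ τ : FormField E M k} (h : ∀ x w, σ.ev x w = τ.ev x w) : σ = τ := by
  funext x
  exact ContinuousAlternatingMap.ext (h x)

omit [IsManifold 𝓘(ℝ, E) ∞ M] in
theorem FormField.isSmooth_iff {σ : FormField E M k} :
    σ.IsSmooth ↔ ∀ x₀ : M, ContDiffOn ℝ ∞ (σ.inChart x₀) (chartAt E x₀).target := by
  unfold FormField.IsSmooth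
  simp

/-- A map between manifolds, written in the preferred charts. -/
def inCharts (E E' : Type*) [NormedAddCommGroup E] [NormedAddCommGroup E'] [ChartedSpace E M]
    [ChartedSpace E' S] (f : S → M) (s₀ : S) (x₀ : M) (z : E') : E :=
  chartAt E x₀ (f ((chartAt E' s₀).symm z))

variable {f : S → M} (hf : ContMDiff 𝓘(ℝ, E') 𝓘(ℝ, E) ∞ f) (s₀ : S) (x₀ : M)

omit [IsManifold 𝓘(ℝ, E) ∞ M] [IsManifold 𝓘(ℝ, E') ∞ S] in
include hf in
theorem isOpen_inCharts_domain :
    IsOpen ((chartAt E' s₀).target ∩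
      (chartAt E' s₀).symm ⁻¹' (f ⁻¹' (chartAt E x₀).source)) :=
  (chartAt E' s₀).isOpen_inter_preimage_symm ((chartAt E x₀).open_source.preimage hf.continuous)

include hf in
theorem contDiffOn_inCharts :
    ContDiffOn ℝ ∞ (inCharts E E' f s₀ x₀) ((chartAt E' s₀).target ∩
      (chartAt E' s₀).symm ⁻¹' (f ⁻¹' (chartAt E x₀).source)) := by
  rw [← contMDiffOn_iff_contDiffOn]
  exact contMDiffOn_chart.comp (hf.comp_contMDiffOn
    ((contMDiffOn_symm_of_mem_maximalAtlas (chart_mem_maximalAtlas s₀)).mono inter_subset_left))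
    inter_subset_right

include hf in
theorem mD_chart_symm_inCharts {z : E'} (hz : z ∈ (chartAt E' s₀).target)
    (hfz : f ((chartAt E' s₀).symm z) ∈ (chartAt E x₀).source) (v : E') :
    mD E E (chartAt E x₀).symm (inCharts E E' f s₀ x₀ z)
      (fderiv ℝ (inCharts E E' f s₀ x₀) z v) =
    mD E' E f ((chartAt E' s₀).symm z) (mD E' E' (chartAt E' s₀).symm z v) := by
  have hφ := chart_mem_maximalAtlas (I := 𝓘(ℝ, E)) (n := ∞) x₀
  have hc := contMDiffAt_symm_of_mem_maximalAtlas
    (chart_mem_maximalAtlas (I := 𝓘(ℝ, E')) (n := ∞) s₀) hz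
  have h1 := mD_comp_at (g := f) (f := (chartAt E' s₀).symm) z hf.contMDiffAt hc v
  have hfc : ContMDiffAt 𝓘(ℝ, E') 𝓘(ℝ, E) ∞ (fun y => f ((chartAt E' s₀).symm y)) z :=
    ContMDiffAt.comp (g := f) (f := (chartAt E' s₀).symm) z hf.contMDiffAt hc
  have h2 := mD_comp_at (g := chartAt E x₀) (f := fun y => f ((chartAt E' s₀).symm y)) z
    (contMDiffAt_of_mem_maximalAtlas hφ hfz) hfc v
  have h3 : fderiv ℝ (inCharts E E' f s₀ x₀) z =
      mD E' E (fun y => chartAt E x₀ (f ((chartAt E' s₀).symm y))) z := (mD_eq_fderiv _ _).symm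
  rw [h3, h2]
  exact (mD_chart_symm_comp hφ hfz _).trans h1

include hf in
theorem inChart_pullback (σ : FormField E M k) {z : E'} (hz : z ∈ (chartAt E' s₀).target)
    (hfz : f ((chartAt E' s₀).symm z) ∈ (chartAt E x₀).source) :
    (σ.pullback f).inChart s₀ z = (σ.inChart x₀ (inCharts E E' f s₀ x₀ z)).compContinuousLinearMap
      (fderiv ℝ (inCharts E E' f s₀ x₀) z) := by
  ext w
  rw [FormField.inChart_apply, FormField.ev_pullback]
  change _ = σ.inChart x₀ (inCharts E E' f s₀ x₀ z) fun i => fderiv ℝ (inCharts E E' f s₀ x₀) z (w i)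
  rw [FormField.inChart_apply]
  simp only [mD_chart_symm_inCharts hf s₀ x₀ hz hfz]
  rw [inCharts, (chartAt E x₀).left_inv hfz]

include hf in
theorem isSmooth_pullback [FiniteDimensional ℝ E'] {σ : FormField E M k} (hσ : σ.IsSmooth) :
    (σ.pullback (E' := E') f).IsSmooth := by
  rw [FormField.isSmooth_iff] at hσ ⊢
  intro s₀ z hz
  set x₀ := f ((chartAt E' s₀).symm z) with hx₀
  have h1 := contDiffOn_form_pullback (hσ x₀) (isOpen_inCharts_domain hf s₀ x₀)
    (contDiffOn_inCharts hf s₀ x₀) (fun y hy => (chartAt E x₀).map_source hy.2)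
  have hz' : z ∈ (chartAt E' s₀).target ∩
      (chartAt E' s₀).symm ⁻¹' (f ⁻¹' (chartAt E x₀).source) := ⟨hz, mem_chart_source E x₀⟩
  have h2 := (isOpen_inCharts_domain hf s₀ x₀).mem_nhds hz'
  refine ContDiffAt.contDiffWithinAt ?_
  refine (h1.contDiffAt h2).congr_of_eventuallyEq ?_
  filter_upwards [h2] with y hy
  exact inChart_pullback hf s₀ x₀ σ hy.1 hy.2

include hf in
-- In the charts at `s` and `f s` this is the naturality of the exterior derivative on vector
-- spaces. The rest of the computation matches the chart differentials at the base points.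
theorem d_pullback {σ : FormField E M k} (hσ : σ.IsSmooth) :
    (σ.pullback (E' := E') f).d = σ.d.pullback f := by
  rw [FormField.isSmooth_iff] at hσ
  refine FormField.ext_ev fun s w => ?_
  have hs : s ∈ (chartAt E' s).source := mem_chart_source E' s
  have hfs : f s ∈ (chartAt E (f s)).source := mem_chart_source E (f s)
  set z := chartAt E' s s with hz
  have hzs : (chartAt E' s).symm z = s := (chartAt E' s).left_inv hs
  have hz' : z ∈ (chartAt E' s).target ∩
      (chartAt E' s).symm ⁻¹' (f ⁻¹' (chartAt E (f s)).source) :=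
    ⟨(chartAt E' s).map_source hs, by rw [mem_preimage, hzs]; exact hfs⟩
  have h2 := (isOpen_inCharts_domain hf s (f s)).mem_nhds hz'
  have hgz : inCharts E E' f s (f s) z = chartAt E (f s) (f s) := by rw [inCharts, hzs]
  have h3 : (σ.pullback f).inChart s =ᶠ[𝓝 z] fun y =>
      (σ.inChart (f s) (inCharts E E' f s (f s) y)).compContinuousLinearMap
      (fderiv ℝ (inCharts E E' f s (f s)) y) := by
    filter_upwards [h2] with y hy
    exact inChart_pullback hf s (f s) σ hy.1 hy.2
  have h4 : DifferentiableAt ℝ (σ.inChart (f s)) (inCharts E E' f s (f s) z) := by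
    rw [hgz]
    exact ((hσ (f s)).contDiffAt ((chartAt E (f s)).open_target.mem_nhds
      ((chartAt E (f s)).map_source hfs))).differentiableAt (by simp)
  have h5 : ∀ v, fderiv ℝ (inCharts E E' f s (f s)) z (mD E' E' (chartAt E' s) s v) =
      mD E E (chartAt E (f s)) (f s) (mD E' E f s v) := by
    intro v
    have h6 := mD_chart_symm_inCharts hf s (f s) hz'.1 hz'.2 (mD E' E' (chartAt E' s) s v)
    rw [hgz, hzs, mD_chart_symm_comp (chart_mem_maximalAtlas s) hs] at h6
    rw [← h6, mD_chart_comp_symm (chart_mem_maximalAtlas (f s)) hfs]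
  rw [FormField.d_apply, FormField.ev_pullback, FormField.d_apply, h3.extDeriv_eq,
    extDeriv_pullback h4 ((contDiffOn_inCharts hf s (f s)).contDiffAt h2) (r := ∞)
    minSmoothness_two_le_infty, hgz]
  simp only [← h5]
  rfl

end Forms

end QHam

namespace QHam
open Set Filter Topology Function IsManifold VectorField

/-! ### Homomorphisms of Lie groups and Lie brackets. -/

section Related

variable {E : Type*} [NormedAddCommGroup E] [NormedSpace ℝ E]
  {E' : Type*} [NormedAddCommGroup E'] [NormedSpace ℝ E']

/-- The Lie bracket of related vector fields. -/
theorem lieBracket_of_related {φ : E → E'} {z : E} (hφ : ContDiffAt ℝ ∞ φ z) {V W : E → E}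
    {V' W' : E' → E'} (hV : DifferentiableAt ℝ V z) (hW : DifferentiableAt ℝ W z)
    (hV' : DifferentiableAt ℝ V' (φ z)) (hW' : DifferentiableAt ℝ W' (φ z))
    (hVV : ∀ᶠ y in 𝓝 z, fderiv ℝ φ y (V y) = V' (φ y))
    (hWW : ∀ᶠ y in 𝓝 z, fderiv ℝ φ y (W y) = W' (φ y)) :
    fderiv ℝ φ z (lieBracket ℝ V W z) = lieBracket ℝ V' W' (φ z) := by
  have hd : DifferentiableAt ℝ (fderiv ℝ φ) z :=
    (hφ.fderiv_right (m := ∞) (by simp)).differentiableAt (by simp)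
  have hφd : DifferentiableAt ℝ φ z := hφ.differentiableAt (by simp)
  -- Differentiate the relation `dφ(X) = X' ∘ φ` in the direction `w`. In the difference of the two
  -- instances the second derivatives of `φ` cancel by symmetry.
  have key : ∀ (X : E → E) (X' : E' → E'), DifferentiableAt ℝ X z → DifferentiableAt ℝ X' (φ z) →
      (∀ᶠ y in 𝓝 z, fderiv ℝ φ y (X y) = X' (φ y)) → ∀ w,
      fderiv ℝ (fderiv ℝ φ) z w (X z) + fderiv ℝ φ z (fderiv ℝ X z w) =
        fderiv ℝ X' (φ z) (fderiv ℝ φ z w) := by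
    intro X X' hX hX' hXX w
    have h1 : HasFDerivAt (fun y => fderiv ℝ φ y (X y)) _ z := hd.hasFDerivAt.clm_apply hX.hasFDerivAt
    have h2 : HasFDerivAt (fun y => X' (φ y)) _ z := hX'.hasFDerivAt.comp z hφd.hasFDerivAt
    have h3 := h1.unique (h2.congr_of_eventuallyEq hXX)
    have h4 := congrArg (fun A : E →L[ℝ] E' => A w) h3
    simp only [add_apply, ContinuousLinearMap.comp_apply,
      ContinuousLinearMap.flip_apply] at h4
    rw [← h4, add_comm]
  have hsymm : IsSymmSndFDerivAt ℝ φ z := hφ.isSymmSndFDerivAt minSmoothness_two_le_infty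
  have h1 := key W W' hW hW' hWW (V z)
  have h2 := key V V' hV hV' hVV (W z)
  rw [lieBracket_eq, lieBracket_eq]
  dsimp only
  rw [← hVV.self_of_nhds, ← hWW.self_of_nhds, ← h1, ← h2, map_sub, hsymm.eq (V z) (W z)]
  abel

end Related

section Bracket

variable {F : Type*} [NormedAddCommGroup F] [NormedSpace ℝ F]
  {G : Type*} [TopologicalSpace G] [ChartedSpace F G] [Group G] [LieGroup 𝓘(ℝ, F) ∞ G]
  {F' : Type*} [NormedAddCommGroup F'] [NormedSpace ℝ F']
  {G' : Type*} [TopologicalSpace G'] [ChartedSpace F' G'] [Group G'] [LieGroup 𝓘(ℝ, F') ∞ G']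

variable (G) in
/-- The left-invariant vector field with value `X` at `1`, in the preferred chart at `1`. -/
def chartField (X z : F) : F :=
  fderiv ℝ (fun w => chartAt F (1 : G) ((chartAt F (1 : G)).symm z * (chartAt F (1 : G)).symm w))
    (chartAt F (1 : G) 1) X

variable (G) in
theorem differentiableAt_chartField (X : F) :
    DifferentiableAt ℝ (chartField G X) (chartAt F (1 : G) 1) := by
  set c := chartAt F (1 : G)
  have hc : c ∈ maximalAtlas 𝓘(ℝ, F) ∞ G := chart_mem_maximalAtlas 1
  have h1c : (1 : G) ∈ c.source := mem_chart_source F 1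
  have hcs := contMDiffAt_symm_of_mem_maximalAtlas hc (c.map_source h1c)
  have h1 : ContMDiffAt ((𝓘(ℝ, F)).prod 𝓘(ℝ, F)) ((𝓘(ℝ, F)).prod 𝓘(ℝ, F)) ∞
      (fun p : F × F => (c.symm p.1, c.symm p.2)) (c 1, c 1) :=
    (ContMDiffAt.comp (g := c.symm) (f := Prod.fst) (c 1, c 1) hcs contMDiffAt_fst).prodMk
      (ContMDiffAt.comp (g := c.symm) (f := Prod.snd) (c 1, c 1) hcs contMDiffAt_snd)
  have h2 : ContMDiffAt ((𝓘(ℝ, F)).prod 𝓘(ℝ, F)) 𝓘(ℝ, F) ∞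
      (fun p : F × F => c.symm p.1 * c.symm p.2) (c 1, c 1) :=
    ContMDiffAt.comp (g := fun p : G × G => p.1 * p.2) (f := fun p : F × F => (c.symm p.1, c.symm p.2))
      (c 1, c 1) (contMDiff_mul 𝓘(ℝ, F) ∞).contMDiffAt h1
  have h3 : ContMDiffAt ((𝓘(ℝ, F)).prod 𝓘(ℝ, F)) 𝓘(ℝ, F) ∞
      (fun p : F × F => c (c.symm p.1 * c.symm p.2)) (c 1, c 1) := by
    refine ContMDiffAt.comp (g := c) (f := fun p : F × F => c.symm p.1 * c.symm p.2) (c 1, c 1) ?_ h2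
    dsimp only
    rw [c.left_inv h1c, mul_one]
    exact contMDiffAt_of_mem_maximalAtlas hc h1c
  rw [← modelWithCornersSelf_prod, chartedSpaceSelf_prod, contMDiffAt_iff_contDiffAt] at h3
  have h4 : ContDiffAt ℝ ∞ (fun z => fderiv ℝ (fun w => c (c.symm z * c.symm w)) (c 1)) (c 1) :=
    ContDiffAt.fderiv (f := fun z w => c (c.symm z * c.symm w)) (g := fun _ => c 1) h3
      contDiffAt_const (m := ∞) (by simp)
  exact (h4.clm_apply contDiffAt_const).differentiableAt (by simp)

theorem chartField_apply (X : F) {z : F} (hz : z ∈ (chartAt F (1 : G)).target) :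
    chartField G X z = mD F F (chartAt F (1 : G)) ((chartAt F (1 : G)).symm z)
      (mD F F (fun h : G => (chartAt F (1 : G)).symm z * h) 1 X) := by
  set c := chartAt F (1 : G)
  have hc : c ∈ maximalAtlas 𝓘(ℝ, F) ∞ G := chart_mem_maximalAtlas 1
  have h1c : (1 : G) ∈ c.source := mem_chart_source F 1
  have hcs := contMDiffAt_symm_of_mem_maximalAtlas hc (c.map_source h1c)
  have hcz := contMDiffAt_of_mem_maximalAtlas hc (c.map_target hz)
  have hm : ContMDiff 𝓘(ℝ, F) 𝓘(ℝ, F) ∞ (fun h : G => c.symm z * h) := contMDiff_mul_left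
  have h0 := mD_comp_at (g := fun h : G => c.symm z * h) (f := c.symm) (c 1) hm.contMDiffAt hcs X
  have hmc : ContMDiffAt 𝓘(ℝ, F) 𝓘(ℝ, F) ∞ (fun w => c.symm z * c.symm w) (c 1) :=
    ContMDiffAt.comp (g := fun h : G => c.symm z * h) (f := c.symm) (c 1) hm.contMDiffAt hcs
  have h1 := mD_comp_at (g := c) (f := fun w => c.symm z * c.symm w) (c 1)
    (by rw [c.left_inv h1c, mul_one]; exact hcz) hmc X
  have h2 : mD F F c.symm (c 1) X = X := by
    have h3 := mD_chart_symm_comp hc h1c X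
    have h4 : mD F F c 1 = ContinuousLinearMap.id ℝ F := mD_extChartAt_self 1
    rw [h4] at h3
    exact h3
  rw [h0, h2, c.left_inv h1c, mul_one, mD_eq_fderiv] at h1
  exact h1

variable (G) in
/-- The bracket of the Lie algebra of a Lie group, as an operation on the model space. -/
def brk (X Y : F) : F :=
  (⁅(show GroupLieAlgebra 𝓘(ℝ, F) G from X), (show GroupLieAlgebra 𝓘(ℝ, F) G from Y)⁆ :
    GroupLieAlgebra 𝓘(ℝ, F) G)

variable (G) in
-- The bracket on `T₁ G` is that of left-invariant fields, computed in the preferred chart at `1`.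
-- The differential of this chart at `1` is the identity, so no correction remains and related
-- vector fields can be used.
theorem brk_eq (X Y : F) : brk G X Y =
    lieBracket ℝ (chartField G X) (chartField G Y) (chartAt F (1 : G) 1) := by
  set c := chartAt F (1 : G) with hcdef
  have hc : c ∈ maximalAtlas 𝓘(ℝ, F) ∞ G := chart_mem_maximalAtlas 1
  have h1c : (1 : G) ∈ c.source := mem_chart_source F 1
  set V : F → F → F := fun Z => (mpullbackWithin 𝓘(ℝ, F) 𝓘(ℝ, F)
    (extChartAt 𝓘(ℝ, F) (1 : G)).symm (mulInvariantVectorField (I := 𝓘(ℝ, F)) (G := G) Z)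
    (range 𝓘(ℝ, F)) : F → F) with hV
  have hV' : ∀ Z z, V Z z = (mD F F c.symm z).inverse (mD F F (fun h : G => c.symm z * h) 1 Z) := by
    intro Z z
    have h0 : V Z z = ((mfderiv[range 𝓘(ℝ, F)] c.symm z : F →L[ℝ] F)).inverse
      (mD F F (fun h : G => c.symm z * h) 1 Z) := rfl
    rw [h0, modelWithCornersSelf_coe, range_id]
    have h1 : (mfderiv[univ] c.symm z : F →L[ℝ] F) = mD F F c.symm z :=
      congrFun mfderivWithin_univ z
    rw [h1]
    rfl
  have h1 : ∀ Z : F, V Z =ᶠ[𝓝 (c 1)] chartField G Z := by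
    intro Z
    filter_upwards [c.open_target.mem_nhds (c.map_source h1c)] with z hz
    rw [chartField_apply _ hz, hV']
    have h2 : (mD F F c.symm z).inverse = mD F F c (c.symm z) := by
      have hz' := c.right_inv hz
      apply ContinuousLinearMap.inverse_eq
      · ext v
        have h3 := mD_chart_symm_comp hc (c.map_target hz) v
        rw [hz'] at h3
        exact h3
      · ext v
        have h3 := mD_chart_comp_symm hc (c.map_target hz) v
        rw [hz'] at h3
        exact h3
    rw [h2]
  have h2 : (mD F F c 1).inverse = ContinuousLinearMap.id ℝ F := by
    have h4 : mD F F c 1 = ContinuousLinearMap.id ℝ F := mD_extChartAt_self 1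
    rw [h4, ContinuousLinearMap.inverse_id]
  have h3 : brk G X Y = (mD F F c 1).inverse (lieBracketWithin ℝ (V X) (V Y)
      ((extChartAt 𝓘(ℝ, F) (1 : G)).symm ⁻¹' univ ∩ range 𝓘(ℝ, F)) (c 1)) := rfl
  rw [h3, h2, modelWithCornersSelf_coe, range_id, preimage_univ, univ_inter, lieBracketWithin_univ]
  exact Filter.EventuallyEq.lieBracket_vectorField_eq (h1 X) (h1 Y)

/-- The differential of a homomorphism of Lie groups preserves brackets. -/
theorem mD_brk (f : G →* G') (hf : ContMDiff 𝓘(ℝ, F) 𝓘(ℝ, F') ∞ f) (X Y : F) :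
    mD F F' f 1 (brk G X Y) = brk G' (mD F F' f 1 X) (mD F F' f 1 Y) := by
  rw [brk_eq, brk_eq]
  set c := chartAt F (1 : G) with hcdef
  set c' := chartAt F' (1 : G') with hcdef'
  have hc : c ∈ maximalAtlas 𝓘(ℝ, F) ∞ G := chart_mem_maximalAtlas 1
  have h1c : (1 : G) ∈ c.source := mem_chart_source F 1
  have hc' : c' ∈ maximalAtlas 𝓘(ℝ, F') ∞ G' := chart_mem_maximalAtlas 1
  have h1c' : (1 : G') ∈ c'.source := mem_chart_source F' 1
  set φ := inCharts F' F (f : G → G') 1 1 with hφ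
  have hz' : c 1 ∈ c.target ∩ c.symm ⁻¹' (f ⁻¹' c'.source) :=
    ⟨c.map_source h1c, by rw [mem_preimage, c.left_inv h1c, mem_preimage, map_one]; exact h1c'⟩
  have hnhds := (isOpen_inCharts_domain hf (1 : G) (1 : G')).mem_nhds hz'
  have hφs : ContDiffAt ℝ ∞ φ (c 1) := (contDiffOn_inCharts hf 1 1).contDiffAt hnhds
  have hφ1 : φ (c 1) = c' 1 := by
    rw [hφ, inCharts, ← hcdef, ← hcdef', c.left_inv h1c, map_one]
  have hfd : ∀ z ∈ c.target, f (c.symm z) ∈ c'.source → ∀ v, fderiv ℝ φ z v =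
      mD F' F' c' (f (c.symm z)) (mD F F' f (c.symm z) (mD F F c.symm z v)) := by
    intro z hz hfz v
    have h6 := mD_chart_symm_inCharts hf (1 : G) (1 : G') hz hfz v
    rw [← h6]
    have h7 := mD_chart_comp_symm hc' hfz (fderiv ℝ φ z v)
    exact h7.symm
  -- Left-invariant fields with corresponding values at `1` are related by `f`, because `f (g * h) =
  -- f g * f h`.
  have hrel : ∀ Z : F, ∀ᶠ z in 𝓝 (c 1),
      fderiv ℝ φ z (chartField G Z z) = chartField G' (mD F F' f 1 Z) (φ z) := by
    intro Z
    filter_upwards [hnhds] with z hz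
    have hφz : φ z = c' (f (c.symm z)) := rfl
    have h1 := chartField_apply (G := G') (mD F F' f 1 Z) (z := φ z) (c'.map_source hz.2)
    rw [← hcdef', hφz, c'.left_inv hz.2] at h1
    have h2 := mD_chart_symm_comp hc (c.map_target hz.1)
      (mD F F (fun h : G => c.symm z * h) 1 Z)
    rw [c.right_inv hz.1] at h2
    rw [hφz, h1, chartField_apply Z hz.1, hfd z hz.1 hz.2, h2]
    have h3 := mD_comp_smooth hf (contMDiff_mul_left (a := c.symm z)) 1 Z
    have h4 := mD_comp_smooth (contMDiff_mul_left (I := 𝓘(ℝ, F')) (n := ∞) (a := f (c.symm z))) hf 1 Z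
    simp only [map_mul] at h3
    rw [mul_one] at h3
    rw [map_one] at h4
    rw [← h3, ← h4]
  have h1 := lieBracket_of_related hφs (differentiableAt_chartField G X)
    (differentiableAt_chartField G Y)
    (by rw [hφ1]; exact differentiableAt_chartField G' _)
    (by rw [hφ1]; exact differentiableAt_chartField G' _) (hrel X) (hrel Y)
  rw [hφ1] at h1
  have h2 : fderiv ℝ φ (c 1) = mD F F' f 1 := by
    ext v
    have h3 := hfd _ hz'.1 hz'.2 v
    have h4 : mD F' F' c' 1 = ContinuousLinearMap.id ℝ F' := mD_extChartAt_self 1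
    have h5 := mD_chart_symm_comp hc h1c v
    have h6 : mD F F c 1 = ContinuousLinearMap.id ℝ F := mD_extChartAt_self 1
    rw [h6] at h5
    rw [c.left_inv h1c, map_one, h4] at h3
    rw [h3]
    exact congrArg (mD F F' f 1) h5
  rw [h2] at h1
  exact h1

end Bracket

end QHam

namespace QHam
open Set Filter Topology Function IsManifold

/-! ### Orthogonal lifts, the adjoint action and the Maurer-Cartan forms. -/

section OrthogonalSection

variable {A C : Type*} [AddCommGroup A] [Module ℝ A] [FiniteDimensional ℝ A]
  [AddCommGroup C] [Module ℝ C]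

/-- A surjective linear map has a section with values orthogonal to its kernel. -/
theorem exists_orthogonal_section (γ : LinearMap.BilinForm ℝ A) (hs : ∀ X Y, γ X Y = γ Y X)
    (hp : ∀ X, X ≠ 0 → 0 < γ X X) (p : A →ₗ[ℝ] C) (hsurj : Surjective p) :
    ∃ s : C →ₗ[ℝ] A, (∀ y, p (s y) = y) ∧ ∀ y Z, p Z = 0 → γ (s y) Z = 0 := by
  have h0 : ∀ X, γ X X = 0 → X = 0 := fun X h => by
    by_contra hX
    exact (hp X hX).ne' h
  set W := LinearMap.ker p
  have hrefl : γ.IsRefl := fun X Y h => by rw [hs, h]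
  have hcompl : IsCompl W (γ.orthogonal W) := by
    rw [LinearMap.BilinForm.isCompl_orthogonal_iff_disjoint hrefl, Submodule.disjoint_def]
    intro X hX hX'
    exact h0 X (hX' X hX)
  set T : γ.orthogonal W →ₗ[ℝ] C := p ∘ₗ (γ.orthogonal W).subtype
  have hT : Bijective T := by
    constructor
    · rw [injective_iff_map_eq_zero]
      intro X hX
      have h1 : (X : A) ∈ W := hX
      exact Subtype.ext (h0 X (X.2 X h1))
    · intro y
      obtain ⟨X, rfl⟩ := hsurj y
      obtain ⟨Z, hZ, Y, hY, rfl⟩ := Submodule.mem_sup.1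
        (show X ∈ W ⊔ γ.orthogonal W by rw [hcompl.sup_eq_top]; trivial)
      refine ⟨⟨Y, hY⟩, ?_⟩
      have h2 : p Z = 0 := hZ
      change p Y = _
      rw [map_add, h2, zero_add]
  refine ⟨(γ.orthogonal W).subtype ∘ₗ (LinearEquiv.ofBijective T hT).symm, ?_, ?_⟩
  · intro y
    exact (LinearEquiv.ofBijective T hT).apply_symm_apply y
  · intro y Z hZ
    rw [hs]
    exact ((LinearEquiv.ofBijective T hT).symm y).2 Z hZ

end OrthogonalSection

section AdjointAction

variable {F : Type*} [NormedAddCommGroup F] [NormedSpace ℝ F]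
  {G : Type*} [TopologicalSpace G] [ChartedSpace F G] [Group G] [LieGroup 𝓘(ℝ, F) ∞ G]
  {F' : Type*} [NormedAddCommGroup F'] [NormedSpace ℝ F']
  {G' : Type*} [TopologicalSpace G'] [ChartedSpace F' G'] [Group G'] [LieGroup 𝓘(ℝ, F') ∞ G']
  {E : Type*} [NormedAddCommGroup E] [NormedSpace ℝ E]
  {M : Type*} [TopologicalSpace M] [ChartedSpace E M]

variable (F) in
/-- The adjoint action, on the model space. -/
def mAd (g : G) : F →L[ℝ] F := mD F F (fun h : G => g * h * g⁻¹) 1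

variable (F) in
/-- The left Maurer-Cartan form, on the model space. -/
def mThetaL (u : G) : F →L[ℝ] F := mD F F (fun h : G => u⁻¹ * h) u

variable (F) in
/-- The right Maurer-Cartan form, on the model space. -/
def mThetaR (u : G) : F →L[ℝ] F := mD F F (fun h : G => h * u⁻¹) u

variable (F) in
theorem contMDiff_conj (g : G) : ContMDiff 𝓘(ℝ, F) 𝓘(ℝ, F) ∞ (fun h : G => g * h * g⁻¹) :=
  (contMDiff_mul_right (I := 𝓘(ℝ, F)) (n := ∞) (a := g⁻¹)).comp contMDiff_mul_left

theorem mAd_mul (g h : G) (X : F) : mAd F (g * h) X = mAd F g (mAd F h X) := by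
  have h1 := mD_comp_smooth (contMDiff_conj F g) (contMDiff_conj F h) 1 X
  rw [mul_one, mul_inv_cancel] at h1
  unfold mAd
  rw [← h1]
  congr 2
  funext x
  group

omit [LieGroup 𝓘(ℝ, F) ∞ G] in
theorem mAd_one (X : F) : mAd F (1 : G) X = X := by
  unfold mAd
  simp only [one_mul, inv_one, mul_one]
  rw [mD_id]; rfl

theorem mAd_mAd_inv (g : G) (X : F) : mAd F g (mAd F g⁻¹ X) = X := by
  rw [← mAd_mul, mul_inv_cancel, mAd_one]

/-- Since `h u⁻¹ = u (u⁻¹ h) u⁻¹`. It turns `θᴸ + θᴿ` in the momentum identity into `Id + Ad u`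
applied to `θᴸ`. -/
theorem mThetaR_eq (u : G) (v : F) : mThetaR F u v = mAd F u (mThetaL F u v) := by
  have h1 := mD_comp_smooth (contMDiff_conj F u)
    (contMDiff_mul_left (I := 𝓘(ℝ, F)) (n := ∞) (a := u⁻¹)) u v
  rw [inv_mul_cancel] at h1
  unfold mThetaR mAd mThetaL
  rw [← h1]
  congr 2
  funext x
  group

variable {f : G →* G'} (hf : ContMDiff 𝓘(ℝ, F) 𝓘(ℝ, F') ∞ f)

include hf in
theorem mD_mAd (g : G) (X : F) : mD F F' f 1 (mAd F g X) = mAd F' (f g) (mD F F' f 1 X) := by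
  have h1 := mD_comp_smooth hf (contMDiff_conj F g) 1 X
  have h2 := mD_comp_smooth (contMDiff_conj F' (f g)) hf 1 X
  rw [mul_one, mul_inv_cancel] at h1
  rw [map_one] at h2
  unfold mAd
  rw [← h1, ← h2]
  simp only [map_mul, map_inv]

include hf in
theorem mD_mThetaL (u : G) (v : F) :
    mD F F' f 1 (mThetaL F u v) = mThetaL F' (f u) (mD F F' f u v) := by
  have h1 := mD_comp_smooth hf (contMDiff_mul_left (I := 𝓘(ℝ, F)) (n := ∞) (a := u⁻¹)) u v
  have h2 := mD_comp_smooth (contMDiff_mul_left (I := 𝓘(ℝ, F')) (n := ∞) (a := (f u)⁻¹)) hf u v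
  rw [inv_mul_cancel] at h1
  unfold mThetaL
  rw [← h1, ← h2]
  simp only [map_mul, map_inv]

theorem mD_mul_one {f h : M → G} {x : M} (hf : ContMDiffAt 𝓘(ℝ, E) 𝓘(ℝ, F) ∞ f x)
    (hh : ContMDiffAt 𝓘(ℝ, E) 𝓘(ℝ, F) ∞ h x) (hf1 : f x = 1) (hh1 : h x = 1) (v : E) :
    mD E F (fun y => f y * h y) x v = mD E F f x v + mD E F h x v := by
  have hfd := hf.mdifferentiableAt (n := ∞) (by simp)
  have hhd := hh.mdifferentiableAt (n := ∞) (by simp)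
  have hm : MDifferentiableAt ((𝓘(ℝ, F)).prod 𝓘(ℝ, F)) 𝓘(ℝ, F) (fun p : G × G => p.1 * p.2)
      (f x, h x) := (contMDiff_mul 𝓘(ℝ, F) ∞).contMDiffAt.mdifferentiableAt (by simp)
  have h1 : mD E F (fun y => f y * h y) x v =
      mfderiv ((𝓘(ℝ, F)).prod 𝓘(ℝ, F)) 𝓘(ℝ, F) (fun p : G × G => p.1 * p.2) (f x, h x)
        (mD E F f x v, mD E F h x v) := by
    have h2 : mfderiv 𝓘(ℝ, E) 𝓘(ℝ, F) ((fun p : G × G => p.1 * p.2) ∘ fun y => (f y, h y)) x = _ :=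
      mfderiv_comp x hm (hfd.prodMk hhd)
    rw [mfderiv_prodMk hfd hhd] at h2
    exact congrArg (fun L : E →L[ℝ] F => L v) h2
  have h2 := mfderiv_prod_eq_add_apply (v := (mD E F f x v, mD E F h x v)) hm
  have h3 : mD F F (fun z : G => z * h x) (f x) = ContinuousLinearMap.id ℝ F := by
    simp only [hh1, mul_one]
    exact mD_id _
  have h4 : mD F F (fun z : G => f x * z) (h x) = ContinuousLinearMap.id ℝ F := by
    simp only [hf1, one_mul]
    exact mD_id _
  rw [h1]
  refine h2.trans ?_
  change mD F F (fun z : G => z * h x) (f x) (mD E F f x v) +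
    mD F F (fun z : G => f x * z) (h x) (mD E F h x v) = _
  rw [h3, h4]; rfl

end AdjointAction

section Fibres

variable {E : Type*} [NormedAddCommGroup E] [NormedSpace ℝ E]
  {M : Type*} [TopologicalSpace M] [ChartedSpace E M]
  {E' : Type*} [NormedAddCommGroup E'] [NormedSpace ℝ E']
  {M' : Type*} [TopologicalSpace M'] [ChartedSpace E' M']
  {E'' : Type*} [NormedAddCommGroup E''] [NormedSpace ℝ E'']
  {M'' : Type*} [TopologicalSpace M''] [ChartedSpace E'' M'']

/-- A smooth map which is constant along the fibres of a submersion kills the vertical vectors. -/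
theorem mD_eq_zero_of_fibre_const [IsManifold 𝓘(ℝ, E) ∞ M] [IsManifold 𝓘(ℝ, E') ∞ M'] {p : M → M'}
    (hp : Manifold.IsSubmersion 𝓘(ℝ, E) 𝓘(ℝ, E') ∞ p) {f : M → M''}
    (hf : ContMDiff 𝓘(ℝ, E) 𝓘(ℝ, E'') ∞ f) (hc : ∀ x y, p x = p y → f x = f y) {x : M} {v : E}
    (hv : mD E E' p x v = 0) : mD E E'' f x v = 0 := by
  obtain ⟨s, hsx, hs, hps⟩ := exists_local_section hp x
  have hpc := hp.contMDiff
  have h1 : f =ᶠ[𝓝 x] fun y => f (s (p y)) := by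
    filter_upwards [hpc.continuous.continuousAt.eventually hps] with y hy
    exact hc _ _ hy.symm
  have h2 : ContMDiffAt 𝓘(ℝ, E') 𝓘(ℝ, E'') ∞ (fun z => f (s z)) (p x) :=
    ContMDiffAt.comp (g := f) (f := s) (p x) hf.contMDiffAt hs
  rw [mD_congr h1, mD_comp_at (g := fun z => f (s z)) (f := p) x h2 hpc.contMDiffAt, hv, map_zero]

end Fibres

end QHam

namespace QHam
open Set Filter Topology Function IsManifold

/-! ### The inner product on the Lie algebra of a quotient group. -/

section QuotientInner

variable {A : Type*} [NormedAddCommGroup A] [NormedSpace ℝ A] [FiniteDimensional ℝ A]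
  {N : Type*} [TopologicalSpace N] [ChartedSpace A N] [Group N] [LieGroup 𝓘(ℝ, A) ∞ N]
  {C : Type*} [NormedAddCommGroup C] [NormedSpace ℝ C]
  {Q : Type*} [TopologicalSpace Q] [ChartedSpace C Q] [Group Q] [LieGroup 𝓘(ℝ, C) ∞ Q]
  {p : N →* Q} (hp : Manifold.IsSubmersion 𝓘(ℝ, A) 𝓘(ℝ, C) ∞ p)

omit [FiniteDimensional ℝ A] in
include hp in
-- Conjugation by `n` is the product of the commutator `c` and the identity map. As `n` commutes
-- with the kernel of `p`, `c` is constant on its cosets, so its differential kills `X`; the product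
-- rule at `1` leaves `X`.
theorem mAd_eq_self_of_commute {n : N} (hn : ∀ k, p k = 1 → n * k = k * n) {X : A}
    (hX : mD A C p 1 X = 0) : mAd A n X = X := by
  set c : N → N := fun g => n * g * n⁻¹ * g⁻¹ with hc
  have hcs : ContMDiff 𝓘(ℝ, A) 𝓘(ℝ, A) ∞ c :=
    (contMDiff_conj A n).mul (contMDiff_inv 𝓘(ℝ, A) ∞)
  have h1 : ∀ x y, p x = p y → c x = c y := by
    intro x y hxy
    have hk : p (x⁻¹ * y) = 1 := by rw [map_mul, map_inv, hxy, inv_mul_cancel]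
    have hy : y = x * (x⁻¹ * y) := by group
    rw [hc]; dsimp only
    rw [hy]
    set k := x⁻¹ * y
    have h2 : n * (x * k) * n⁻¹ * (x * k)⁻¹ = n * x * (k * n⁻¹ * k⁻¹) * x⁻¹ := by group
    have h3 : k * n⁻¹ * k⁻¹ = n⁻¹ := by
      have h4 := hn k hk
      rw [mul_inv_eq_iff_eq_mul, eq_inv_mul_iff_mul_eq, ← mul_assoc, h4, mul_inv_cancel_right]
    rw [h2, h3]
  have h2 := mD_eq_zero_of_fibre_const hp hcs h1 hX
  have h3 := mD_mul_one (f := c) (h := fun g : N => g) (x := 1) hcs.contMDiffAt contMDiffAt_id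
    (by simp [hc]) rfl X
  have h4 : (fun g : N => c g * g) = fun g => n * g * n⁻¹ := by
    funext g
    simp [hc]
  rw [h4, h2, mD_id, zero_add] at h3
  exact h3

include hp in
/-- An invariant inner product on the Lie algebra of a Lie group induces one on the Lie algebra of
a quotient. -/
theorem exists_quotient_inner (hps : Surjective p) (γ : LinearMap.BilinForm ℝ A)
    (hs : ∀ X Y, γ X Y = γ Y X) (hpos : ∀ X, X ≠ 0 → 0 < γ X X)
    (hAd : ∀ (n : N) X Y, γ (mAd A n X) (mAd A n Y) = γ X Y) :
    ∃ (B' : LinearMap.BilinForm ℝ C) (s : C →ₗ[ℝ] A), (∀ y, mD A C p 1 (s y) = y) ∧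
      (∀ y Z, mD A C p 1 Z = 0 → γ (s y) Z = 0) ∧ (∀ x y, B' x y = B' y x) ∧
      (∀ x, x ≠ 0 → 0 < B' x x) ∧ (∀ (l : Q) x y, B' (mAd C l x) (mAd C l y) = B' x y) ∧
      ∀ X Y, (∀ Z, mD A C p 1 Z = 0 → γ X Z = 0) → B' (mD A C p 1 X) (mD A C p 1 Y) = γ X Y := by
  obtain ⟨s, hs1, hs2⟩ := exists_orthogonal_section γ hs hpos (mD A C p 1 : A →ₗ[ℝ] C)
    (mD_surjective_of_isSubmersion hp 1)
  have hs1' : ∀ y, mD A C p 1 (s y) = y := hs1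
  have hs2' : ∀ y Z, mD A C p 1 Z = 0 → γ (s y) Z = 0 := hs2
  -- Two lifts of the same element, both orthogonal to the kernel, differ by a vector of the kernel
  -- orthogonal to itself.
  have huniq : ∀ X, (∀ Z, mD A C p 1 Z = 0 → γ X Z = 0) → s (mD A C p 1 X) = X := by
    intro X hX
    by_contra hne
    have h1 : mD A C p 1 (s (mD A C p 1 X) - X) = 0 := by rw [map_sub, hs1', sub_self]
    have h2 : γ (s (mD A C p 1 X) - X) (s (mD A C p 1 X) - X) = 0 := by
      rw [map_sub γ, LinearMap.sub_apply, hs2' _ _ h1, hX _ h1, sub_self]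
    exact (hpos _ (sub_ne_zero.2 hne)).ne' h2
  -- Orthogonality of one argument suffices: replacing `Y` by another lift of its image changes it
  -- by a vector of the kernel, which `X` does not see.
  have hq : ∀ X Y, (∀ Z, mD A C p 1 Z = 0 → γ X Z = 0) →
      γ (s (mD A C p 1 X)) (s (mD A C p 1 Y)) = γ X Y := by
    intro X Y hX
    rw [huniq X hX]
    have h1 : mD A C p 1 (s (mD A C p 1 Y) - Y) = 0 := by rw [map_sub, hs1', sub_self]
    have h2 := hX _ h1
    rw [map_sub, sub_eq_zero] at h2
    exact h2
  refine ⟨γ.comp s s, s, hs1', hs2', fun x y => hs _ _, ?_, ?_, ?_⟩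
  · intro x hx
    refine hpos _ fun h => hx ?_
    rw [← hs1' x, h, map_zero]
  · intro l x y
    obtain ⟨n, rfl⟩ := hps l
    -- The orthogonal lift is `Ad`-equivariant, because `Ad n` preserves both the form and the
    -- kernel of the differential of `p`. Invariance of `B'` follows.
    have h1 : ∀ z, s (mAd C (p n) z) = mAd A n (s z) := by
      intro z
      have h2 := mD_mAd hp.contMDiff n (s z)
      rw [hs1'] at h2
      rw [← h2]
      apply huniq
      intro Z hZ
      rw [← mAd_mAd_inv n Z, hAd]
      apply hs2'
      rw [mD_mAd hp.contMDiff, hZ, map_zero]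
    simp only [LinearMap.BilinForm.comp_apply, h1, hAd]
  · intro X Y hX
    simp only [LinearMap.BilinForm.comp_apply]
    exact hq X Y hX

end QuotientInner

section Embedding

variable {E : Type*} [NormedAddCommGroup E] [NormedSpace ℝ E]
  {M : Type*} [TopologicalSpace M] [ChartedSpace E M]
  {E' : Type*} [NormedAddCommGroup E'] [NormedSpace ℝ E']
  {M' : Type*} [TopologicalSpace M'] [ChartedSpace E' M']

theorem contMDiffAt_of_comp_embedding {f : M → M'}
    (hf : Manifold.IsSmoothEmbedding 𝓘(ℝ, E) 𝓘(ℝ, E') ∞ f)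
    {E₁ : Type*} [NormedAddCommGroup E₁] [NormedSpace ℝ E₁] {H₁ : Type*} [TopologicalSpace H₁]
    {I : ModelWithCorners ℝ E₁ H₁} {M₁ : Type*} [TopologicalSpace M₁] [ChartedSpace H₁ M₁]
    {g : M₁ → M} {x : M₁} (hg : ContMDiffAt I 𝓘(ℝ, E') ∞ (fun y => f (g y)) x) :
    ContMDiffAt I 𝓘(ℝ, E) ∞ g x :=
  (ContMDiffAt.iff_comp_isImmersionAt (hf.isImmersion.isImmersionAt _)).2
    ⟨hf.isEmbedding.isInducing.continuousAt_iff.2 hg.continuousAt, hg⟩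

end Embedding

/-! ### Centralizing elements and vectors fixed by `Ad K`. -/

section Centralizer

variable {F : Type*} [NormedAddCommGroup F] [NormedSpace ℝ F] [FiniteDimensional ℝ F]
  {U : Type*} [TopologicalSpace U] [ChartedSpace F U] [Group U] [LieGroup 𝓘(ℝ, F) ∞ U]
  [T2Space U] [CompactSpace U] {K : Subgroup U} (hK : IsClosed (K : Set U))

omit [FiniteDimensional ℝ F] [T2Space U] [CompactSpace U] in
variable (F U) in
theorem contMDiff_conj_uncurry :
    ContMDiff ((𝓘(ℝ, F)).prod 𝓘(ℝ, F)) 𝓘(ℝ, F) ∞ (uncurry fun g h : U => g * h * g⁻¹) :=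
  (contMDiff_mul 𝓘(ℝ, F) ∞).mul ((contMDiff_inv 𝓘(ℝ, F) ∞).comp contMDiff_fst)

omit [TopologicalSpace U] [T2Space U] [CompactSpace U] in
theorem mem_nor_of_commute {c : U} (hc : ∀ k ∈ K, k * c * k⁻¹ = c) : c ∈ Nor K := by
  have h1 : ∀ k ∈ K, c * k * c⁻¹ = k := by
    intro k hk
    have h2 := hc k hk
    rw [mul_inv_eq_iff_eq_mul] at h2
    rw [mul_inv_eq_iff_eq_mul, h2]
  rw [Subgroup.mem_normalizer_iff]
  intro h
  constructor
  · intro hh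
    rw [h1 h hh]; exact hh
  · intro hh
    have h2 := h1 _ hh
    have h3 : c * h * c⁻¹ = h := by
      have h4 : c⁻¹ * (c * (c * h * c⁻¹) * c⁻¹) * c = c⁻¹ * (c * h * c⁻¹) * c := by rw [h2]
      simpa [mul_assoc] using h4
    rwa [h3] at hh

include hK in
/-- The vectors fixed by the adjoint action of `K` are tangent to the normalizer of `K`. -/
theorem fixedVectors_conj_le {A : Type*} [NormedAddCommGroup A] [NormedSpace ℝ A]
    [ChartedSpace A (Nor K)] [LieGroup 𝓘(ℝ, A) ∞ (Nor K)]
    (hi : Manifold.IsSmoothEmbedding 𝓘(ℝ, A) 𝓘(ℝ, F) ∞ (Nor K).subtype) {X : F}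
    (hX : X ∈ fixedVectors (fun g h : U => g * h * g⁻¹) K 1) :
    ∃ Y : A, mD A F (Nor K).subtype 1 Y = X := by
  have : IsTopologicalGroup U := topologicalGroup_of_lieGroup 𝓘(ℝ, F) ∞
  have : CompactSpace K := isCompact_iff_compactSpace.1 hK.isCompact
  have ha := contMDiff_conj_uncurry F U
  have h1K : ∀ k ∈ K, k * 1 * k⁻¹ = (1 : U) := fun k _ => by group
  obtain ⟨ψ, hψ, hψ1, hψd, hψK⟩ := exists_linearization ha (fun y => by group)
    (fun g h y => by group) K h1K
  obtain ⟨e, he, h1e, -, heψ⟩ := exists_chart_of_bijective isOpen_univ (mem_univ (1 : U))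
    hψ.contMDiffOn (by rw [hψd]; exact bijective_id)
  have he1 : e 1 = 0 := (heψ 1 h1e).trans hψ1
  have hsource : ∀ᶠ y in 𝓝 (1 : U), ∀ k ∈ (K : Set U), k * y * k⁻¹ ∈ e.source := by
    refine hK.isCompact.eventually_forall_of_forall_eventually fun k hk => ?_
    have h2 : IsOpen {p : U × U | p.2 * p.1 * p.2⁻¹ ∈ e.source} :=
      e.open_source.preimage (ha.continuous.comp (continuous_snd.prodMk continuous_fst))
    refine h2.mem_nhds ?_
    change k * 1 * k⁻¹ ∈ e.source
    rw [h1K k hk]; exact h1e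
  -- The line through `X` consists of fixed vectors, so in a chart linearizing conjugation by `K` it
  -- is a curve of elements that commute with `K`, with velocity `X` at `0`.
  set c : ℝ → U := fun r => e.symm (r • X) with hc
  have hc0 : c 0 = 1 := by
    rw [hc]; dsimp only
    rw [zero_smul, ← he1, e.left_inv h1e]
  have hlin : ContMDiff 𝓘(ℝ, ℝ) 𝓘(ℝ, F) ∞ (fun r : ℝ => r • X) :=
    (contDiff_id.smul contDiff_const).contMDiff
  have hcs : ContMDiffAt 𝓘(ℝ, ℝ) 𝓘(ℝ, F) ∞ c 0 := by
    refine ContMDiffAt.comp (g := e.symm) (f := fun r : ℝ => r • X) 0 ?_ hlin.contMDiffAt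
    rw [zero_smul, ← he1]
    exact contMDiffAt_symm_of_mem_maximalAtlas he (e.map_source h1e)
  have htarget : ∀ᶠ r : ℝ in 𝓝 0, r • X ∈ e.target := by
    refine hlin.continuous.continuousAt.eventually_mem (e.open_target.mem_nhds ?_)
    rw [zero_smul, ← he1]
    exact e.map_source h1e
  have hψc : ∀ᶠ r : ℝ in 𝓝 0, ψ (c r) = r • X := by
    filter_upwards [htarget] with r hr
    rw [hc]; dsimp only
    rw [← heψ _ (e.map_target hr), e.right_inv hr]
  have hcN : ∀ᶠ r in 𝓝 0, c r ∈ Nor K := by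
    have h2 : ∀ᶠ r in 𝓝 0, ∀ k ∈ (K : Set U), k * c r * k⁻¹ ∈ e.source := by
      have h3 := hcs.continuousAt
      rw [ContinuousAt, hc0] at h3
      exact h3.eventually hsource
    filter_upwards [h2, htarget, hψc] with r hr1 hr2 hr3
    refine mem_nor_of_commute fun k hk => ?_
    apply e.injOn (hr1 k hk) (e.map_target hr2)
    have h4 := hψK k hk (c r)
    rw [heψ _ (hr1 k hk), h4, hr3, map_smul, hX k hk, heψ _ (e.map_target hr2)]
    exact hr3.symm
  classical
  -- The value `1` is used only where the curve may leave the normalizer, away from `0`.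
  set g : ℝ → Nor K := fun r => if h : c r ∈ Nor K then ⟨c r, h⟩ else 1 with hg
  have hgc : (fun r => (Nor K).subtype (g r)) =ᶠ[𝓝 0] c := by
    filter_upwards [hcN] with r hr
    rw [hg]; dsimp only
    rw [dif_pos hr]; rfl
  have hg0 : g 0 = 1 := by
    apply Subtype.ext
    have h2 := hgc.self_of_nhds
    rw [hc0] at h2
    exact h2
  have hgs : ContMDiffAt 𝓘(ℝ, ℝ) 𝓘(ℝ, A) ∞ g 0 :=
    contMDiffAt_of_comp_embedding hi (hcs.congr_of_eventuallyEq hgc)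
  refine ⟨mD ℝ A g 0 1, ?_⟩
  have h2 := mD_comp_at (g := (Nor K).subtype) (f := g) 0 hi.contMDiff.contMDiffAt hgs 1
  have h3 := mD_comp_at (g := ψ) (f := c) 0 hψ.contMDiffAt hcs 1
  rw [mD_congr hgc, hg0] at h2
  rw [hc0, hψd, mD_congr (g := fun r : ℝ => r • X) hψc, mD_eq_fderiv] at h3
  have h4 : fderiv ℝ (fun r : ℝ => r • X) 0 1 = X := by
    have h5 : HasFDerivAt (fun r : ℝ => r • X) ((ContinuousLinearMap.id ℝ ℝ).smulRight X) 0 :=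
      (hasFDerivAt_id (𝕜 := ℝ) (0 : ℝ)).smul_const X
    rw [h5.fderiv]
    simp
  rw [← h2]
  rw [h4] at h3
  exact h3.symm

end Centralizer

end QHam

namespace QHam
open Set Filter Topology Function IsManifold

section PullbackComp

variable {E : Type*} [NormedAddCommGroup E] [NormedSpace ℝ E]
  {M : Type*} [TopologicalSpace M] [ChartedSpace E M]
  {E' : Type*} [NormedAddCommGroup E'] [NormedSpace ℝ E']
  {M' : Type*} [TopologicalSpace M'] [ChartedSpace E' M']
  {E'' : Type*} [NormedAddCommGroup E''] [NormedSpace ℝ E'']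
  {M'' : Type*} [TopologicalSpace M''] [ChartedSpace E'' M''] {k : ℕ}

theorem pullback_comp (σ : FormField E'' M'' k) {g : M' → M''} {f : M → M'}
    (hg : ContMDiff 𝓘(ℝ, E') 𝓘(ℝ, E'') ∞ g) (hf : ContMDiff 𝓘(ℝ, E) 𝓘(ℝ, E') ∞ f) :
    (σ.pullback (E' := E) fun y => g (f y)) = (σ.pullback (E' := E') g).pullback f := by
  refine FormField.ext_ev fun x w => ?_
  rw [FormField.ev_pullback, FormField.ev_pullback, FormField.ev_pullback]
  simp only [mD_comp_smooth hg hf]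

end PullbackComp

set_option linter.unusedSectionVars false

/-! ### Action, momentum map and orthogonality on `M_K`. -/

section Reduction

variable {F : Type*} [NormedAddCommGroup F] [NormedSpace ℝ F] [FiniteDimensional ℝ F]
  {U : Type*} [TopologicalSpace U] [ChartedSpace F U] [Group U] [LieGroup 𝓘(ℝ, F) ∞ U]
  [T2Space U] [CompactSpace U]
  {E : Type*} [NormedAddCommGroup E] [NormedSpace ℝ E] [FiniteDimensional ℝ E]
  {M : Type*} [TopologicalSpace M] [ChartedSpace E M] [IsManifold 𝓘(ℝ, E) ∞ M] [T2Space M]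
  [MulAction U M]
  {K : Subgroup U} (hK : IsClosed (K : Set U))
  {A : Type*} [NormedAddCommGroup A] [NormedSpace ℝ A] [FiniteDimensional ℝ A]
  [ChartedSpace A (Nor K)] [LieGroup 𝓘(ℝ, A) ∞ (Nor K)]
  {C : Type*} [NormedAddCommGroup C] [NormedSpace ℝ C]
  [ChartedSpace C (LK K)] [LieGroup 𝓘(ℝ, C) ∞ (LK K)]
  (hi : Manifold.IsSmoothEmbedding 𝓘(ℝ, A) 𝓘(ℝ, F) ∞ (Nor K).subtype)
  (hp : Manifold.IsSubmersion 𝓘(ℝ, A) 𝓘(ℝ, C) ∞ (pK K))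
  {D : Type*} [NormedAddCommGroup D] [NormedSpace ℝ D]
  {S : SubMulAction (LK K) (Isotropy M K)} [ChartedSpace D S] [IsManifold 𝓘(ℝ, D) ∞ S]

/-- The inclusion of a part of `M_K` in `M`. -/
def incl (S : SubMulAction (LK K) (Isotropy M K)) (y : S) : M := ((y : Isotropy M K) : M)

variable (hι : Manifold.IsSmoothEmbedding 𝓘(ℝ, D) 𝓘(ℝ, E) ∞ (incl S))

omit [TopologicalSpace U] [T2Space U] [CompactSpace U] [TopologicalSpace M] [T2Space M] in
theorem smul_incl (y : S) {k : U} (hk : k ∈ K) : k • incl S y = incl S y :=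
  (smul_eq_of_mem_isotropy (y : Isotropy M K).2 k).2 hk

omit [TopologicalSpace U] [T2Space U] [CompactSpace U] [TopologicalSpace M] [T2Space M] in
/-- The values of an equivariant map on `M_K` commute with `K`. -/
theorem conj_momentum_eq {μ : M → U} (hμ : ∀ (g : U) (x : M), μ (g • x) = g * μ x * g⁻¹)
    {x : M} (hx : x ∈ Isotropy M K) {k : U} (hk : k ∈ K) : k * μ x * k⁻¹ = μ x := by
  rw [← hμ, (smul_eq_of_mem_isotropy hx k).2 hk]

/-- The momentum map as a map to the normalizer of `K`. -/
def momNor {μ : M → U} (hμ : ∀ x : Isotropy M K, μ x ∈ Nor K)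
    (S : SubMulAction (LK K) (Isotropy M K)) (y : S) : Nor K :=
  ⟨μ (incl S y), hμ (y : Isotropy M K)⟩

variable {μ : M → U} (hμ : ∀ x : Isotropy M K, μ x ∈ Nor K)

section

variable (hμs : ContMDiff 𝓘(ℝ, E) 𝓘(ℝ, F) ∞ μ)

include hι hi hμs in
theorem contMDiff_momNor : ContMDiff 𝓘(ℝ, D) 𝓘(ℝ, A) ∞ (momNor hμ S) :=
  contMDiff_of_comp_embedding hi (g := momNor hμ S) (hμs.comp hι.contMDiff)

variable [hsm : ContMDiffSMul 𝓘(ℝ, F) 𝓘(ℝ, E) ∞ U M]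

include hi hp hι hsm in
-- Smoothness is tested after composing with the submersion `N(K) → L_K` on one side and the
-- embedding in `M` on the other, where the map is a restriction of the `U`-action.
theorem contMDiffSMul_quotient : ContMDiffSMul 𝓘(ℝ, C) 𝓘(ℝ, D) ∞ (LK K) S := by
  constructor
  rintro ⟨l, y⟩
  obtain ⟨n, rfl⟩ := QuotientGroup.mk'_surjective _ l
  refine contMDiffAt_of_comp_submersion_prod hp (g := fun q : LK K × S => q.1 • q.2) n y ?_
  have h1 : ContMDiff ((𝓘(ℝ, A)).prod 𝓘(ℝ, D)) 𝓘(ℝ, E) ∞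
      (fun q : Nor K × S => ((Nor K).subtype q.1) • incl S q.2) :=
    (contMDiff_smul_uncurry F U E M).comp (hi.contMDiff.prodMap hι.contMDiff)
  exact contMDiff_of_comp_embedding hι (g := fun q : Nor K × S => pK K q.1 • q.2) h1 (n, y)

include hi hp hι hsm in
/-- The fundamental vector fields of the quotient are the restrictions of those of the group. -/
theorem mD_incl_orbit (X : A) (y : S) :
    mD D E (incl S) y (mD C D (fun l : LK K => l • y) 1 (mD A C (pK K) 1 X)) =
      mD F E (fun g : U => g • incl S y) 1 (mD A F (Nor K).subtype 1 X) := by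
  have hact := contMDiffSMul_quotient (F := F) hi hp hι
  have horb : ContMDiff 𝓘(ℝ, C) 𝓘(ℝ, D) ∞ (fun l : LK K => l • y) :=
    (contMDiff_smul (I := 𝓘(ℝ, C)) (I' := 𝓘(ℝ, D)) (n := ∞)).comp
      (contMDiff_id.prodMk contMDiff_const)
  have horbU : ContMDiff 𝓘(ℝ, F) 𝓘(ℝ, E) ∞ (fun g : U => g • incl S y) :=
    (contMDiff_smul_uncurry F U E M).comp (contMDiff_id.prodMk contMDiff_const)
  have h1 := mD_comp_smooth hι.contMDiff horb 1 (mD A C (pK K) 1 X)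
  have h2 := mD_comp_smooth (g := fun l : LK K => incl S (l • y)) (hι.contMDiff.comp horb)
    hp.contMDiff 1 X
  have h3 := mD_comp_smooth horbU hi.contMDiff 1 X
  rw [one_smul] at h1
  rw [map_one] at h2 h3
  rw [← h1, ← h2, ← h3]
  rfl

include hi hp hι hsm in
theorem invariant_pullback {σ : FormField E M 2}
    (hσ : ∀ g : U, σ.pullback (fun x : M => g • x) = σ) (l : LK K) :
    (σ.pullback (E' := D) (incl S)).pullback (fun y : S => l • y) =
      σ.pullback (E' := D) (incl S) := by
  have hact := contMDiffSMul_quotient (F := F) hi hp hι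
  obtain ⟨n, rfl⟩ := QuotientGroup.mk'_surjective _ l
  have h1 : ContMDiff 𝓘(ℝ, D) 𝓘(ℝ, D) ∞ (fun y : S => pK K n • y) :=
    (contMDiff_smul (I := 𝓘(ℝ, C)) (I' := 𝓘(ℝ, D)) (n := ∞)).comp
      (contMDiff_const.prodMk contMDiff_id)
  have h2 : ContMDiff 𝓘(ℝ, E) 𝓘(ℝ, E) ∞ (fun x : M => (n : U) • x) :=
    contMDiff_action (contMDiff_smul_uncurry F U E M) (n : U)
  have h3 := pullback_comp σ hι.contMDiff h1
  have h4 := pullback_comp σ h2 hι.contMDiff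
  rw [hσ] at h4
  exact h3.symm.trans h4

end

section LieAlgebra

variable (β : LinearMap.BilinForm ℝ F)

/-- The restriction of a bilinear form to the Lie algebra of the normalizer. -/
def norForm (K : Subgroup U) (A : Type*) [NormedAddCommGroup A] [NormedSpace ℝ A]
    [ChartedSpace A (Nor K)] (β : LinearMap.BilinForm ℝ F) : LinearMap.BilinForm ℝ A :=
  β.comp (mD A F (Nor K).subtype 1 : A →ₗ[ℝ] F) (mD A F (Nor K).subtype 1 : A →ₗ[ℝ] F)

omit [FiniteDimensional ℝ F] [LieGroup 𝓘(ℝ, F) ∞ U] [T2Space U] [CompactSpace U]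
  [FiniteDimensional ℝ A] [LieGroup 𝓘(ℝ, A) ∞ (Nor K)] in
theorem norForm_apply (X Y : A) : norForm K A β X Y =
    β (mD A F (Nor K).subtype 1 X) (mD A F (Nor K).subtype 1 Y) := rfl

/-- The logarithmic derivative of the momentum map on `M_K`. -/
def logMom (A : Type*) [NormedAddCommGroup A] [NormedSpace ℝ A] [ChartedSpace A (Nor K)]
    {D : Type*} [NormedAddCommGroup D] [NormedSpace ℝ D]
    {μ : M → U} (hμ : ∀ x : Isotropy M K, μ x ∈ Nor K)
    {S : SubMulAction (LK K) (Isotropy M K)} [ChartedSpace D S] (y : S) (v : D) : A :=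
  mThetaL A (momNor hμ S y) (mD D A (momNor hμ S) y v)

variable (hμs : ContMDiff 𝓘(ℝ, E) 𝓘(ℝ, F) ∞ μ)

include hi hι hμs in
-- With `mD_pK_logMom`: a single vector of `Lie(N(K))` lies over the logarithmic derivatives of `μ`
-- and of `p_K ∘ μ`. The two inner products are compared on it.
theorem mD_subtype_logMom (y : S) (v : D) : mD A F (Nor K).subtype 1 (logMom A hμ y v) =
    mThetaL F (μ (incl S y)) (mD E F μ (incl S y) (mD D E (incl S) y v)) := by
  have h1 := mD_comp_smooth hμs hι.contMDiff y v
  have h2 := mD_comp_smooth hi.contMDiff (contMDiff_momNor hi hι hμ hμs) y v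
  rw [logMom, mD_mThetaL hi.contMDiff, ← h1, ← h2]
  rfl

include hi hι hμs hp in
theorem mD_pK_logMom (y : S) (v : D) : mD A C (pK K) 1 (logMom A hμ y v) =
    mThetaL C (pK K (momNor hμ S y)) (mD D C (fun z => pK K (momNor hμ S z)) y v) := by
  have h2 := mD_comp_smooth hp.contMDiff (contMDiff_momNor hi hι hμ hμs) y v
  rw [logMom, mD_mThetaL hp.contMDiff, h2]

variable [hsm : ContMDiffSMul 𝓘(ℝ, F) 𝓘(ℝ, E) ∞ U M] {σ : FormField E M 2}
  (hmom : ∀ (X : F) (x : M) (v : E), σ.ev x ![mD F E (fun g : U => g • x) 1 X, v] =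
    (1 / 2 : ℝ) * β (mThetaL F (μ x) (mD E F μ x v) + mThetaR F (μ x) (mD E F μ x v)) X)

include hi hι hμs hmom in
theorem momentum_nor (X : A) (y : S) (v : D) :
    σ.ev (incl S y) ![mD F E (fun g : U => g • incl S y) 1 (mD A F (Nor K).subtype 1 X),
      mD D E (incl S) y v] =
    (1 / 2 : ℝ) * norForm K A β (logMom A hμ y v + mAd A (momNor hμ S y) (logMom A hμ y v)) X := by
  have h : mD A F (Nor K).subtype 1
      (logMom A hμ y v + mAd A (momNor hμ S y) (logMom A hμ y v)) =
      mD A F (Nor K).subtype 1 (logMom A hμ y v) +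
        mAd F (μ (incl S y)) (mD A F (Nor K).subtype 1 (logMom A hμ y v)) := by
    rw [map_add, mD_mAd hi.contMDiff]
    rfl
  rw [hmom, mThetaR_eq, ← mD_subtype_logMom hi hι hμ hμs, norForm_apply, h]

variable (hequiv : ∀ (g : U) (x : M), μ (g • x) = g * μ x * g⁻¹)
  (hAd : ∀ (g : U) X Y, β (mAd F g X) (mAd F g Y) = β X Y)

include hp hequiv in
-- `μ(y)` commutes with `K`, hence acts trivially on `Lie(K)`, the kernel of the differential of
-- `p_K`.
theorem mAd_momNor (y : S) {X : A} (hX : mD A C (pK K) 1 X = 0) : mAd A (momNor hμ S y) X = X := by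
  refine mAd_eq_self_of_commute hp (fun k hk => ?_) hX
  have hk' : (k : U) ∈ K := by
    rw [← MonoidHom.mem_ker, QuotientGroup.ker_mk'] at hk
    exact Subgroup.mem_subgroupOf.1 hk
  have h1 := conj_momentum_eq hequiv (y : Isotropy M K).2 hk'
  rw [mul_inv_eq_iff_eq_mul] at h1
  exact Subtype.ext h1.symm

include hi hAd in
theorem norForm_mAd (n : Nor K) (X Y : A) :
    norForm K A β (mAd A n X) (mAd A n Y) = norForm K A β X Y := by
  rw [norForm_apply, mD_mAd hi.contMDiff, mD_mAd hi.contMDiff, hAd]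
  rfl

include hi hAd hp hequiv in
theorem norForm_mAd_momNor (y : S) (X : A) {Z : A} (hZ : mD A C (pK K) 1 Z = 0) :
    norForm K A β (mAd A (momNor hμ S y) X) Z = norForm K A β X Z := by
  conv_lhs => rw [← mAd_momNor hp hμ hequiv y hZ]
  exact norForm_mAd hi β hAd _ _ _

include hi hp hι hμs hmom hequiv hAd hsm in
-- `Z` is in `Lie(K)`, so its fundamental vector at `y` vanishes. Since `Ad μ(y)` is an isometry
-- fixing `Z`, both terms of the momentum identity equal half the pairing with `Z`, and their sum is
-- `0`.
theorem norForm_logMom_eq_zero (y : S) (v : D) {Z : A} (hZ : mD A C (pK K) 1 Z = 0) :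
    norForm K A β (logMom A hμ y v) Z = 0 := by
  have h1 := momentum_nor hi hι hμ β hμs hmom Z y v
  have h2 := mD_incl_orbit hi hp hι Z y (F := F)
  rw [hZ, map_zero, map_zero] at h2
  have h3 : σ.ev (incl S y) ![(0 : E), mD D E (incl S) y v] = 0 :=
    (σ (incl S y)).map_coord_zero 0 rfl
  rw [← h2, h3, map_add, LinearMap.add_apply, norForm_mAd_momNor hi hp hμ β hequiv hAd y _ hZ] at h1
  linarith

end LieAlgebra

end Reduction

end QHam

namespace QHam
open Set Filter Topology Function IsManifold

set_option linter.unusedSectionVars false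

/-! ### The kernel condition and averaging over `K`. -/

section Kernel

variable {F : Type*} [NormedAddCommGroup F] [NormedSpace ℝ F] [FiniteDimensional ℝ F]
  {U : Type*} [TopologicalSpace U] [ChartedSpace F U] [Group U] [LieGroup 𝓘(ℝ, F) ∞ U]
  [T2Space U] [CompactSpace U]
  {E : Type*} [NormedAddCommGroup E] [NormedSpace ℝ E] [FiniteDimensional ℝ E]
  {M : Type*} [TopologicalSpace M] [ChartedSpace E M] [IsManifold 𝓘(ℝ, E) ∞ M] [T2Space M]
  [MulAction U M] [hsm : ContMDiffSMul 𝓘(ℝ, F) 𝓘(ℝ, E) ∞ U M]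
  {K : Subgroup U} (hK : IsClosed (K : Set U)) {σ : FormField E M 2}

theorem FormField.ev_pair_map (σ : FormField E M 2) (L : E →L[ℝ] E) (x : M) (u w : E) :
    (σ.ev x fun i => L (![u, w] i)) = σ.ev x ![L u, L w] := by
  congr 1
  funext i
  fin_cases i <;> rfl

theorem ev_smul_of_fixed (hinv : ∀ g : U, σ.pullback (fun x : M => g • x) = σ) {k : U} {x : M}
    (hx : k • x = x) (u w : E) :
    σ.ev x ![mD E E (fun y : M => k • y) x u, mD E E (fun y : M => k • y) x w] =
      σ.ev x ![u, w] := by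
  have h1 : (σ.pullback (fun x : M => k • x)).ev x ![u, w] = σ.ev x ![u, w] := by rw [hinv]
  rw [FormField.ev_pullback, hx, FormField.ev_pair_map] at h1
  exact h1

/-- The contraction of a `2`-form with a vector. -/
def FormField.contract (σ : FormField E M 2) (x : M) (u : E) : E →L[ℝ] ℝ :=
  ContinuousMultilinearMap.toContinuousLinearMap (R := ℝ) (M₁ := fun _ : Fin 2 => E)
    (show E [⋀^Fin 2]→L[ℝ] ℝ from σ x).toContinuousMultilinearMap ![u, 0] 1

theorem FormField.contract_apply (σ : FormField E M 2) (x : M) (u w : E) :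
    σ.contract x u w = σ.ev x ![u, w] := by
  have h : Function.update ![u, 0] (1 : Fin 2) w = ![u, w] := by
    funext i
    fin_cases i <;> rfl
  rw [← h]
  rfl

variable (F) in
include hK hsm in
/-- An invariant `2`-form pairs a fixed vector with all vectors through the fixed vectors. -/
theorem ev_eq_zero_of_fixed (hinv : ∀ g : U, σ.pullback (fun x : M => g • x) = σ) {x : M}
    (hx : ∀ k ∈ K, k • x = x) {u : E} (hu : u ∈ fixedTangent E K x)
    (h : ∀ w ∈ fixedTangent E K x, σ.ev x ![u, w] = 0) (w : E) : σ.ev x ![u, w] = 0 := by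
  have : IsTopologicalGroup U := topologicalGroup_of_lieGroup 𝓘(ℝ, F) ∞
  have : CompactSpace K := isCompact_iff_compactSpace.1 hK.isCompact
  have ha := contMDiff_smul_uncurry F U E M
  have h1 := clm_fixedProj ha K hx (σ.contract x u) (v := w) fun k hk => by
    rw [FormField.contract_apply, FormField.contract_apply, ← ev_smul_of_fixed hinv (hx k hk) u w,
      hu k hk]
  have h2 := fixedProj_mem ha (fun g h y => mul_smul g h y) K hx w
  rw [FormField.contract_apply, FormField.contract_apply, h _ h2] at h1
  exact h1.symm

include hK in
/-- A tangent vector to an orbit at a fixed point of `K`, which is itself fixed by `K`, comes from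
a vector fixed by the adjoint action of `K`. -/
theorem exists_fixed_generator {x : M} (hx : ∀ k ∈ K, k • x = x) {u : U}
    (hu : ∀ k ∈ K, k * u * k⁻¹ = u) {X : F} (hX : mAd F u X + X = 0)
    (hXx : mD F E (fun g : U => g • x) 1 X ∈ fixedTangent E K x) :
    ∃ Y ∈ fixedVectors (fun g h : U => g * h * g⁻¹) K 1, mAd F u Y + Y = 0 ∧
      mD F E (fun g : U => g • x) 1 Y = mD F E (fun g : U => g • x) 1 X := by
  have : IsTopologicalGroup U := topologicalGroup_of_lieGroup 𝓘(ℝ, F) ∞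
  have : CompactSpace K := isCompact_iff_compactSpace.1 hK.isCompact
  have ha := contMDiff_conj_uncurry F U
  have hs := contMDiff_smul_uncurry F U E M
  have h1K : ∀ k ∈ K, k * 1 * k⁻¹ = (1 : U) := fun k _ => by group
  have horb : ContMDiff 𝓘(ℝ, F) 𝓘(ℝ, E) ∞ (fun g : U => g • x) :=
    hs.comp (contMDiff_id.prodMk contMDiff_const)
  -- Average `Ad k X` over `K`. The equation survives because `u` commutes with `K`; the tangent
  -- vector is unchanged because the orbit map is `K`-equivariant and its value at `X` is fixed by
  -- `K`.
  refine ⟨fixedProj (fun g h : U => g * h * g⁻¹) K 1 X,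
    fixedProj_mem ha (fun g h y => by group) K h1K X, ?_, ?_⟩
  · have h1 := clm_fixedProj ha K h1K (mAd F u + ContinuousLinearMap.id ℝ F) (v := X)
      fun k hk => by
        have h2 : mAd F u (mAd F k X) = mAd F k (mAd F u X) := by
          have h3 := hu k hk
          rw [mul_inv_eq_iff_eq_mul] at h3
          rw [← mAd_mul, ← mAd_mul, h3]
        change mAd F u (mAd F k X) + mAd F k X = mAd F u X + X
        rw [h2, ← map_add, hX, map_zero]
    exact h1.trans hX
  · refine clm_fixedProj ha K h1K (mD F E (fun g : U => g • x) 1) (v := X) fun k hk => ?_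
    have h1 := mD_comp_smooth horb (contMDiff_conj F k) 1 X
    have h2 := mD_comp_smooth (contMDiff_action hs k) horb 1 X
    rw [h1K k hk] at h1
    rw [one_smul] at h2
    rw [hXx k hk] at h2
    rw [← h1, ← h2]
    congr 2
    funext g
    rw [mul_smul, mul_smul, hx _ (K.inv_mem hk)]

end Kernel

section Reduction

variable {F : Type*} [NormedAddCommGroup F] [NormedSpace ℝ F] [FiniteDimensional ℝ F]
  {U : Type*} [TopologicalSpace U] [ChartedSpace F U] [Group U] [LieGroup 𝓘(ℝ, F) ∞ U]
  [T2Space U] [CompactSpace U]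
  {E : Type*} [NormedAddCommGroup E] [NormedSpace ℝ E] [FiniteDimensional ℝ E]
  {M : Type*} [TopologicalSpace M] [ChartedSpace E M] [IsManifold 𝓘(ℝ, E) ∞ M] [T2Space M]
  [MulAction U M] [hsm : ContMDiffSMul 𝓘(ℝ, F) 𝓘(ℝ, E) ∞ U M]
  {K : Subgroup U} (hK : IsClosed (K : Set U))
  {A : Type*} [NormedAddCommGroup A] [NormedSpace ℝ A] [FiniteDimensional ℝ A]
  [ChartedSpace A (Nor K)] [LieGroup 𝓘(ℝ, A) ∞ (Nor K)]
  {C : Type*} [NormedAddCommGroup C] [NormedSpace ℝ C]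
  [ChartedSpace C (LK K)] [LieGroup 𝓘(ℝ, C) ∞ (LK K)]
  (hi : Manifold.IsSmoothEmbedding 𝓘(ℝ, A) 𝓘(ℝ, F) ∞ (Nor K).subtype)
  (hp : Manifold.IsSubmersion 𝓘(ℝ, A) 𝓘(ℝ, C) ∞ (pK K))
  {D : Type*} [NormedAddCommGroup D] [NormedSpace ℝ D]
  {S : SubMulAction (LK K) (Isotropy M K)} [ChartedSpace D S] [IsManifold 𝓘(ℝ, D) ∞ S]
  (hι : Manifold.IsSmoothEmbedding 𝓘(ℝ, D) 𝓘(ℝ, E) ∞ (incl S))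
  (hT : ∀ y : S, LinearMap.range (mD D E (incl S) y : D →ₗ[ℝ] E) = fixedTangent E K (incl S y))
  {μ : M → U} (hμ : ∀ x : Isotropy M K, μ x ∈ Nor K) {β : LinearMap.BilinForm ℝ F}
  (hpos : ∀ X, X ≠ 0 → 0 < β X X)
  (hAd : ∀ (g : U) X Y, β (mAd F g X) (mAd F g Y) = β X Y)
  {σ : FormField E M 2}
  (hinv : ∀ g : U, σ.pullback (fun x : M => g • x) = σ)
  (hequiv : ∀ (g : U) (x : M), μ (g • x) = g * μ x * g⁻¹)
  (hker : ∀ (x : M) (v : E), (∀ w : E, σ.ev x ![v, w] = 0) ↔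
    ∃ X : F, mAd F (μ x) X + X = 0 ∧ mD F E (fun g : U => g • x) 1 X = v)
  {s : C →ₗ[ℝ] A} (hs1 : ∀ y, mD A C (pK K) 1 (s y) = y)
  (hs2 : ∀ y Z, mD A C (pK K) 1 Z = 0 → norForm K A β (s y) Z = 0)

theorem pullback_ev_pair (σ : FormField E M 2) (y : S) (v w : D) :
    (σ.pullback (E' := D) (incl S)).ev y ![v, w] =
      σ.ev (incl S y) ![mD D E (incl S) y v, mD D E (incl S) y w] := by
  rw [FormField.ev_pullback]
  congr 1
  funext i
  fin_cases i <;> rfl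

include hsm hK hi hp hι hT hpos hAd hinv hequiv hker hs1 hs2 in
/-- The kernel of the restriction of the `2`-form of a quasi-Hamiltonian space to `M_K`. -/
theorem ker_form_pullback (y : S) (v : D) :
    (∀ w : D, (σ.pullback (E' := D) (incl S)).ev y ![v, w] = 0) ↔
      ∃ X : C, mAd C (pK K (momNor hμ S y)) X + X = 0 ∧
        mD C D (fun l : LK K => l • y) 1 X = v := by
  have hx : ∀ k ∈ K, k • incl S y = incl S y := fun k hk => smul_incl y hk
  have hinj := mD_injective_of_isImmersion hi.isImmersion 1
  have hιinj := mD_injective_of_isImmersion hι.isImmersion y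
  have hfix : ∀ v, mD D E (incl S) y v ∈ fixedTangent E K (incl S y) := fun v => by
    rw [← hT y]; exact ⟨v, rfl⟩
  constructor
  · intro h
    have h1 : ∀ w, σ.ev (incl S y) ![mD D E (incl S) y v, w] = 0 := by
      refine ev_eq_zero_of_fixed F hK hinv hx (hfix v) fun w hw => ?_
      rw [← hT y] at hw
      obtain ⟨w', rfl⟩ := hw
      exact (pullback_ev_pair σ y v w').symm.trans (h w')
    obtain ⟨X, hX, hXv⟩ := (hker _ _).1 h1
    -- The averaged generator is fixed by `Ad K`, so it comes from a vector `Z` of `Lie(N(K))`,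
    -- whose image in `Lie(L_K)` is the required element.
    obtain ⟨Y, hY, hY1, hY2⟩ := exists_fixed_generator hK hx
      (fun k hk => conj_momentum_eq hequiv (y : Isotropy M K).2 hk) hX (by rw [hXv]; exact hfix v)
    obtain ⟨Z, rfl⟩ := fixedVectors_conj_le hK hi hY
    refine ⟨mD A C (pK K) 1 Z, ?_, ?_⟩
    · have h2 : mAd A (momNor hμ S y) Z + Z = 0 := by
        apply hinj
        rw [map_add, mD_mAd hi.contMDiff, map_zero]
        exact hY1
      rw [← mD_mAd hp.contMDiff, ← map_add, h2, map_zero]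
    · apply hιinj
      rw [mD_incl_orbit (F := F) hi hp hι, hY2, hXv]
  · rintro ⟨X, hX, rfl⟩ w
    have h1 : mD A C (pK K) 1 (mAd A (momNor hμ S y) (s X) + s X) = 0 := by
      rw [map_add, mD_mAd hp.contMDiff, hs1, hX]
    -- The vector lies in `Lie(K)` by `h1`. It is orthogonal to `Lie(K)` because `s X` is and `Ad
    -- μ(y)` preserves pairings with `Lie(K)`; so it is orthogonal to itself.
    have h2 : norForm K A β (mAd A (momNor hμ S y) (s X) + s X)
        (mAd A (momNor hμ S y) (s X) + s X) = 0 := by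
      conv_lhs => rw [map_add (norForm K A β), LinearMap.add_apply]
      rw [norForm_mAd_momNor hi hp hμ β hequiv hAd y _ h1, hs2 _ _ h1, add_zero]
    have h3 : mAd A (momNor hμ S y) (s X) + s X = 0 := by
      by_contra hne
      have h4 : mD A F (Nor K).subtype 1 (mAd A (momNor hμ S y) (s X) + s X) ≠ 0 := fun h5 =>
        hne (hinj (h5.trans (map_zero _).symm))
      exact (hpos _ h4).ne' h2
    rw [pullback_ev_pair]
    refine (hker _ _).2 ⟨mD A F (Nor K).subtype 1 (s X), ?_, ?_⟩ _
    · have h4 := congrArg (mD A F (Nor K).subtype 1) h3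
      rw [map_add, mD_mAd hi.contMDiff, map_zero] at h4
      exact h4
    · rw [← mD_incl_orbit (F := F) hi hp hι, hs1]

variable {B' : LinearMap.BilinForm ℝ C} (hsymm : ∀ X Y, β X Y = β Y X)
  (hsymm' : ∀ X Y, B' X Y = B' Y X)
  (hB' : ∀ X Y, (∀ Z, mD A C (pK K) 1 Z = 0 → norForm K A β X Z = 0) →
    B' (mD A C (pK K) 1 X) (mD A C (pK K) 1 Y) = norForm K A β X Y)
  (hμs : ContMDiff 𝓘(ℝ, E) 𝓘(ℝ, F) ∞ μ)
  (hmom : ∀ (X : F) (x : M) (v : E), σ.ev x ![mD F E (fun g : U => g • x) 1 X, v] =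
    (1 / 2 : ℝ) * β (mThetaL F (μ x) (mD E F μ x v) + mThetaR F (μ x) (mD E F μ x v)) X)

include hsm hi hp hι hsymm hsymm' hB' hμs hmom hs1 hs2 in
-- The generator is replaced by its orthogonal lift `s X`, for which the two inner products agree
-- against any vector.
theorem momentum_pullback (X : C) (y : S) (v : D) :
    (σ.pullback (E' := D) (incl S)).ev y ![mD C D (fun l : LK K => l • y) 1 X, v] =
      (1 / 2 : ℝ) * B' (mThetaL C (pK K (momNor hμ S y))
          (mD D C (fun z => pK K (momNor hμ S z)) y v) +
        mThetaR C (pK K (momNor hμ S y)) (mD D C (fun z => pK K (momNor hμ S z)) y v)) X := by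
  have h1 := mD_incl_orbit (F := F) hi hp hι (s X) y
  rw [hs1] at h1
  rw [pullback_ev_pair, h1, momentum_nor hi hι hμ β hμs hmom, mThetaR_eq,
    ← mD_pK_logMom hi hp hι hμ hμs, ← mD_mAd hp.contMDiff, ← map_add]
  congr 1
  have h2 := hB' (s X) (logMom A hμ y v + mAd A (momNor hμ S y) (logMom A hμ y v)) (hs2 X)
  rw [hs1] at h2
  rw [hsymm', h2, norForm_apply, norForm_apply, hsymm]

include hsm hi hp hι hAd hequiv hB' hμs hmom in
-- Brackets are preserved by the inclusion of `N(K)` and by `p_K`. The first argument is orthogonal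
-- to `Lie(K)`, which is enough for the two inner products to agree even if the bracket is not
-- orthogonal to it.
theorem d_form_pullback (hσ : σ.IsSmooth)
    (hd : ∀ (x : M) (v : Fin 3 → E), σ.d.ev x v = -((1 / 2 : ℝ) *
      β (mThetaL F (μ x) (mD E F μ x (v 0)))
        (brk U (mThetaL F (μ x) (mD E F μ x (v 1))) (mThetaL F (μ x) (mD E F μ x (v 2))))))
    (y : S) (v : Fin 3 → D) :
    (σ.pullback (E' := D) (incl S)).d.ev y v = -((1 / 2 : ℝ) *
      B' (mThetaL C (pK K (momNor hμ S y)) (mD D C (fun z => pK K (momNor hμ S z)) y (v 0)))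
        (brk (LK K)
          (mThetaL C (pK K (momNor hμ S y)) (mD D C (fun z => pK K (momNor hμ S z)) y (v 1)))
          (mThetaL C (pK K (momNor hμ S y)) (mD D C (fun z => pK K (momNor hμ S z)) y (v 2))))) := by
  rw [d_pullback hι.contMDiff hσ, FormField.ev_pullback, hd]
  simp only [← mD_pK_logMom hi hp hι hμ hμs, ← mD_subtype_logMom hi hι hμ hμs]
  rw [← mD_brk _ hp.contMDiff, ← mD_brk _ hi.contMDiff, hB', norForm_apply]
  exact fun Z hZ => norForm_logMom_eq_zero hi hp hι hμ β hμs hmom hequiv hAd y _ hZ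

end Reduction

end QHam

namespace QHam
open Set Filter Topology Function IsManifold

set_option linter.unusedSectionVars false

/-! ### Assembly of the quasi-Hamiltonian structure. -/

section Reduction

variable {F : Type*} [NormedAddCommGroup F] [NormedSpace ℝ F] [FiniteDimensional ℝ F]
  {U : Type*} [TopologicalSpace U] [ChartedSpace F U] [Group U] [LieGroup 𝓘(ℝ, F) ∞ U]
  [T2Space U] [CompactSpace U]
  {E : Type*} [NormedAddCommGroup E] [NormedSpace ℝ E] [FiniteDimensional ℝ E]
  {M : Type*} [TopologicalSpace M] [ChartedSpace E M] [IsManifold 𝓘(ℝ, E) ∞ M] [T2Space M]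
  [MulAction U M] [hsm : ContMDiffSMul 𝓘(ℝ, F) 𝓘(ℝ, E) ∞ U M]
  {K : Subgroup U} (hK : IsClosed (K : Set U))
  {A : Type*} [NormedAddCommGroup A] [NormedSpace ℝ A] [FiniteDimensional ℝ A]
  [ChartedSpace A (Nor K)] [LieGroup 𝓘(ℝ, A) ∞ (Nor K)]
  {C : Type*} [NormedAddCommGroup C] [NormedSpace ℝ C]
  [ChartedSpace C (LK K)] [LieGroup 𝓘(ℝ, C) ∞ (LK K)]
  (hi : Manifold.IsSmoothEmbedding 𝓘(ℝ, A) 𝓘(ℝ, F) ∞ (Nor K).subtype)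
  (hp : Manifold.IsSubmersion 𝓘(ℝ, A) 𝓘(ℝ, C) ∞ (pK K))
  {D : Type*} [NormedAddCommGroup D] [NormedSpace ℝ D]
  {S : SubMulAction (LK K) (Isotropy M K)} [ChartedSpace D S] [IsManifold 𝓘(ℝ, D) ∞ S]
  (hι : Manifold.IsSmoothEmbedding 𝓘(ℝ, D) 𝓘(ℝ, E) ∞ (incl S))
  (hT : ∀ y : S, LinearMap.range (mD D E (incl S) y : D →ₗ[ℝ] E) = fixedTangent E K (incl S y))
  {μ : M → U} (hμ : ∀ x : Isotropy M K, μ x ∈ Nor K)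
  {B : LinearMap.BilinForm ℝ (GroupLieAlgebra 𝓘(ℝ, F) U)} (hB : IsAdInvariantInner B)
  {σ : FormField E M 2} (hM : IsQuasiHamiltonian B σ μ)
  {B' : LinearMap.BilinForm ℝ C} (hsymm' : ∀ X Y, B' X Y = B' Y X)
  (hB' : ∀ X Y, (∀ Z, mD A C (pK K) 1 Z = 0 → norForm (F := F) K A B X Z = 0) →
    B' (mD A C (pK K) 1 X) (mD A C (pK K) 1 Y) = norForm (F := F) K A B X Y)
  {s : C →ₗ[ℝ] A} (hs1 : ∀ y, mD A C (pK K) 1 (s y) = y)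
  (hs2 : ∀ y Z, mD A C (pK K) 1 Z = 0 → norForm (F := F) K A B (s y) Z = 0)

include hsm hK hi hp hι hT hB hM hsymm' hB' hs1 hs2 in
/-- The restriction of a quasi-Hamiltonian structure to a smooth part of `M_K`. -/
theorem isQuasiHamiltonian_restriction [FiniteDimensional ℝ D] :
    IsQuasiHamiltonian (F := C) (G := LK K) (E := D) (M := S) B' (σ.pullback (E' := D) (incl S))
      (fun y => pK K (momNor hμ S y)) where
  smooth_action := contMDiffSMul_quotient (F := F) hi hp hι
  smooth_form := isSmooth_pullback hι.contMDiff hM.smooth_form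
  smooth_momentum := hp.contMDiff.comp (contMDiff_momNor hi hι hμ hM.smooth_momentum)
  invariant := invariant_pullback (F := F) hi hp hι hM.invariant
  equivariant := by
    intro l y
    obtain ⟨n, rfl⟩ := QuotientGroup.mk'_surjective _ l
    rw [← map_inv, ← map_mul, ← map_mul]
    exact congrArg (pK K) (Subtype.ext (hM.equivariant (n : U) (incl S y)))
  d_form := d_form_pullback hi hp hι hμ hB.ad_invariant hM.equivariant hB' hM.smooth_momentum
    hM.momentum hM.smooth_form hM.d_form
  ker_form := ker_form_pullback hK hi hp hι hT hμ hB.pos hB.ad_invariant hM.invariant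
    hM.equivariant hM.ker_form hs1 hs2
  momentum := momentum_pullback hi hp hι hμ hs1 hs2 hB.symm hsymm' hB' hM.smooth_momentum
    hM.momentum

end Reduction

theorem isClosed_nor {U : Type*} [TopologicalSpace U] [Group U] [IsTopologicalGroup U]
    {K : Subgroup U} (hK : IsClosed (K : Set U)) : IsClosed (Nor K : Set U) := by
  have h : (Nor K : Set U) = ⋂ k : K, ({g : U | g * k * g⁻¹ ∈ (K : Set U)} ∩
      {g : U | g⁻¹ * k * g ∈ (K : Set U)}) := by
    ext g
    simp only [SetLike.mem_coe, mem_iInter, mem_inter_iff, mem_ofPred_eq, Subgroup.mem_normalizer_iff]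
    constructor
    · intro hg k
      refine ⟨(hg k).1 k.2, (hg _).2 ?_⟩
      have h1 : g * (g⁻¹ * k * g) * g⁻¹ = k := by group
      rw [h1]
      exact k.2
    · intro hg k
      refine ⟨fun hk => (hg ⟨k, hk⟩).1, fun hk => ?_⟩
      have h1 := (hg ⟨_, hk⟩).2
      have h2 : g⁻¹ * (g * k * g⁻¹) * g = k := by group
      rwa [h2] at h1
  rw [h]
  exact isClosed_iInter fun k => (hK.preimage (by fun_prop)).inter (hK.preimage (by fun_prop))

theorem eq_one_of_smul_eq {U M : Type*} [Group U] [MulAction U M] {K : Subgroup U} (l : LK K)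
    (x : Isotropy M K) (h : l • x = x) : l = 1 := by
  obtain ⟨n, rfl⟩ := QuotientGroup.mk'_surjective _ l
  have h1 : (n : U) • (x : M) = x := congrArg Subtype.val h
  exact (QuotientGroup.eq_one_iff n).2
    (Subgroup.mem_subgroupOf.2 ((smul_eq_of_mem_isotropy x.2 _).1 h1))

end QHam

end

theorem theorem3
    -- the compact connected Lie group `U`, with its inner product `(· | ·) = B`
    {F : Type*} [NormedAddCommGroup F] [NormedSpace ℝ F] [FiniteDimensional ℝ F]
    {U : Type*} [TopologicalSpace U] [ChartedSpace F U] [Group U] [LieGroup 𝓘(ℝ, F) ∞ U]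
    [T2Space U] [CompactSpace U] [ConnectedSpace U]
    (B : LinearMap.BilinForm ℝ (GroupLieAlgebra 𝓘(ℝ, F) U)) (hB : QHam.IsAdInvariantInner B)
    -- the quasi-Hamiltonian `U`-space `(M, σ, μ)`
    {E : Type*} [NormedAddCommGroup E] [NormedSpace ℝ E] [FiniteDimensional ℝ E]
    {M : Type*} [TopologicalSpace M] [ChartedSpace E M] [IsManifold 𝓘(ℝ, E) ∞ M] [T2Space M]
    [SecondCountableTopology M] [MulAction U M]
    (σ : QHam.FormField E M 2) (μ : M → U) (hM : QHam.IsQuasiHamiltonian B σ μ)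
    -- the closed subgroup `K`
    (K : Subgroup U) (hK : IsClosed (K : Set U)) :
    -- `L_K` is compact and Hausdorff, and acts freely on `M_K`
    CompactSpace (QHam.LK K) ∧ T2Space (QHam.LK K) ∧
    (∀ (l : QHam.LK K) (x : QHam.Isotropy M K), l • x = x → l = 1) ∧
    -- `μ` maps `M_K` to `N(K)`
    ∃ hμ : ∀ x : QHam.Isotropy M K, μ x ∈ QHam.Nor K,
    -- the smooth structures of the Lie subgroup `N(K)` and of the quotient Lie group `L_K`
    ∃ (a b : ℕ) (_ : ChartedSpace (EuclideanSpace ℝ (Fin a)) (QHam.Nor K))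
      (_ : ChartedSpace (EuclideanSpace ℝ (Fin b)) (QHam.LK K)),
      LieGroup (𝓡 a) ∞ (QHam.Nor K) ∧ LieGroup (𝓡 b) ∞ (QHam.LK K) ∧
      Manifold.IsSmoothEmbedding (𝓡 a) 𝓘(ℝ, F) ∞ (QHam.Nor K).subtype ∧
      Manifold.IsSubmersion (𝓡 a) (𝓡 b) ∞ (QHam.pK K) ∧
    -- the inner product induced by `B` on `Lie(L_K) = Lie(N(K)) / Lie(K)`, the latter being
    -- identified with the orthogonal complement of `Lie(K)` in `Lie(N(K))`
    ∃ B' : LinearMap.BilinForm ℝ (GroupLieAlgebra (𝓡 b) (QHam.LK K)),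
      QHam.IsAdInvariantInner B' ∧
      QHam.IsQuotientInner B (F₁ := EuclideanSpace ℝ (Fin a)) (QHam.Nor K).subtype (QHam.pK K) B' ∧
    -- `M_K` is the disjoint union of open `L_K`-stable subsets `P d`, where `P d` is an embedded
    -- submanifold of `M` of dimension `d`
    ∃ P : ℕ → SubMulAction (QHam.LK K) (QHam.Isotropy M K),
      (∀ x : QHam.Isotropy M K, ∃! d : ℕ, x ∈ P d) ∧
      ∀ d : ℕ, IsOpen (P d : Set (QHam.Isotropy M K)) ∧
        ∃ _ : ChartedSpace (EuclideanSpace ℝ (Fin d)) (P d),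
          IsManifold (𝓡 d) ∞ (P d) ∧
          Manifold.IsSmoothEmbedding (𝓡 d) 𝓘(ℝ, E) ∞
            (fun y : P d => ((y : QHam.Isotropy M K) : M)) ∧
          -- with the restriction of `σ` and `p_K ∘ μ`, it is a quasi-Hamiltonian `L_K`-space
          QHam.IsQuasiHamiltonian B'
            (σ.pullback (E' := EuclideanSpace ℝ (Fin d))
              (fun y : P d => ((y : QHam.Isotropy M K) : M)))
            (fun y : P d =>
              QHam.pK K ⟨μ ((y : QHam.Isotropy M K) : M), hμ (y : QHam.Isotropy M K)⟩) := by
  have hgrp : IsTopologicalGroup U := topologicalGroup_of_lieGroup 𝓘(ℝ, F) ∞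
  have hsm := hM.smooth_action
  have hN := QHam.isClosed_nor hK
  have hNc : CompactSpace (QHam.Nor K) := isCompact_iff_compactSpace.1 hN.isCompact
  have hKN : IsClosed (K.subgroupOf (QHam.Nor K) : Set (QHam.Nor K)) :=
    hK.preimage continuous_subtype_val
  have hμ : ∀ x : QHam.Isotropy M K, μ x ∈ QHam.Nor K := fun x =>
    QHam.mem_nor_of_commute fun k hk => QHam.conj_momentum_eq hM.equivariant x.2 hk
  obtain ⟨a, csN, hN1, hi⟩ := QHam.exists_lieSubgroup (F := F) (QHam.Nor K) hN
  obtain ⟨b, csL, hL1, hp⟩ := QHam.exists_lieQuotient (F := EuclideanSpace ℝ (Fin a))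
    (K.subgroupOf (QHam.Nor K)) hKN
  have hinj := QHam.mD_injective_of_isImmersion hi.isImmersion 1
  obtain ⟨B', s, hs1, hs2, hsymm', hpos', hAd', hq⟩ := QHam.exists_quotient_inner hp
    (QuotientGroup.mk'_surjective _) (QHam.norForm (F := F) K (EuclideanSpace ℝ (Fin a)) B)
    (fun X Y => hB.symm _ _)
    (fun X hX => hB.pos _ fun h => hX (hinj (h.trans (map_zero _).symm)))
    (QHam.norForm_mAd (F := F) hi B hB.ad_invariant)
  -- The anonymous dimension is that of the fixed tangent space at `x`, so membership in its stratum
  -- holds by definition and uniqueness is immediate.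
  refine ⟨inferInstance, inferInstance, QHam.eq_one_of_smul_eq, hμ, a, b, csN, csL, hN1, hL1, hi,
    hp, B', ⟨hsymm', hpos', hAd'⟩, fun X Y h => hq X Y fun Z hZ => (h Z hZ).1,
    QHam.stratum F E M K, fun x => ⟨_, QHam.mem_stratum.2 rfl, fun d hd =>
      (QHam.mem_stratum.1 hd).symm⟩, fun d => ⟨QHam.isOpen_stratum hK d, ?_⟩⟩
  obtain ⟨csS, hS1, hι⟩ := QHam.exists_stratum_manifold (F := F) (E := E) (M := M) hK d
  exact ⟨csS, hS1, hι, QHam.isQuasiHamiltonian_restriction hK hi hp hι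
    (QHam.range_mD_stratum hι) hμ hB hM hsymm' hq hs1 hs2⟩
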